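/- \textbf{Setting.} Let $d\ge 1$, $1\le p<\infty$, and let $\Omega\subset\mathbb R^d$ be a bounded, open, uniformly convex domain. Let $f\in C(\bar\Omega)$ be uniformly positive, and let $u\in C^{3,1}(\bar\Omega)$ be the convex solution of $\det D^2u=f$ in $\Omega$, $u=0$ on $\partial\Omega$, with $0<\lambda I\le D^2u\le\Lambda I$ in $\Omega$. \textbf{Nodes.} Let $0<h\le\frac12$. The interior nodes $\mathcal N_h^I$ are the points $z$ of a lattice $b+h\mathbb Z^d$ ($b\in\mathbb R^d$) that lie in $\Omega$ and satisfy $\operatorname{dist}(z,\partial\Omega)\ge h/2$. The boundary nodes $\mathcal N_h^B$ form a finite subset of $\partial\Omega$ with $\operatorname{dist}(x,\mathcal N_h^B)\le h$ for all $x\in\partial\Omega$. Put $\mathcal N_h=\mathcal N_h^I\cup\mathcal N_h^B$. \textbf{Triangulation.} Let $\mathcal T_h$ be a conforming simplicial triangulation, with vertex set $\mathcal N_h$, of a polyhedral region $\Omega_h\subset\bar\Omega$ that contains $\mathcal N_h^I$ in its interior. Assume that it is shape regular, $h_T\le\sigma\rho_T$ for every $d$-simplex $T$ ($h_T$ is the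 diameter of $T$ and $\rho_T$ the diameter of the largest ball contained in $T$), and translation invariant away from a boundary layer of width $R_0h$: if $z,z'\in\mathcal N_h^I$ both have distance at least $R_0h$ from $\partial\Omega$, then the translation by $z'-z$ maps each simplex of $\mathcal T_h$ with vertex $z$ to a simplex of $\mathcal T_h$. For $z\in\mathcal N_h^I$ let $\phi_z$ be the piecewise linear hat function of $z$, extended by $0$ outside $\Omega_h$, and let $f_z=\int_\Omega f\phi_z\,dx$. \textbf{Method.} Let $u_h:\mathcal N_h\to\mathbb R$ be a solution of the Oliker--Prussner method: $u_h=0$ on $\mathcal N_h^B$, and for every $z\in\mathcal N_h^I$ the set $$\partial u_h(z)=\{q\in\mathbb R^d:\ u_h(y)\ge u_h(z)+q\cdot(y-z)\ \ \forall y\in\mathcal N_h\}$$ is nonempty and has Lebesgue measure $|\partial u_h(z)|=f_z$. \textbf{Discrete norm.} A nodal function $v$ that vanishes on $\mathcal N_h^B$ is extended to $\bar\Omega$ by $\sum_{z\in\mathcal N_h^I}v(z)\phi_z$. For $0\ne e\in\mathbb Z^d$ and $z\in\mathcal N_h^I$ let $\rho_1,\rho_2\in(0,1]$ be the largest numbers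 in $(0,1]$ such that $z+\rho_1he\in\bar\Omega$ and $z-\rho_2he\in\bar\Omega$, and let $$\delta_ev(z)=\frac{\rho_2v(z+\rho_1he)-(\rho_1+\rho_2)v(z)+\rho_1v(z-\rho_2he)}{\rho_1\rho_2(\rho_1+\rho_2)|e|^2h^2/2},$$ which is the usual centered second difference if $z\pm he\in\bar\Omega$. Set $$\|v\|_{W^2_p(\mathcal N_h^I)}=\Big(\sum_{z\in\mathcal N_h^I}f_z\,|\delta_ev(z)|^p\Big)^{1/p}.$$ \textbf{Theorem.} Let $N_hu$ be the restriction of $u$ to $\mathcal N_h$. Then, for every $0\ne e\in\mathbb Z^d$, $$\|N_hu-u_h\|_{W^2_p(\mathcal N_h^I)}\le C\begin{cases}h^{1/p}&\text{if }p>d,\\ h^{1/d}\,(\ln(1/h))^{1/d}&\text{if }p\le d,\end{cases}$$ where $C$ depends only on $d$, $p$, an upper bound for $\|u\|_{C^{3,1}(\bar\Omega)}$, $\lambda$, $\Lambda$, $\sigma$ and $R_0$. -/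

import Mathlib

open scoped ENNReal

noncomputable section

namespace OlikerPrussner

/-- The space `ℝ^d` with its Euclidean norm. -/
abbrev Space (d : ℕ) : Type := EuclideanSpace ℝ (Fin d)

/-- The vector of `ℝ^d` with integer coordinates `k`. -/
def intVec {d : ℕ} (k : Fin d → ℤ) : Space d := WithLp.toLp 2 (fun i => (k i : ℝ))

/-! ### The continuous problem -/

/-- A bounded uniformly convex domain: an open bounded convex set such that, for one radius `R`,
every boundary point lies on a sphere of radius `R` whose closed ball contains the set. -/
structure IsUniformlyConvexDomain {d : ℕ} (Ω : Set (Space d)) : Prop where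
  isOpen : IsOpen Ω
  nonempty : Ω.Nonempty
  isBounded : Bornology.IsBounded Ω
  convex : Convex ℝ Ω
  uniform : ∃ R : ℝ, 0 < R ∧
    ∀ y ∈ frontier Ω, ∃ c : Space d, dist y c = R ∧ Ω ⊆ Metric.closedBall c R

/-- The Hessian matrix `D²u(x)`. -/
def hessian {d : ℕ} (u : Space d → ℝ) (x : Space d) : Matrix (Fin d) (Fin d) ℝ :=
  Matrix.of fun i j =>
    iteratedFDeriv ℝ 2 u x ![EuclideanSpace.single i (1 : ℝ), EuclideanSpace.single j (1 : ℝ)]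

/-- `u` is a (classical) convex solution of `det D²u = f` in `Ω`, `u = 0` on `∂Ω`. -/
structure IsConvexSolution {d : ℕ} (Ω : Set (Space d)) (f u : Space d → ℝ) : Prop where
  continuousOn : ContinuousOn u (closure Ω)
  contDiffOn : ContDiffOn ℝ 2 u Ω
  convexOn : ConvexOn ℝ (closure Ω) u
  det_eq : ∀ x ∈ Ω, (hessian u x).det = f x
  boundary : ∀ x ∈ frontier Ω, u x = 0

/-- The `C^{3,1}` norm over `Ω`: the suprema of the derivatives of order `0, …, 3` plus the
Lipschitz seminorm of the third derivative. -/
def c31Norm {d : ℕ} (Ω : Set (Space d)) (u : Space d → ℝ) : ℝ≥0∞ :=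
  (∑ k ∈ Finset.range 4, ⨆ x ∈ Ω, ENNReal.ofReal ‖iteratedFDeriv ℝ k u x‖) +
    ⨆ x ∈ Ω, ⨆ y ∈ Ω,
      edist (iteratedFDeriv ℝ 3 u x) (iteratedFDeriv ℝ 3 u y) / edist x y

/-- `u ∈ C^{3,1}(Ω̄)` for a bounded convex open set `Ω`; the Lipschitz bound on the third derivative
makes all derivatives of order at most three extend continuously to `Ω̄`. -/
structure IsC31 {d : ℕ} (Ω : Set (Space d)) (u : Space d → ℝ) : Prop where
  continuousOn : ContinuousOn u (closure Ω)
  contDiffOn : ContDiffOn ℝ 3 u Ω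
  norm_lt_top : c31Norm Ω u < ⊤

/-! ### Nodes and triangulation -/

/-- A translation invariant nodal set of spacing `h` in `Ω̄`. The interior nodes are the points of
the lattice `b + h ℤ^d` in `Ω` whose distance to `∂Ω` is at least `h / 2`; the boundary nodes are
finitely many points of `∂Ω` such that every point of `∂Ω` is within `h` of one of them. -/
structure NodalSet {d : ℕ} (Ω : Set (Space d)) (h : ℝ) where
  base : Space d
  inner : Finset (Space d)
  bdry : Finset (Space d)
  mem_inner : ∀ z, z ∈ inner ↔
    z ∈ Ω ∧ (∃ k : Fin d → ℤ, z = base + h • intVec k) ∧ h / 2 ≤ Metric.infDist z (frontier Ω)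
  bdry_subset : ∀ z ∈ bdry, z ∈ frontier Ω
  bdry_dense : ∀ x ∈ frontier Ω, ∃ z ∈ bdry, dist x z ≤ h

/-- All nodes, interior and boundary. -/
def NodalSet.nodes {d : ℕ} {Ω : Set (Space d)} {h : ℝ} (N : NodalSet Ω h) : Set (Space d) :=
  (N.inner : Set (Space d)) ∪ (N.bdry : Set (Space d))

/-- `ρ_T`: the diameter of the largest ball contained in `T`. -/
def inballDiam {d : ℕ} (T : Set (Space d)) : ℝ :=
  sSup {t : ℝ | 0 ≤ t ∧ ∃ c : Space d, Metric.closedBall c (t / 2) ⊆ T}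

/-- `K` is a (conforming) simplicial triangulation with vertex set the set of nodes: every simplex
is a face of a `d`-dimensional one, and the interior nodes lie in the interior of the triangulated
polyhedral region `K.space ⊆ Ω̄`. -/
structure IsTriangulation {d : ℕ} {Ω : Set (Space d)} {h : ℝ} (N : NodalSet Ω h)
    (K : Geometry.SimplicialComplex ℝ (Space d)) : Prop where
  vertices_eq : K.vertices = N.nodes
  pure : ∀ s ∈ K.faces, ∃ t ∈ K.faces, s ⊆ t ∧ t.card = d + 1
  inner_interior : ∀ z ∈ N.inner, z ∈ interior K.space

/-- Shape regularity with constant `σ`: `h_T ≤ σ ρ_T` for all `d`-dimensional simplices `T`. -/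
def IsShapeRegular {d : ℕ} (σ : ℝ) (K : Geometry.SimplicialComplex ℝ (Space d)) : Prop :=
  ∀ s ∈ K.faces, s.card = d + 1 →
    Metric.diam (convexHull ℝ (s : Set (Space d))) ≤
      σ * inballDiam (convexHull ℝ (s : Set (Space d)))

open Classical in
/-- The triangulation is translation invariant away from a boundary layer of width `R₀ h`: the
simplices around any two interior nodes at distance at least `R₀ h` from `∂Ω` are translates of each
other. -/
def IsTranslationInvariant {d : ℕ} {Ω : Set (Space d)} {h : ℝ} (N : NodalSet Ω h) (R₀ : ℝ)
    (K : Geometry.SimplicialComplex ℝ (Space d)) : Prop :=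
  ∀ z ∈ N.inner, ∀ z' ∈ N.inner,
    R₀ * h ≤ Metric.infDist z (frontier Ω) → R₀ * h ≤ Metric.infDist z' (frontier Ω) →
    ∀ s ∈ K.faces, z ∈ s → s.image (fun x => x + (z' - z)) ∈ K.faces

/-- The continuous piecewise linear interpolant on `K` of the nodal values `v`, extended by zero
outside the triangulated region. The set below has exactly one element if `x ∈ K.space`, namely
`∑ w_y v(y)` with `w` the barycentric coordinates of `x` in a simplex containing it, and it is empty
otherwise. -/
def interp {d : ℕ} (K : Geometry.SimplicialComplex ℝ (Space d)) (v : Space d → ℝ) (x : Space d) :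
    ℝ :=
  sSup {t : ℝ | ∃ s ∈ K.faces, ∃ w : Space d → ℝ, (∀ y ∈ s, 0 ≤ w y) ∧ ∑ y ∈ s, w y = 1 ∧
    ∑ y ∈ s, w y • y = x ∧ t = ∑ y ∈ s, w y * v y}

open Classical in
/-- The hat function of the node `z`. -/
def hat {d : ℕ} (K : Geometry.SimplicialComplex ℝ (Space d)) (z : Space d) : Space d → ℝ :=
  interp K (fun y => if y = z then 1 else 0)

/-! ### The Oliker–Prussner method -/

/-- The subdifferential at the node `z` of the nodal function `v`. Nodal functions are represented
by functions on `ℝ^d`, of which only the values at the nodes matter. -/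
def subdiff {d : ℕ} {Ω : Set (Space d)} {h : ℝ} (N : NodalSet Ω h) (v : Space d → ℝ)
    (z : Space d) : Set (Space d) :=
  {q | ∀ y ∈ N.nodes, v z + inner ℝ q (y - z) ≤ v y}

/-- The weight `f_z = ∫_Ω f φ_z`. -/
def weight {d : ℕ} (Ω : Set (Space d)) (f : Space d → ℝ)
    (K : Geometry.SimplicialComplex ℝ (Space d)) (z : Space d) : ℝ :=
  ∫ x in Ω, f x * hat K z x

/-- `uh` solves the Oliker–Prussner scheme: it is a convex nodal function that vanishes at the
boundary nodes, and `|∂uh(z)| = f_z` at every interior node `z`. -/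
structure IsOPSolution {d : ℕ} {Ω : Set (Space d)} {h : ℝ} (N : NodalSet Ω h)
    (K : Geometry.SimplicialComplex ℝ (Space d)) (f uh : Space d → ℝ) : Prop where
  convex : ∀ z ∈ N.inner, (subdiff N uh z).Nonempty
  boundary : ∀ z ∈ N.bdry, uh z = 0
  volume_eq : ∀ z ∈ N.inner,
    MeasureTheory.volume (subdiff N uh z) = ENNReal.ofReal (weight Ω f K z)

/-! ### The discrete `W^2_p` norm -/

/-- The largest `ρ ∈ (0, 1]` with `x + ρ a ∈ Ω̄`. -/
def stepLength {d : ℕ} (Ω : Set (Space d)) (x a : Space d) : ℝ :=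
  sSup {ρ : ℝ | 0 < ρ ∧ ρ ≤ 1 ∧ x + ρ • a ∈ closure Ω}

/-- The second difference `δ_e v (x)` of a function `v`. If `x ± h e ∈ Ω̄`, both step lengths are `1`
and this is `(v (x + h e) - 2 v x + v (x - h e)) / (|e|² h²)`. -/
def secondDiff {d : ℕ} (Ω : Set (Space d)) (h : ℝ) (e : Fin d → ℤ) (v : Space d → ℝ)
    (x : Space d) : ℝ :=
  let a : Space d := h • intVec e
  let ρ₁ := stepLength Ω x a
  let ρ₂ := stepLength Ω x (-a)
  (ρ₂ * v (x + ρ₁ • a) - (ρ₁ + ρ₂) * v x + ρ₁ * v (x - ρ₂ • a)) /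
    (ρ₁ * ρ₂ * (ρ₁ + ρ₂) * ‖intVec e‖ ^ 2 * h ^ 2 / 2)

/-- The weighted discrete `W^2_p` norm in direction `e`, over the interior nodes, of a nodal function
`v` (vanishing at the boundary nodes). Where the second difference needs a value at a point that is
not a node, it is the value of the piecewise linear interpolant `∑ v(z) φ_z`, which is `0` on
`∂Ω`. -/
def w2pNorm {d : ℕ} {Ω : Set (Space d)} {h : ℝ} (N : NodalSet Ω h)
    (K : Geometry.SimplicialComplex ℝ (Space d)) (f : Space d → ℝ) (p : ℝ) (e : Fin d → ℤ)
    (v : Space d → ℝ) : ℝ :=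
  (∑ z ∈ N.inner, weight Ω f K z * |secondDiff Ω h e (interp K v) z| ^ p) ^ (1 / p)

end OlikerPrussner

end

open scoped ENNReal Pointwise
noncomputable section
namespace OlikerPrussner
open MeasureTheory Set

/-! ### The Prékopa–Leindler and Brunn–Minkowski inequalities -/

/-! Write `w` for the error `u - u_h` or its negative. Two facts are proved: all second differences
of `w` are bounded by a constant `T`, and the weighted sum `∑ f_z |δ_e w(z)|` is `O(h)`. Since `g ^
p ≤ T ^ (p - 1) * g` for `0 ≤ g ≤ T`, they give the rate `h ^ (1/p)` for every `p ≥ 1`; for `p ≤ d`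
this is no worse than the claimed rate, because `h ≤ 1/2`.

Consistency. In the variable `x` with `q = ∇u(z) + h D²u(z) x`, the set `∂u(z)` at a node away from
the boundary is a perturbation of the Voronoi cell of `ℤ^d` for the quadratic form `D²u(z)`. The
exact cell tiles space, so it has volume one. The facets move by `O(h)`, but opposite facets move
consistently up to `O(h²)`, so the volume changes only by `O(h²)` (`cell_volume`). Hat functions of
a periodic triangulation integrate affine functions exactly, so `f_z = f(z) h^d + O(h^(d+2))`.
Together, `|∂u(z)| = f_z (1 + O(h²))` (`exists_consistency`).

Maximum norm. Where `a - b` is maximal, `∂a ⊆ ∂b`, so volumes can be compared. From below, `u_h` is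
compared with a barrier, a convex function of `u` with extra curvature in the layer of width `O(h)`
where consistency fails (`exists_lower_bound`). From above, near the boundary, a node is a convex
combination of a boundary node and a deep point, and convexity of `u_h` suffices
(`exists_upper_bound`). Hence `|u - u_h| = O(h²)`, and second differences are bounded.

Summed second differences. By Brunn–Minkowski, `|∂(w + η² u)(z)| ≤ f_z (η² + γ h²)^d` away from the
boundary (`exists_perturbation_volume`). Each plane of slope `η² ∇u(x)`, with `x` of depth of order
`h/η`, touches `w + η² u` from below at some node, and at a contact node `δ_e w ≥ -M η²`. By the
area formula the contact nodes carry all the mass except `O(h/η)` (`sum_noncontact_le`). Summing `η²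
* (h/η)` over dyadic `η ≥ h` is a geometric series, so the weighted sum is `O(h)`.

Constants may not depend on the domain. With `-μ²` the minimum of `u`, the bounds on `D²u` make the
domain comparable to a ball of radius `μ` (`exists_isRound`), and boundary estimates are scaled by
`μ`. -/

lemma real_volume_add_le {A B C : Set ℝ} (hA : MeasurableSet A) (hB : MeasurableSet B)
    (hAn : A.Nonempty) (hBn : B.Nonempty) (hC : ∀ a ∈ A, ∀ b ∈ B, a + b ∈ C) :
    volume A + volume B ≤ volume C := by
  have key : ∀ K ⊆ A, IsCompact K → ∀ L ⊆ B, IsCompact L → K.Nonempty → L.Nonempty →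
      volume K + volume L ≤ volume C := by
    intro K hKA hK L hLB hL hKn hLn
    obtain ⟨k, hk, hkmax⟩ := hK.exists_isGreatest hKn
    obtain ⟨l, hl, hlmin⟩ := hL.exists_isLeast hLn
    -- `K + min L` and `max K + L` lie side by side and share only one point.
    have h1 : (fun x => x + l) '' K ∪ (fun x => k + x) '' L ⊆ C := by
      rintro _ (⟨x, hx, rfl⟩ | ⟨x, hx, rfl⟩)
      · exact hC _ (hKA hx) _ (hLB hl)
      · exact hC _ (hKA hk) _ (hLB hx)
    have h2 : volume ((fun x => x + l) '' K ∩ (fun x => k + x) '' L) = 0 := by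
      refine measure_mono_null (t := {k + l}) ?_ (by simp)
      rintro _ ⟨⟨x, hx, rfl⟩, ⟨y, hy, hxy⟩⟩
      have := hkmax hx
      have := hlmin hy
      simp only [mem_singleton_iff]
      simp only at hxy
      linarith
    have hm : MeasurableSet ((fun x => k + x) '' L) :=
      (hL.image (by fun_prop)).measurableSet
    calc volume K + volume L
        = volume ((fun x => x + l) '' K) + volume ((fun x => k + x) '' L) := by
          simp only [image_add_right, image_add_left, measure_preimage_add,
            measure_preimage_add_right]
      _ = volume ((fun x => x + l) '' K ∪ (fun x => k + x) '' L) := by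
          rw [← measure_union_add_inter _ hm, h2, add_zero]
      _ ≤ volume C := measure_mono h1
  obtain ⟨a0, ha0⟩ := hAn
  obtain ⟨b0, hb0⟩ := hBn
  have e : ∀ U : Set ℝ, MeasurableSet U →
      volume U = ⨆ (K : Set ℝ) (_ : K ⊆ U ∧ IsCompact K), volume K := by
    intro U hU
    rw [hU.measure_eq_iSup_isCompact]
    simp only [iSup_and]
  rw [e A hA, e B hB]
  refine ENNReal.biSup_add_biSup_le' ⟨∅, by simp⟩ ⟨∅, by simp⟩ ?_
  intro K hK L hL
  -- The compact sets from inner regularity may be empty; inserting a point provides the extrema.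
  have := key (insert a0 K) (insert_subset ha0 hK.1) (hK.2.insert a0) (insert b0 L)
    (insert_subset hb0 hL.1) (hL.2.insert b0) (insert_nonempty _ _) (insert_nonempty _ _)
  refine le_trans ?_ this
  gcongr <;> exact subset_insert _ _

lemma ennreal_geom_mean_le {a b : ℝ} (ha : 0 < a) (hb : 0 < b) (hab : a + b = 1) (x y : ℝ≥0∞) :
    x ^ a * y ^ b ≤ ENNReal.ofReal a * x + ENNReal.ofReal b * y := by
  rcases eq_or_ne x ⊤ with rfl | hx
  · rw [ENNReal.mul_top (by simpa using ha)]; simp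
  rcases eq_or_ne y ⊤ with rfl | hy
  · rw [ENNReal.mul_top (by simpa using hb)]; simp
  lift x to NNReal using hx
  lift y to NNReal using hy
  lift a to NNReal using ha.le
  lift b to NNReal using hb.le
  have := NNReal.geom_mean_le_arith_mean2_weighted a b x y (by exact_mod_cast hab)
  rw [← ENNReal.coe_rpow_of_nonneg _ ha.le, ← ENNReal.coe_rpow_of_nonneg _ hb.le,
    ENNReal.ofReal_coe_nnreal, ENNReal.ofReal_coe_nnreal]
  exact_mod_cast this

lemma lintegral_eq_lintegral_superlevel {f : ℝ → ℝ≥0∞} (hf : Measurable f) (h1 : ∀ x, f x ≤ 1) :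
    ∫⁻ x, f x = ∫⁻ s in Ioo (0 : ℝ) 1, volume {x | ENNReal.ofReal s < f x} := by
  have h2 : ∀ x, ENNReal.ofReal (f x).toReal = f x := fun x =>
    ENNReal.ofReal_toReal (ne_top_of_le_ne_top ENNReal.one_ne_top (h1 x))
  have h3 := lintegral_eq_lintegral_meas_lt (volume : Measure ℝ) (f := fun x => (f x).toReal)
    (Filter.Eventually.of_forall fun x => ENNReal.toReal_nonneg) hf.ennreal_toReal.aemeasurable
  simp only [h2] at h3
  rw [h3]
  have h4 : Ioi (0 : ℝ) = Ioo 0 1 ∪ Ici 1 := by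
    rw [Ioo_union_Ici_eq_Ioi one_pos]
  rw [h4, lintegral_union measurableSet_Ici (by
    rw [Set.disjoint_left]; intro x hx hx'; exact absurd hx.2 (not_lt.2 hx'))]
  have h5 : ∫⁻ s in Ici (1 : ℝ), volume {x | s < (f x).toReal} = 0 := by
    rw [setLIntegral_congr_fun (g := fun _ => 0) measurableSet_Ici]
    · simp
    · intro s hs
      have : {x | s < (f x).toReal} = ∅ := by
        ext x
        simp only [mem_ofPred_eq, mem_empty_iff_false, iff_false, not_lt]
        refine le_trans ?_ hs
        exact ENNReal.toReal_le_of_le_ofReal zero_le_one (by simpa using h1 x)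
      simp [this]
  rw [h5, add_zero]
  refine setLIntegral_congr_fun measurableSet_Ioo fun s hs => ?_
  congr 1
  ext x
  simp only [mem_ofPred_eq]
  rw [ENNReal.ofReal_lt_iff_lt_toReal hs.1.le (ne_top_of_le_ne_top ENNReal.one_ne_top (h1 x))]

/-- With both suprema equal to one, the superlevel sets of `f` and `g` are nonempty for every level
`s < 1`, and `a {f > s} + b {g > s} ⊆ {h > s}`. Integrating the one-dimensional sumset inequality
over `s` bounds the arithmetic mean of the integrals, which dominates the geometric mean. -/
lemma prekopa_leindler_normalized {a b : ℝ} (ha : 0 < a) (hb : 0 < b) (hab : a + b = 1)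
    {f g h : ℝ → ℝ≥0∞} (hf : Measurable f) (hg : Measurable g) (hh : Measurable h)
    (hf1 : ⨆ x, f x = 1) (hg1 : ⨆ x, g x = 1)
    (H : ∀ x y, f x ^ a * g y ^ b ≤ h (a * x + b * y)) :
    (∫⁻ x, f x) ^ a * (∫⁻ x, g x) ^ b ≤ ∫⁻ x, h x := by
  have f1 : ∀ x, f x ≤ 1 := fun x => hf1 ▸ le_iSup f x
  have g1 : ∀ x, g x ≤ 1 := fun x => hg1 ▸ le_iSup g x
  refine (ennreal_geom_mean_le ha hb hab _ _).trans ?_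
  -- Truncation at one restricts the layer cake formula for `h` to the same levels.
  have h0 : ∫⁻ x, min (h x) 1 ≤ ∫⁻ x, h x := lintegral_mono fun x => min_le_left _ _
  refine le_trans ?_ h0
  rw [lintegral_eq_lintegral_superlevel hf f1, lintegral_eq_lintegral_superlevel hg g1,
    lintegral_eq_lintegral_superlevel (hh.min measurable_const) (fun x => min_le_right _ _)]
  have anti : ∀ k : ℝ → ℝ≥0∞, Measurable fun s : ℝ => volume {x | ENNReal.ofReal s < k x} := by
    intro k
    refine Antitone.measurable fun s t hst => measure_mono fun x hx => ?_
    exact lt_of_le_of_lt (ENNReal.ofReal_le_ofReal hst) hx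
  rw [← lintegral_const_mul _ (anti _), ← lintegral_const_mul _ (anti _),
    ← lintegral_add_left ((anti _).const_mul _)]
  refine setLIntegral_mono' measurableSet_Ioo fun s hs => ?_
  have hs1 : ENNReal.ofReal s < 1 := by
    rw [ENNReal.ofReal_lt_one]; exact hs.2
  obtain ⟨x0, hx0⟩ := lt_iSup_iff.1 (hf1 ▸ hs1)
  obtain ⟨y0, hy0⟩ := lt_iSup_iff.1 (hg1 ▸ hs1)
  have sc : ∀ (c : ℝ), 0 < c → ∀ A : Set ℝ, ENNReal.ofReal c * volume A = volume (c • A) := by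
    intro c hc A
    rw [Measure.addHaar_smul_of_nonneg _ hc.le]; simp
  rw [sc a ha, sc b hb]
  refine real_volume_add_le
    ((measurableSet_lt measurable_const hf).const_smul₀ a)
    ((measurableSet_lt measurable_const hg).const_smul₀ b)
    ⟨_, smul_mem_smul_set hx0⟩ ⟨_, smul_mem_smul_set hy0⟩ ?_
  rintro _ ⟨x, hx, rfl⟩ _ ⟨y, hy, rfl⟩
  simp only [mem_ofPred_eq, smul_eq_mul] at hx hy ⊢
  refine lt_min ?_ hs1
  refine lt_of_lt_of_le ?_ (H x y)
  have e : ENNReal.ofReal s = ENNReal.ofReal s ^ a * ENNReal.ofReal s ^ b := by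
    rw [← ENNReal.rpow_add _ _ (by simpa using hs.1) ENNReal.ofReal_ne_top, hab, ENNReal.rpow_one]
  rw [e]
  exact ENNReal.mul_lt_mul (ENNReal.rpow_lt_rpow hx ha) (ENNReal.rpow_lt_rpow hy hb)

/-- Dividing `f` and `g` by their suprema scales both sides by the same factor. -/
lemma prekopa_leindler_bounded {a b : ℝ} (ha : 0 < a) (hb : 0 < b) (hab : a + b = 1)
    {f g h : ℝ → ℝ≥0∞} (hf : Measurable f) (hg : Measurable g) (hh : Measurable h)
    (hf1 : ⨆ x, f x ≠ ⊤) (hg1 : ⨆ x, g x ≠ ⊤)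
    (H : ∀ x y, f x ^ a * g y ^ b ≤ h (a * x + b * y)) :
    (∫⁻ x, f x) ^ a * (∫⁻ x, g x) ^ b ≤ ∫⁻ x, h x := by
  set F := ⨆ x, f x with hF
  set G := ⨆ x, g x with hG
  rcases eq_or_ne F 0 with h0 | hF0
  · have : ∀ x, f x = 0 := by simpa [hF] using h0
    simp [this, ha]
  rcases eq_or_ne G 0 with h0 | hG0
  · have : ∀ x, g x = 0 := by simpa [hG] using h0
    simp [this, hb]
  have key := prekopa_leindler_normalized ha hb hab (f := fun x => F⁻¹ * f x)
    (g := fun x => G⁻¹ * g x) (h := fun x => (F⁻¹ ^ a * G⁻¹ ^ b) * h x)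
    (hf.const_mul _) (hg.const_mul _) (hh.const_mul _)
    (by rw [← ENNReal.mul_iSup, ← hF, ENNReal.inv_mul_cancel hF0 hf1])
    (by rw [← ENNReal.mul_iSup, ← hG, ENNReal.inv_mul_cancel hG0 hg1])
    (by
      intro x y
      rw [ENNReal.mul_rpow_of_nonneg _ _ ha.le, ENNReal.mul_rpow_of_nonneg _ _ hb.le,
        mul_mul_mul_comm]
      gcongr
      exact H x y)
  rw [lintegral_const_mul _ hf, lintegral_const_mul _ hg, lintegral_const_mul _ hh,
    ENNReal.mul_rpow_of_nonneg _ _ ha.le, ENNReal.mul_rpow_of_nonneg _ _ hb.le,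
    mul_mul_mul_comm] at key
  have c0 : F⁻¹ ^ a * G⁻¹ ^ b ≠ 0 := by
    have i1 : F⁻¹ ≠ 0 := ENNReal.inv_ne_zero.2 hf1
    have i2 : G⁻¹ ≠ 0 := ENNReal.inv_ne_zero.2 hg1
    refine mul_ne_zero (fun h => ?_) (fun h => ?_)
    · rcases ENNReal.rpow_eq_zero_iff.1 h with h | h
      exacts [i1 h.1, absurd h.2 (not_lt.2 ha.le)]
    · rcases ENNReal.rpow_eq_zero_iff.1 h with h | h
      exacts [i2 h.1, absurd h.2 (not_lt.2 hb.le)]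
  have c1 : F⁻¹ ^ a * G⁻¹ ^ b ≠ ⊤ :=
    ENNReal.mul_ne_top (ENNReal.rpow_ne_top_of_nonneg ha.le (ENNReal.inv_ne_top.2 hF0))
      (ENNReal.rpow_ne_top_of_nonneg hb.le (ENNReal.inv_ne_top.2 hG0))
  exact (ENNReal.mul_le_mul_iff_right c0 c1).1 key

/-- Truncation of `f` and `g` at height `n`, then monotone convergence. -/
lemma prekopa_leindler_real {a b : ℝ} (ha : 0 < a) (hb : 0 < b) (hab : a + b = 1)
    {f g h : ℝ → ℝ≥0∞} (hf : Measurable f) (hg : Measurable g) (hh : Measurable h)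
    (H : ∀ x y, f x ^ a * g y ^ b ≤ h (a * x + b * y)) :
    (∫⁻ x, f x) ^ a * (∫⁻ x, g x) ^ b ≤ ∫⁻ x, h x := by
  have mono : ∀ f : ℝ → ℝ≥0∞, Monotone fun (n : ℕ) x => min (f x) (n : ℝ≥0∞) := by
    intro f n m hnm x
    exact min_le_min le_rfl (by exact_mod_cast hnm)
  have lim : ∀ f : ℝ → ℝ≥0∞, Measurable f → Filter.Tendsto (fun n : ℕ => ∫⁻ x, min (f x) n)
      Filter.atTop (nhds (∫⁻ x, f x)) := by
    intro f hf
    refine lintegral_tendsto_of_tendsto_of_monotone (fun n => (hf.min measurable_const).aemeasurable)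
      (Filter.Eventually.of_forall fun x n m hnm => mono f hnm x)
      (Filter.Eventually.of_forall fun x => ?_)
    have := (tendsto_const_nhds (x := f x)).min ENNReal.tendsto_nat_nhds_top
    simpa using this
  have bdd : ∀ (f : ℝ → ℝ≥0∞) (n : ℕ), ⨆ x, min (f x) (n : ℝ≥0∞) ≠ ⊤ := fun f n =>
    ne_top_of_le_ne_top (ENNReal.natCast_ne_top n) (iSup_le fun x => min_le_right _ _)
  have step : ∀ n : ℕ, (∫⁻ x, min (f x) n) ^ a * (∫⁻ x, g x ⊓ n) ^ b ≤ ∫⁻ x, h x := by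
    intro n
    refine prekopa_leindler_bounded ha hb hab (hf.min measurable_const) (hg.min measurable_const)
      hh (bdd f n) (bdd g n) fun x y => le_trans ?_ (H x y)
    gcongr <;> exact min_le_left _ _
  rcases eq_or_ne (∫⁻ x, f x) 0 with h0 | hf0
  · rw [h0, ENNReal.zero_rpow_of_pos ha]; simp
  rcases eq_or_ne (∫⁻ x, g x) 0 with h0 | hg0
  · rw [h0, ENNReal.zero_rpow_of_pos hb]; simp
  have T := ENNReal.Tendsto.mul
    ((ENNReal.continuous_rpow_const (y := a)).continuousAt.tendsto.comp (lim f hf)) (Or.inl fun h => by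
      rcases ENNReal.rpow_eq_zero_iff.1 h with h | h
      exacts [hf0 h.1, absurd h.2 (not_lt.2 ha.le)])
    ((ENNReal.continuous_rpow_const (y := b)).continuousAt.tendsto.comp (lim g hg)) (Or.inl fun h => by
      rcases ENNReal.rpow_eq_zero_iff.1 h with h | h
      exacts [hg0 h.1, absurd h.2 (not_lt.2 hb.le)])
  exact le_of_tendsto' T step

/-- Induction by Tonelli: the inequality on slices is exactly the hypothesis of the one-dimensional
inequality for the slice integrals. -/
theorem prekopa_leindler {a b : ℝ} (ha : 0 < a) (hb : 0 < b) (hab : a + b = 1) (n : ℕ)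
    {f g h : (Fin n → ℝ) → ℝ≥0∞} (hf : Measurable f) (hg : Measurable g) (hh : Measurable h)
    (H : ∀ x y, f x ^ a * g y ^ b ≤ h (a • x + b • y)) :
    (∫⁻ x, f x) ^ a * (∫⁻ x, g x) ^ b ≤ ∫⁻ x, h x := by
  induction n with
  | zero =>
    simp only [lintegral_unique]
    have : volume (univ : Set (Fin 0 → ℝ)) = 1 := by
      simp [volume_pi]
    rw [this]
    rw [mul_one, mul_one, mul_one]
    have H' : ∀ u v, f u ^ a * g u ^ b ≤ h v := fun u v => by
      have := H u u
      rwa [Subsingleton.elim (a • u + b • u) v] at this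
    exact H' _ _
  | succ n ih =>
    let e := (MeasurableEquiv.piFinSuccAbove (fun _ : Fin (n + 1) => ℝ) 0).symm
    have he : MeasurePreserving e volume volume :=
      (volume_preserving_piFinSuccAbove (fun _ : Fin (n + 1) => ℝ) 0).symm
    have hE : ∀ k : (Fin (n + 1) → ℝ) → ℝ≥0∞, Measurable k →
        ∫⁻ x, k x = ∫⁻ s : ℝ, ∫⁻ y : Fin n → ℝ, k (e (s, y)) := by
      intro k hk
      rw [← he.lintegral_comp hk]
      exact lintegral_prod _ (hk.comp e.measurable).aemeasurable
    have hM : ∀ k : (Fin (n + 1) → ℝ) → ℝ≥0∞, Measurable k →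
        Measurable fun s : ℝ => ∫⁻ y : Fin n → ℝ, k (e (s, y)) := by
      intro k hk
      exact (hk.comp e.measurable).lintegral_prod_right'
    rw [hE f hf, hE g hg, hE h hh]
    refine prekopa_leindler_real ha hb hab (hM f hf) (hM g hg) (hM h hh) fun s t => ?_
    refine ih (hf.comp (e.measurable.comp measurable_prodMk_left))
      (hg.comp (e.measurable.comp measurable_prodMk_left))
      (hh.comp (e.measurable.comp measurable_prodMk_left)) fun x y => ?_
    refine (H (e (s, x)) (e (t, y))).trans (le_of_eq (congrArg h ?_))
    ext i
    refine Fin.cases ?_ (fun j => ?_) i <;>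
      simp [e, MeasurableEquiv.piFinSuccAbove, Fin.insertNthEquiv]

/-- The Brunn–Minkowski inequality. -/
theorem brunn_minkowski {d : ℕ} {X Y Z : Set (Space d)} (hX : MeasurableSet X)
    (hY : MeasurableSet Y) (hZ : MeasurableSet Z) (hXn : X.Nonempty) (hYn : Y.Nonempty)
    (hXY : ∀ x ∈ X, ∀ y ∈ Y, x + y ∈ Z) {a b : ℝ} (ha : 0 ≤ a) (hb : 0 ≤ b)
    (haX : ENNReal.ofReal (a ^ d) ≤ volume X) (hbY : ENNReal.ofReal (b ^ d) ≤ volume Y) :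
    ENNReal.ofReal ((a + b) ^ d) ≤ volume Z := by
  rcases ha.eq_or_lt with rfl | ha
  · obtain ⟨x, hx⟩ := hXn
    rw [zero_add]
    refine hbY.trans ?_
    rw [← measure_preimage_add volume (-x) Y]
    refine measure_mono fun y hy => ?_
    simpa using hXY x hx _ hy
  rcases hb.eq_or_lt with rfl | hb
  · obtain ⟨y, hy⟩ := hYn
    rw [add_zero]
    refine haX.trans ?_
    rw [← measure_preimage_add volume (-y) X]
    refine measure_mono fun x hx => ?_
    simpa using hXY _ hx y hy
  have hs : 0 < a + b := by positivity
  -- With these weights `X / s` and `Y / t` both have volume at least `(a + b) ^ d`, so the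
  -- geometric mean loses nothing.
  set s := a / (a + b) with hsdef
  set t := b / (a + b) with htdef
  have s0 : 0 < s := by positivity
  have t0 : 0 < t := by positivity
  have hst : s + t = 1 := by rw [hsdef, htdef]; field_simp
  have hvp := PiLp.volume_preserving_toLp (Fin d)
  let S : Set (Space d) → Set (Fin d → ℝ) := fun A => WithLp.toLp 2 ⁻¹' A
  have hSm : ∀ A : Set (Space d), MeasurableSet A → MeasurableSet (S A) := fun A hA =>
    hvp.measurable hA
  have hSv : ∀ A : Set (Space d), MeasurableSet A → volume (S A) = volume A := fun A hA =>
    hvp.measure_preimage hA.nullMeasurableSet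
  let X' := (s⁻¹) • S X
  let Y' := (t⁻¹) • S Y
  have PL := prekopa_leindler s0 t0 hst d
    (f := X'.indicator 1) (g := Y'.indicator 1) (h := (S Z).indicator 1)
    (measurable_one.indicator ((hSm X hX).const_smul₀ _))
    (measurable_one.indicator ((hSm Y hY).const_smul₀ _))
    (measurable_one.indicator (hSm Z hZ)) (by
      intro x y
      by_cases hx : x ∈ X'
      swap
      · rw [indicator_of_notMem hx, ENNReal.zero_rpow_of_pos s0]; simp
      by_cases hy : y ∈ Y'
      swap
      · rw [indicator_of_notMem hy, ENNReal.zero_rpow_of_pos t0]; simp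
      have hz : s • x + t • y ∈ S Z := by
        obtain ⟨x, hx, rfl⟩ := hx
        obtain ⟨y, hy, rfl⟩ := hy
        simp only [smul_smul, mul_inv_cancel₀ s0.ne', mul_inv_cancel₀ t0.ne', one_smul]
        exact hXY _ hx _ hy
      simp [hx, hy, hz])
  rw [lintegral_indicator_one ((hSm X hX).const_smul₀ _),
    lintegral_indicator_one ((hSm Y hY).const_smul₀ _), lintegral_indicator_one (hSm Z hZ),
    hSv Z hZ, Measure.addHaar_smul_of_nonneg _ (by positivity), hSv X hX,
    Measure.addHaar_smul_of_nonneg _ (by positivity), hSv Y hY] at PL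
  refine le_trans ?_ PL
  have h1 : ENNReal.ofReal ((a + b) ^ d) ≤
      ENNReal.ofReal (s⁻¹ ^ Module.finrank ℝ (Fin d → ℝ)) * volume X := by
    refine le_trans (le_of_eq ?_) (mul_le_mul_right haX _)
    rw [← ENNReal.ofReal_mul (by positivity), Module.finrank_fin_fun, ← mul_pow]
    congr 2
    rw [hsdef]; field_simp
  have h2 : ENNReal.ofReal ((a + b) ^ d) ≤
      ENNReal.ofReal (t⁻¹ ^ Module.finrank ℝ (Fin d → ℝ)) * volume Y := by
    refine le_trans (le_of_eq ?_) (mul_le_mul_right hbY _)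
    rw [← ENNReal.ofReal_mul (by positivity), Module.finrank_fin_fun, ← mul_pow]
    congr 2
    rw [htdef]; field_simp
  calc ENNReal.ofReal ((a + b) ^ d)
      = ENNReal.ofReal ((a + b) ^ d) ^ s * ENNReal.ofReal ((a + b) ^ d) ^ t := by
        rw [← ENNReal.rpow_add _ _ (by simp only [ne_eq, ENNReal.ofReal_eq_zero, not_le]; positivity)
          ENNReal.ofReal_ne_top, hst, ENNReal.rpow_one]
    _ ≤ _ := by gcongr

/-! ### Integer vectors and the tiling by unit cubes -/

variable {d : ℕ}

@[simp] lemma intVec_apply (k : Fin d → ℤ) (i : Fin d) : intVec k i = (k i : ℝ) := rfl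

@[simp] lemma intVec_zero : intVec (0 : Fin d → ℤ) = 0 := by ext; simp

@[simp] lemma intVec_add (k l : Fin d → ℤ) : intVec (k + l) = intVec k + intVec l := by ext; simp

@[simp] lemma intVec_sub (k l : Fin d → ℤ) : intVec (k - l) = intVec k - intVec l := by ext; simp

@[simp] lemma intVec_neg (k : Fin d → ℤ) : intVec (-k) = -intVec k := by ext; simp

lemma inner_intVec (k l : Fin d → ℤ) :
    inner ℝ (intVec k) (intVec l) = ((∑ i, k i * l i : ℤ) : ℝ) := by
  simp [PiLp.inner_apply, mul_comm]

lemma norm_intVec_sq (k : Fin d → ℤ) : ‖intVec k‖ ^ 2 = ((∑ i, k i * k i : ℤ) : ℝ) := by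
  rw [← real_inner_self_eq_norm_sq, inner_intVec]

lemma intVec_ne_zero {k : Fin d → ℤ} (hk : k ≠ 0) : intVec k ≠ 0 := by
  intro h
  apply hk
  ext i
  have := congrArg (fun v : Space d => v i) h
  simpa using this

lemma intVec_injective : Function.Injective (intVec (d := d)) := by
  intro k l h
  by_contra hne
  exact intVec_ne_zero (sub_ne_zero.2 hne) (by rw [intVec_sub, h, sub_self])

lemma one_le_norm_intVec {k : Fin d → ℤ} (hk : k ≠ 0) : 1 ≤ ‖intVec k‖ := by
  have h1 : 0 < ‖intVec k‖ ^ 2 := by have := norm_pos_iff.2 (intVec_ne_zero hk); positivity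
  have h2 : 1 ≤ ‖intVec k‖ ^ 2 := by
    rw [norm_intVec_sq] at h1 ⊢
    exact_mod_cast h1
  nlinarith [norm_nonneg (intVec k)]

lemma abs_apply_le_norm (x : Space d) (i : Fin d) : |x i| ≤ ‖x‖ := by
  simpa using PiLp.norm_apply_le x i

lemma finite_intVec_norm_le (n : ℝ) : {k : Fin d → ℤ | ‖intVec k‖ ≤ n}.Finite := by
  refine (finite_Icc (fun _ => -⌈n⌉) (fun _ => ⌈n⌉)).subset fun k hk => ?_
  have h : ∀ i, |k i| ≤ ⌈n⌉ := fun i => by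
    have h1 := (abs_apply_le_norm (intVec k) i).trans hk
    have h2 : ((|k i| : ℤ) : ℝ) ≤ (⌈n⌉ : ℝ) := by
      push_cast; exact h1.trans (Int.le_ceil n)
    exact_mod_cast h2
  exact ⟨fun i => (abs_le.1 (h i)).1, fun i => (abs_le.1 (h i)).2⟩

/-- The half-open unit cube. -/
def unitCube (d : ℕ) : Set (Space d) := {x | ∀ i, x i ∈ Ico (0 : ℝ) 1}

lemma unitCube_eq_preimage :
    unitCube d = WithLp.ofLp ⁻¹' (Set.pi Set.univ fun _ : Fin d => Ico (0 : ℝ) 1) := by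
  ext x; simp [unitCube]

lemma measurableSet_unitCube : MeasurableSet (unitCube d) := by
  rw [unitCube_eq_preimage]
  exact (PiLp.volume_preserving_ofLp (Fin d)).measurable
    (MeasurableSet.univ_pi fun _ => measurableSet_Ico)

lemma volume_unitCube : volume (unitCube d) = 1 := by
  rw [unitCube_eq_preimage, (PiLp.volume_preserving_ofLp (Fin d)).measure_preimage
    (MeasurableSet.univ_pi fun _ => measurableSet_Ico).nullMeasurableSet]
  simp [volume_pi_pi]

lemma norm_le_of_abs_apply_le {x : Space d} {c : ℝ} (h : ∀ i, |x i| ≤ c) :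
    ‖x‖ ≤ d * c := by
  have h1 : ‖x‖ ≤ ∑ i, |x i| := by
    have h2 : x = ∑ i, x i • EuclideanSpace.single i (1 : ℝ) := by
      ext j; simp [Finset.sum_apply, Pi.single_apply]
    calc ‖x‖ = ‖∑ i, x i • EuclideanSpace.single i (1 : ℝ)‖ := by rw [← h2]
      _ ≤ ∑ i, ‖x i • EuclideanSpace.single i (1 : ℝ)‖ := norm_sum_le _ _
      _ = ∑ i, |x i| := by simp [norm_smul]
  refine h1.trans ((Finset.sum_le_sum fun i _ => h i).trans ?_)
  simp

lemma norm_le_of_mem_unitCube {x : Space d} (hx : x ∈ unitCube d) : ‖x‖ ≤ d := by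
  have := norm_le_of_abs_apply_le (x := x) (c := 1) fun i => by
    rw [abs_of_nonneg (hx i).1]; exact (hx i).2.le
  simpa using this

/-- The vector of integer parts of the coordinates. -/
def floorVec (x : Space d) : Fin d → ℤ := fun i => ⌊x i⌋

lemma sub_floorVec_mem (x : Space d) : x - intVec (floorVec x) ∈ unitCube d := by
  intro i
  simp only [PiLp.sub_apply, intVec_apply, floorVec]
  exact ⟨Int.fract_nonneg _, Int.fract_lt_one _⟩

lemma eq_floorVec {x : Space d} {k : Fin d → ℤ} (h : x - intVec k ∈ unitCube d) :
    k = floorVec x := by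
  ext i
  have := h i
  simp only [PiLp.sub_apply, intVec_apply] at this
  symm
  rw [floorVec, Int.floor_eq_iff]
  constructor <;> linarith [this.1, this.2]

/-- The translate of the unit cube by an integer vector. -/
def cubeAt (k : Fin d → ℤ) : Set (Space d) := {x | x - intVec k ∈ unitCube d}

lemma measurableSet_cubeAt (k : Fin d → ℤ) : MeasurableSet (cubeAt k) :=
  (measurable_sub_const _) measurableSet_unitCube

lemma iUnion_cubeAt : ⋃ k, cubeAt (d := d) k = univ :=
  eq_univ_of_forall fun x => mem_iUnion.2 ⟨floorVec x, sub_floorVec_mem x⟩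

lemma pairwise_disjoint_cubeAt : Pairwise (Function.onFun Disjoint (cubeAt (d := d))) := by
  intro k l hkl
  rw [Function.onFun, Set.disjoint_left]
  intro x hx hx'
  exact hkl ((eq_floorVec hx).trans (eq_floorVec hx').symm)

lemma measurePreserving_sub_intVec (k : Fin d → ℤ) :
    MeasurePreserving (fun x : Space d => x - intVec k) volume volume :=
  measurePreserving_sub_right volume _

lemma lintegral_eq_lintegral_unitCube_tsum {F : Space d → ℝ≥0∞} (hF : Measurable F) :
    ∫⁻ x, F x = ∫⁻ x in unitCube d, ∑' k, F (x + intVec k) := by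
  have hk : ∀ k : Fin d → ℤ, Measurable fun x => F (x + intVec k) := fun k =>
    hF.comp (measurable_add_const _)
  rw [lintegral_tsum fun k => (hk k).aemeasurable]
  rw [← setLIntegral_univ, ← iUnion_cubeAt,
    lintegral_iUnion measurableSet_cubeAt pairwise_disjoint_cubeAt]
  refine tsum_congr fun k => ?_
  have := (measurePreserving_sub_intVec k).setLIntegral_comp_preimage
    (s := unitCube d) measurableSet_unitCube (f := fun x => F (x + intVec k))
    (hF.comp (measurable_add_const _))
  simp only [sub_add_cancel] at this
  exact this

/-- After folding onto the unit cube, the indicators of the integer translates sum to at most one at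
each point. The covering lemma below is the opposite inequality. -/
lemma volume_le_one_of_packing {S : Set (Space d)} (hS : MeasurableSet S)
    (h : ∀ k : Fin d → ℤ, k ≠ 0 → ∀ x ∈ S, x - intVec k ∉ S) : volume S ≤ 1 := by
  rw [← lintegral_indicator_one hS, lintegral_eq_lintegral_unitCube_tsum
    (measurable_one.indicator hS), ← volume_unitCube (d := d), ← setLIntegral_one]
  refine lintegral_mono fun x => ?_
  by_cases hx : ∃ k, x + intVec k ∈ S
  · obtain ⟨k, hk⟩ := hx
    rw [tsum_eq_single k]
    · exact indicator_le_self' (by simp) _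
    · intro l hl
      refine indicator_of_notMem (fun hl' => ?_) _
      refine h (l - k) (sub_ne_zero.2 hl) _ hl' ?_
      rw [intVec_sub]
      convert hk using 1
      abel
  · push Not at hx
    simp [indicator_of_notMem, hx]

lemma one_le_volume_of_covering {S : Set (Space d)} (hS : MeasurableSet S)
    (h : ∀ x : Space d, ∃ k : Fin d → ℤ, x + intVec k ∈ S) : 1 ≤ volume S := by
  rw [← lintegral_indicator_one hS, lintegral_eq_lintegral_unitCube_tsum
    (measurable_one.indicator hS), ← volume_unitCube (d := d), ← setLIntegral_one]
  refine lintegral_mono fun x => ?_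
  obtain ⟨k, hk⟩ := h x
  refine le_trans ?_ (ENNReal.le_tsum k)
  simp [hk]

/-! ### Measure of thin slabs -/

/-- About `1 / (2 δ)` translates of a thin set along `w` are pairwise disjoint and stay in a bounded
region, so each has measure `O(δ)` times that of their union. Since only the direction `w` is used,
slab bounds in directions orthogonal to `w` survive, and the construction can be iterated. -/
lemma exists_spread {T : Set (Space d)} (hT : MeasurableSet T) {ρ c a δ : ℝ} {u w : Space d}
    (hTρ : T ⊆ Metric.closedBall 0 ρ) (hw : ‖w‖ ≤ c) (huw : inner ℝ w u = 1) (hδ : 0 < δ)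
    (hTu : ∀ x ∈ T, a ≤ inner ℝ x u ∧ inner ℝ x u ≤ a + δ) :
    ∃ T' : Set (Space d), MeasurableSet T' ∧ T' ⊆ Metric.closedBall 0 (ρ + c) ∧
      (∀ x ∈ T', ∃ y ∈ T, ∃ s : ℝ, x = y + s • w) ∧
      volume T ≤ ENNReal.ofReal (4 * δ) * volume T' := by
  have hc : 0 ≤ c := (norm_nonneg w).trans hw
  rcases lt_or_ge (1 / 4) δ with h4 | h4
  · refine ⟨T, hT, hTρ.trans (Metric.closedBall_subset_closedBall (by linarith)),
      fun x hx => ⟨x, hx, 0, by simp⟩, ?_⟩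
    calc volume T = ENNReal.ofReal 1 * volume T := by simp
      _ ≤ _ := by gcongr; linarith
  -- The spacing `2 δ` separates slabs of width `δ`, and `N` is chosen so that the total shift is at
  -- most `w` while `4 δ N ≥ 1`.
  set N : ℕ := ⌊1 / (2 * δ)⌋₊ with hN
  have hN1 : (N : ℝ) * (2 * δ) ≤ 1 := by
    have := Nat.floor_le (a := 1 / (2 * δ)) (by positivity)
    calc (N : ℝ) * (2 * δ) ≤ 1 / (2 * δ) * (2 * δ) := by gcongr
      _ = 1 := by field_simp
  have hN2 : 1 ≤ 4 * δ * N := by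
    have h1 := Nat.lt_floor_add_one (1 / (2 * δ))
    rw [div_lt_iff₀ (by positivity)] at h1
    nlinarith
  let S : ℕ → Set (Space d) := fun i => (fun x => x - ((i : ℝ) * (2 * δ)) • w) ⁻¹' T
  have hSm : ∀ i, MeasurableSet (S i) := fun i => (measurable_sub_const _) hT
  have hSv : ∀ i, volume (S i) = volume T := fun i =>
    (measurePreserving_sub_right volume _).measure_preimage hT.nullMeasurableSet
  have hSin : ∀ i, ∀ x ∈ S i, a + i * (2 * δ) ≤ inner ℝ x u ∧
      inner ℝ x u ≤ a + i * (2 * δ) + δ := by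
    intro i x hx
    have := hTu _ hx
    rw [inner_sub_left, inner_smul_left, huw] at this
    simp only [RCLike.conj_to_real, mul_one] at this
    constructor <;> linarith [this.1, this.2]
  refine ⟨⋃ i ∈ Finset.range N, S i, Finset.measurableSet_biUnion _ fun i _ => hSm i, ?_, ?_, ?_⟩
  · refine iUnion₂_subset fun i hi x hx => ?_
    have h1 := hTρ hx
    rw [mem_closedBall_zero_iff] at h1 ⊢
    have hi' : (i : ℝ) ≤ N := by exact_mod_cast (Finset.mem_range.1 hi).le
    have h2 : ‖((i : ℝ) * (2 * δ)) • w‖ ≤ c := by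
      rw [norm_smul, Real.norm_of_nonneg (by positivity)]
      have : (i : ℝ) * (2 * δ) ≤ 1 := le_trans (by gcongr) hN1
      calc (i : ℝ) * (2 * δ) * ‖w‖ ≤ 1 * c := by gcongr
        _ = c := one_mul c
    calc ‖x‖ = ‖(x - ((i : ℝ) * (2 * δ)) • w) + ((i : ℝ) * (2 * δ)) • w‖ := by simp
      _ ≤ _ := (norm_add_le _ _).trans (add_le_add h1 h2)
  · intro x hx
    obtain ⟨i, -, hx⟩ := mem_iUnion₂.1 hx
    exact ⟨_, hx, (i : ℝ) * (2 * δ), by simp⟩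
  · rw [measure_biUnion_finset ?_ fun i _ => hSm i]
    · simp only [hSv, Finset.sum_const, Finset.card_range, nsmul_eq_mul]
      rw [← mul_assoc]
      calc volume T = ENNReal.ofReal 1 * volume T := by simp
        _ ≤ ENNReal.ofReal (4 * δ * N) * volume T := by gcongr
        _ = _ := by rw [ENNReal.ofReal_mul (by positivity), ENNReal.ofReal_natCast]
    · intro i _ j _ hij
      rw [Function.onFun, Set.disjoint_left]
      intro x hi hj
      have h1 := hSin i x hi
      have h2 := hSin j x hj
      rcases lt_or_gt_of_ne hij with h | h
      · have : (i : ℝ) + 1 ≤ j := by exact_mod_cast h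
        nlinarith [h1.2, h2.1]
      · have : (j : ℝ) + 1 ≤ i := by exact_mod_cast h
        nlinarith [h2.2, h1.1]

/-- The volume of the ball of radius `r`, as a real number. -/
def ballVol (d : ℕ) (r : ℝ) : ℝ := (volume (Metric.closedBall (0 : Space d) r)).toReal

lemma ballVol_nonneg (r : ℝ) : 0 ≤ ballVol d r := ENNReal.toReal_nonneg

lemma volume_closedBall_eq (r : ℝ) :
    volume (Metric.closedBall (0 : Space d) r) = ENNReal.ofReal (ballVol d r) :=
  (ENNReal.ofReal_toReal measure_closedBall_lt_top.ne).symm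

lemma volume_slab_le {T : Set (Space d)} (hT : MeasurableSet T) {ρ c a δ : ℝ} {u w : Space d}
    (hTρ : T ⊆ Metric.closedBall 0 ρ) (hw : ‖w‖ ≤ c) (huw : inner ℝ w u = 1) (hδ : 0 < δ)
    (hTu : ∀ x ∈ T, a ≤ inner ℝ x u ∧ inner ℝ x u ≤ a + δ) :
    volume T ≤ ENNReal.ofReal (4 * ballVol d (ρ + c) * δ) := by
  obtain ⟨T', -, h1, -, h2⟩ := exists_spread hT hTρ hw huw hδ hTu
  refine h2.trans ((mul_le_mul_right (measure_mono h1) _).trans (le_of_eq ?_))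
  rw [volume_closedBall_eq, ← ENNReal.ofReal_mul (by positivity)]
  congr 1
  ring

/-- Spreading along a vector orthogonal to `v` keeps the slab for `v` intact, so each slab
contributes its own factor `δ`. -/
lemma volume_two_slabs_le {T : Set (Space d)} (hT : MeasurableSet T) {ρ c a b δ : ℝ}
    {u v w w' : Space d} (hTρ : T ⊆ Metric.closedBall 0 ρ) (hw : ‖w‖ ≤ c) (hw' : ‖w'‖ ≤ c)
    (huw : inner ℝ w u = 1) (hvw : inner ℝ w v = 0) (hvw' : inner ℝ w' v = 1) (hδ : 0 < δ)
    (hTu : ∀ x ∈ T, a ≤ inner ℝ x u ∧ inner ℝ x u ≤ a + δ)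
    (hTv : ∀ x ∈ T, b ≤ inner ℝ x v ∧ inner ℝ x v ≤ b + δ) :
    volume T ≤ ENNReal.ofReal (16 * ballVol d (ρ + c + c) * δ ^ 2) := by
  obtain ⟨T', hT', h1, h2, h3⟩ := exists_spread hT hTρ hw huw hδ hTu
  have h4 := volume_slab_le hT' h1 hw' hvw' hδ (a := b) (fun x hx => by
    obtain ⟨y, hy, s, rfl⟩ := h2 x hx
    rw [inner_add_left, inner_smul_left, hvw]
    simpa using hTv y hy)
  refine h3.trans ((mul_le_mul_right h4 _).trans (le_of_eq ?_))
  rw [← ENNReal.ofReal_mul (by positivity)]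
  congr 1
  ring

/-! ### The volume of perturbed Voronoi cells -/

/-- Solving `A y = w`, with the norm bound from coercivity, carries vectors dual to integer vectors
over to vectors dual to the facet normals `A k`. -/
lemma exists_dual_pair {A : Space d →L[ℝ] Space d} {lam : ℝ} (hlam : 0 < lam)
    (hA : ∀ x y, inner ℝ (A x) y = inner ℝ x (A y))
    (hcoer : ∀ x, lam * ‖x‖ ^ 2 ≤ inner ℝ (A x) x) (w : Space d) :
    ∃ y : Space d, ‖y‖ ≤ ‖w‖ / lam ∧ ∀ v, inner ℝ y (A v) = inner ℝ w v := by
  have hbd : ∀ x, lam * ‖x‖ ≤ ‖A x‖ := by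
    intro x
    rcases eq_or_ne x 0 with rfl | hx
    · simp
    have h1 := (hcoer x).trans (real_inner_le_norm _ _)
    have h2 : 0 < ‖x‖ := norm_pos_iff.2 hx
    nlinarith
  have hinj : Function.Injective A.toLinearMap := by
    rw [← LinearMap.ker_eq_bot, LinearMap.ker_eq_bot']
    intro x hx
    have h1 := hbd x
    have h2 : A x = 0 := hx
    rw [h2, norm_zero] at h1
    by_contra hne
    have := norm_pos_iff.2 hne
    nlinarith
  obtain ⟨y, hy⟩ := LinearMap.injective_iff_surjective.1 hinj w
  have hy' : A y = w := hy
  refine ⟨y, ?_, fun v => by rw [← hA, hy']⟩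
  rw [le_div_iff₀ hlam, mul_comm, ← hy']
  exact hbd y

/-- The unique vector `w` in the plane of `p, q` with `⟪w, p⟫ = 1` and `⟪w, q⟫ = 0`. -/
lemma exists_biorthogonal {p q : Space d} {D n : ℝ} (hp : ‖p‖ ≤ n) (hq : ‖q‖ ≤ n)
    (hD : D = ‖p‖ ^ 2 * ‖q‖ ^ 2 - inner ℝ p q ^ 2) (hD1 : 1 ≤ D) :
    ∃ w : Space d, ‖w‖ ≤ 2 * n ^ 3 ∧ inner ℝ w p = 1 ∧ inner ℝ w q = 0 := by
  have hn : 0 ≤ n := (norm_nonneg p).trans hp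
  refine ⟨D⁻¹ • (‖q‖ ^ 2 • p - inner ℝ p q • q), ?_, ?_, ?_⟩
  · have h1 : |inner ℝ p q| ≤ n * n := (abs_real_inner_le_norm p q).trans (by gcongr)
    rw [norm_smul, Real.norm_of_nonneg (by positivity)]
    have h2 : ‖‖q‖ ^ 2 • p - inner ℝ p q • q‖ ≤ 2 * n ^ 3 := by
      refine (norm_sub_le _ _).trans ?_
      rw [norm_smul, norm_smul, Real.norm_of_nonneg (by positivity), Real.norm_eq_abs]
      calc ‖q‖ ^ 2 * ‖p‖ + |inner ℝ p q| * ‖q‖ ≤ n ^ 2 * n + (n * n) * n := by gcongr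
        _ = _ := by ring
    calc D⁻¹ * _ ≤ 1 * (2 * n ^ 3) := by
          gcongr
          exact inv_le_one_of_one_le₀ hD1
      _ = _ := one_mul _
  · simp only [inner_smul_left, inner_sub_left, real_inner_self_eq_norm_sq,
      RCLike.conj_to_real, real_inner_comm p q]
    rw [inv_mul_eq_one₀ (by positivity), hD]
    ring
  · simp only [inner_smul_left, inner_sub_left, real_inner_self_eq_norm_sq, RCLike.conj_to_real]
    ring

/-- The Gram determinant is a nonnegative integer. This gives a uniform transversality of
non-parallel facets. -/
lemma gram_eq_zero_or_one_le (k l : Fin d → ℤ) :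
    ‖intVec k‖ ^ 2 * ‖intVec l‖ ^ 2 - inner ℝ (intVec k) (intVec l) ^ 2 = 0 ∨
      1 ≤ ‖intVec k‖ ^ 2 * ‖intVec l‖ ^ 2 - inner ℝ (intVec k) (intVec l) ^ 2 := by
  have h0 : 0 ≤ ‖intVec k‖ ^ 2 * ‖intVec l‖ ^ 2 - inner ℝ (intVec k) (intVec l) ^ 2 := by
    have h1 := abs_real_inner_le_norm (intVec k) (intVec l)
    have h2 := pow_le_pow_left₀ (abs_nonneg _) h1 2
    rw [sq_abs, mul_pow] at h2
    linarith
  rw [norm_intVec_sq, norm_intVec_sq, inner_intVec] at h0 ⊢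
  norm_cast at h0 ⊢
  omega

lemma exists_smul_of_gram_eq_zero {p q : Space d} (hp : p ≠ 0)
    (h : ‖p‖ ^ 2 * ‖q‖ ^ 2 - inner ℝ p q ^ 2 = 0) : ∃ c : ℝ, q = c • p := by
  refine ⟨inner ℝ p q / ‖p‖ ^ 2, ?_⟩
  have hp' : ‖p‖ ≠ 0 := norm_ne_zero_iff.2 hp
  rw [← sub_eq_zero, ← norm_eq_zero, ← sq_eq_zero_iff, norm_sub_sq_real, inner_smul_right,
    norm_smul, real_inner_comm p q, mul_pow, Real.norm_eq_abs, sq_abs]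
  field_simp
  linarith

section Cell

variable (A : Space d →L[ℝ] Space d)

/-- The polytope `{x | ⟪x, A k⟫ ≤ β k for all integer vectors 0 < |k| ≤ n}`. -/
def cell (n : ℝ) (β : (Fin d → ℤ) → ℝ) : Set (Space d) :=
  {x | ∀ k : Fin d → ℤ, k ≠ 0 → ‖intVec k‖ ≤ n → inner ℝ x (A (intVec k)) ≤ β k}

lemma measurableSet_cell (n : ℝ) (β : (Fin d → ℤ) → ℝ) : MeasurableSet (cell A n β) := by
  have : cell A n β = ⋂ k : Fin d → ℤ, ⋂ _ : k ≠ 0 ∧ ‖intVec k‖ ≤ n,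
      {x | inner ℝ x (A (intVec k)) ≤ β k} := by
    ext x; simp [cell]
  rw [this]
  exact MeasurableSet.iInter fun k => MeasurableSet.iInter fun _ =>
    (isClosed_le (by fun_prop) (by fun_prop)).measurableSet

/-- The value of the quadratic form of `A` at an integer vector. -/
def qf (k : Fin d → ℤ) : ℝ := inner ℝ (A (intVec k)) (intVec k)

/-- The part of the ball of radius `ρ` that is close to the facet hyperplanes of `k` and `l`. -/
def nearTwo (ρ η : ℝ) (k l : Fin d → ℤ) : Set (Space d) :=
  {x | ‖x‖ ≤ ρ ∧ |inner ℝ x (A (intVec k)) - qf A k / 2| ≤ η ∧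
    |inner ℝ x (A (intVec l)) - qf A l / 2| ≤ η}

lemma measurableSet_nearTwo (ρ η : ℝ) (k l : Fin d → ℤ) : MeasurableSet (nearTwo A ρ η k l) := by
  have h1 : IsClosed {x : Space d | ‖x‖ ≤ ρ} := isClosed_le (by fun_prop) (by fun_prop)
  have h2 : IsClosed {x : Space d | |inner ℝ x (A (intVec k)) - qf A k / 2| ≤ η} :=
    isClosed_le (by fun_prop) (by fun_prop)
  have h3 : IsClosed {x : Space d | |inner ℝ x (A (intVec l)) - qf A l / 2| ≤ η} :=
    isClosed_le (by fun_prop) (by fun_prop)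
  exact (h1.inter (h2.inter h3)).measurableSet

/-- A slab of the ball of radius `ρ` between two hyperplanes orthogonal to `A k`. -/
def slab (ρ a b : ℝ) (k : Fin d → ℤ) : Set (Space d) :=
  {x | ‖x‖ ≤ ρ ∧ a ≤ inner ℝ x (A (intVec k)) ∧ inner ℝ x (A (intVec k)) ≤ b}

lemma measurableSet_slab (ρ a b : ℝ) (k : Fin d → ℤ) : MeasurableSet (slab A ρ a b k) := by
  have h1 : IsClosed {x : Space d | ‖x‖ ≤ ρ} := isClosed_le (by fun_prop) (by fun_prop)
  have h2 : IsClosed {x : Space d | a ≤ inner ℝ x (A (intVec k))} :=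
    isClosed_le (by fun_prop) (by fun_prop)
  have h3 : IsClosed {x : Space d | inner ℝ x (A (intVec k)) ≤ b} :=
    isClosed_le (by fun_prop) (by fun_prop)
  exact (h1.inter (h2.inter h3)).measurableSet

variable {A} {lam M : ℝ} (hlam : 0 < lam)
    (hA : ∀ x y, inner ℝ (A x) y = inner ℝ x (A y))
    (hcoer : ∀ x, lam * ‖x‖ ^ 2 ≤ inner ℝ (A x) x)

include hlam hA hcoer

lemma volume_slab_set_le {ρ n a b δ : ℝ} {k : Fin d → ℤ} (hk : k ≠ 0) (hkn : ‖intVec k‖ ≤ n)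
    (hδ : 0 < δ) (hab : b ≤ a + δ) :
    volume (slab A ρ a b k) ≤ ENNReal.ofReal (4 * ballVol d (ρ + n / lam) * δ) := by
  have h1 := one_le_norm_intVec hk
  obtain ⟨y, hy, hy'⟩ := exists_dual_pair hlam hA hcoer ((‖intVec k‖ ^ 2)⁻¹ • intVec k)
  refine volume_slab_le (measurableSet_slab A ρ a b k) (u := A (intVec k)) (w := y) (a := a)
    (fun x hx => mem_closedBall_zero_iff.2 hx.1) (hy.trans ?_) ?_ hδ
    fun x hx => ⟨hx.2.1, hx.2.2.trans hab⟩
  · gcongr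
    rw [norm_smul, norm_inv, norm_pow, norm_norm]
    calc (‖intVec k‖ ^ 2)⁻¹ * ‖intVec k‖ ≤ 1 * n := by
          gcongr
          exact inv_le_one_of_one_le₀ (one_le_pow₀ h1)
      _ = n := one_mul n
  · rw [hy', inner_smul_left, real_inner_self_eq_norm_sq]
    simp only [RCLike.conj_to_real]
    exact inv_mul_cancel₀ (by positivity)

/-- If `k` and `l` are not parallel, the set lies in two transversal slabs of width `2 η`. If they
are parallel, the two bisectors are distinct parallel hyperplanes whose distance is bounded below,
and for small `η` the set is empty. -/
lemma volume_nearTwo_le {ρ n η : ℝ} {k l : Fin d → ℤ} (hk : k ≠ 0) (hl : l ≠ 0) (hkl : k ≠ l)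
    (hkn : ‖intVec k‖ ≤ n) (hln : ‖intVec l‖ ≤ n) (hη : 0 < η) (hη' : (1 + n) * η < lam / 2) :
    volume (nearTwo A ρ η k l) ≤
      ENNReal.ofReal (64 * ballVol d (ρ + 2 * n ^ 3 / lam + 2 * n ^ 3 / lam) * η ^ 2) := by
  rcases gram_eq_zero_or_one_le k l with h0 | h1
  · have : nearTwo A ρ η k l = ∅ := by
      rw [eq_empty_iff_forall_notMem]
      rintro x ⟨-, hx1, hx2⟩
      obtain ⟨c, hc⟩ := exists_smul_of_gram_eq_zero (intVec_ne_zero hk) h0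
      have e1 : inner ℝ x (A (intVec l)) = c * inner ℝ x (A (intVec k)) := by
        rw [hc, map_smul, inner_smul_right]
      have e2 : qf A l = c ^ 2 * qf A k := by
        rw [qf, qf, hc, map_smul, inner_smul_right, inner_smul_left]
        simp only [RCLike.conj_to_real]
        ring
      have e3 : |c| ≤ n := by
        have := congrArg norm hc
        rw [norm_smul, Real.norm_eq_abs] at this
        have := one_le_norm_intVec hk
        nlinarith [abs_nonneg c]
      -- Both `l` and `k - l` are nonzero integer vectors, hence of norm at least one.
      have e4 : 1 ≤ |c| * |1 - c| * ‖intVec k‖ ^ 2 := by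
        have n1 : ‖intVec l‖ = |c| * ‖intVec k‖ := by rw [hc, norm_smul, Real.norm_eq_abs]
        have n2 : ‖intVec (k - l)‖ = |1 - c| * ‖intVec k‖ := by
          rw [intVec_sub, hc, ← Real.norm_eq_abs, ← norm_smul, sub_smul, one_smul]
        have n3 := one_le_norm_intVec hl
        have n4 := one_le_norm_intVec (sub_ne_zero.2 hkl)
        calc (1 : ℝ) ≤ ‖intVec l‖ * ‖intVec (k - l)‖ := by nlinarith
          _ = _ := by rw [n1, n2]; ring
      have e5 : lam * ‖intVec k‖ ^ 2 ≤ qf A k := hcoer _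
      rw [e1, e2] at hx2
      have e6 : |c| * |1 - c| * (qf A k / 2) ≤ (1 + |c|) * η := by
        have : c * (1 - c) * (qf A k / 2) =
            (c * inner ℝ x (A (intVec k)) - c ^ 2 * qf A k / 2) -
              c * (inner ℝ x (A (intVec k)) - qf A k / 2) := by ring
        have h7 : |c * (1 - c) * (qf A k / 2)| ≤ (1 + |c|) * η := by
          rw [this]
          refine (abs_sub _ _).trans ?_
          rw [abs_mul]
          nlinarith [abs_nonneg c]
        have h8 : 0 ≤ qf A k := le_trans (by positivity) e5
        rwa [abs_mul, abs_mul, abs_of_nonneg (by positivity : 0 ≤ qf A k / 2)] at h7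
      have e7 : |c| * |1 - c| * (lam * ‖intVec k‖ ^ 2 / 2) ≤ (1 + n) * η := by
        calc _ ≤ |c| * |1 - c| * (qf A k / 2) := by gcongr
          _ ≤ (1 + |c|) * η := e6
          _ ≤ _ := by gcongr
      nlinarith
    rw [this]; simp
  · have h2 : 1 ≤ ‖intVec l‖ ^ 2 * ‖intVec k‖ ^ 2 - inner ℝ (intVec l) (intVec k) ^ 2 := by
      rw [real_inner_comm, mul_comm]; exact h1
    obtain ⟨w, hw, hw1, hw2⟩ := exists_biorthogonal hkn hln rfl h1
    obtain ⟨w', hw', hw1', hw2'⟩ := exists_biorthogonal hln hkn rfl h2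
    obtain ⟨y, hy, hy1⟩ := exists_dual_pair hlam hA hcoer w
    obtain ⟨y', hy', hy1'⟩ := exists_dual_pair hlam hA hcoer w'
    have key := volume_two_slabs_le (measurableSet_nearTwo A ρ η k l) (ρ := ρ)
      (c := 2 * n ^ 3 / lam) (a := qf A k / 2 - η) (b := qf A l / 2 - η) (δ := 2 * η)
      (u := A (intVec k)) (v := A (intVec l)) (w := y) (w' := y')
      (fun x hx => mem_closedBall_zero_iff.2 hx.1)
      (hy.trans (by gcongr)) (hy'.trans (by gcongr)) (by rw [hy1, hw1]) (by rw [hy1, hw2])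
      (by rw [hy1', hw1']) (by positivity)
      (fun x hx => by have := abs_le.1 hx.2.1; constructor <;> linarith [this.1, this.2])
      (fun x hx => by have := abs_le.1 hx.2.2; constructor <;> linarith [this.1, this.2])
    refine key.trans (le_of_eq ?_)
    congr 1
    ring

/-- A lattice point nearest to `x` in the norm of `A` works, so the exact Voronoi cell covers space
modulo the lattice. -/
lemma exists_reduced (x : Space d) : ∃ k : Fin d → ℤ, ∀ l : Fin d → ℤ,
    inner ℝ (x - intVec k) (A (intVec l)) ≤ qf A l / 2 := by
  let Q : Space d → ℝ := fun y => inner ℝ (A y) y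
  have hfin : {k : Fin d → ℤ | Q (x - intVec k) ≤ Q x}.Finite := by
    refine (finite_intVec_norm_le (‖x‖ + (Q x / lam + 1))).subset fun k hk => ?_
    have h1 : lam * ‖x - intVec k‖ ^ 2 ≤ Q x := (hcoer _).trans hk
    have h2 : ‖x - intVec k‖ ^ 2 ≤ Q x / lam := by
      rw [le_div_iff₀ hlam]; linarith
    have h3 : ‖x - intVec k‖ ≤ Q x / lam + 1 := by nlinarith [norm_nonneg (x - intVec k)]
    have h4 : ‖intVec k‖ ≤ ‖x‖ + ‖x - intVec k‖ := by
      have := norm_sub_le x (x - intVec k)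
      simpa using this
    simp only [mem_ofPred_eq]
    linarith
  obtain ⟨k, hk, hmin⟩ := exists_min_image _ (fun k => Q (x - intVec k)) hfin
    ⟨0, by simp⟩
  refine ⟨k, fun l => ?_⟩
  have h1 : Q (x - intVec k) ≤ Q (x - intVec (k + l)) := by
    by_cases h : Q (x - intVec (k + l)) ≤ Q x
    · exact hmin _ h
    · exact le_trans hk (not_le.1 h).le
  have h2 : x - intVec (k + l) = (x - intVec k) - intVec l := by rw [intVec_add]; abel
  rw [h2] at h1
  generalize x - intVec k = y at h1 ⊢
  simp only [Q, map_sub, inner_sub_left, inner_sub_right] at h1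
  rw [hA y (intVec l), real_inner_comm y (A (intVec l))] at h1
  rw [qf]
  linarith

end Cell

lemma norm_le_of_inner_single_le {A : Space d →L[ℝ] Space d} {lam c : ℝ} (hlam : 0 < lam)
    (hA : ∀ x y, inner ℝ (A x) y = inner ℝ x (A y))
    (hcoer : ∀ x, lam * ‖x‖ ^ 2 ≤ inner ℝ (A x) x) {x : Space d}
    (h : ∀ k : Fin d → ℤ, ‖intVec k‖ = 1 → inner ℝ x (A (intVec k)) ≤ c) :
    ‖x‖ ≤ d * c / lam := by
  have e : ∀ i : Fin d, intVec (Pi.single i 1) = EuclideanSpace.single i (1 : ℝ) := by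
    intro i; ext j; simp [Pi.single_apply]
  have h1 : ∀ i, |A x i| ≤ c := by
    intro i
    have n1 : ‖intVec (Pi.single i 1 : Fin d → ℤ)‖ = 1 := by rw [e]; simp
    have h2 := h (Pi.single i 1) n1
    have h3 := h (-Pi.single i 1) (by rw [intVec_neg, norm_neg, n1])
    rw [intVec_neg, map_neg, inner_neg_right] at h3
    rw [← hA, e, EuclideanSpace.inner_single_right] at h2 h3
    simp only [RCLike.conj_to_real, one_mul] at h2 h3
    rw [abs_le]; constructor <;> linarith
  have h2 := norm_le_of_abs_apply_le h1
  rw [le_div_iff₀ hlam]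
  have h3 : lam * ‖x‖ ^ 2 ≤ ‖A x‖ * ‖x‖ := (hcoer x).trans (real_inner_le_norm _ _)
  rcases eq_or_ne x 0 with rfl | hx
  · simpa using (norm_nonneg (A (0 : Space d))).trans h2
  · have := norm_pos_iff.2 hx
    nlinarith

/-- The exact Voronoi cell `β k = qf A k / 2` has volume one. Under a perturbation of size `t`, the
constraints for `k` and `-k` together fail to match under translation by `k` only in a slab of width
`O(t²)`. Removing these slabs makes the cell pack; adding them and the points near two bisectors at
once, again of measure `O(t²)`, makes it cover. The radius `ρ` is fixed before `n` since overlaps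
only involve `‖k‖ ≤ 2 ρ ≤ n`, while `C` and `t₀` depend on the number of constraints. -/
theorem cell_volume {lam M K : ℝ} (d : ℕ) (hlam : 0 < lam) (hM : 0 ≤ M) (hK : 0 < K) :
    ∃ ρ : ℝ, 0 < ρ ∧ ∀ n : ℝ, 2 * ρ ≤ n → 1 ≤ n → ∃ C t₀ : ℝ, 0 ≤ C ∧ 0 < t₀ ∧ t₀ ≤ 1 ∧
      ∀ A : Space d →L[ℝ] Space d, (∀ x y, inner ℝ (A x) y = inner ℝ x (A y)) →
      (∀ x, lam * ‖x‖ ^ 2 ≤ inner ℝ (A x) x) → ‖A‖ ≤ M →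
      ∀ t, 0 < t → t ≤ t₀ → ∀ β : (Fin d → ℤ) → ℝ,
      (∀ k, ‖intVec k‖ ≤ n → |β k - qf A k / 2| ≤ K * t) →
      (∀ k, ‖intVec k‖ ≤ n → |β k + β (-k) - qf A k| ≤ K * t ^ 2) →
      (∀ x ∈ cell A n β, ‖x‖ ≤ ρ) ∧
      volume (cell A n β) ≤ ENNReal.ofReal (1 + C * t ^ 2) ∧
      ENNReal.ofReal 1 ≤ volume (cell A n β) + ENNReal.ofReal (C * t ^ 2) := by
  classical
  set ρ : ℝ := d * (M / 2 + K) / lam + 1 with hρ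
  have hρ0 : 0 < ρ := by positivity
  refine ⟨ρ, hρ0, fun n hn hn1 => ?_⟩
  set S : Finset (Fin d → ℤ) := (finite_intVec_norm_le n).toFinset.filter (· ≠ 0) with hS
  set S2 : Finset (Fin d → ℤ) := (finite_intVec_norm_le (2 * n)).toFinset.filter (· ≠ 0) with hS2
  have memS : ∀ k, k ∈ S ↔ ‖intVec k‖ ≤ n ∧ k ≠ 0 := by intro k; simp [hS]
  have memS2 : ∀ k, k ∈ S2 ↔ ‖intVec k‖ ≤ 2 * n ∧ k ≠ 0 := by intro k; simp [hS2]
  set V1 := 4 * ballVol d (ρ + n / lam) * K with hV1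
  set V2 := 64 * ballVol d (ρ + 2 * (2 * n) ^ 3 / lam + 2 * (2 * n) ^ 3 / lam) * (2 * K) ^ 2
    with hV2
  have V10 : 0 ≤ V1 := by have := ballVol_nonneg (d := d) (ρ + n / lam); positivity
  have V20 : 0 ≤ V2 := by
    have := ballVol_nonneg (d := d) (ρ + 2 * (2 * n) ^ 3 / lam + 2 * (2 * n) ^ 3 / lam)
    positivity
  set C : ℝ := S.card * V1 + S.card * S2.card * V2 with hC
  -- The second bound makes `η = 2 K t` admissible for all pairs of integer vectors of norm at most
  -- `2 n`.
  set t₀ : ℝ := min 1 (lam / (8 * (1 + 2 * n) * K)) with ht₀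
  refine ⟨C, t₀, by positivity, lt_min one_pos (by positivity), min_le_left _ _, ?_⟩
  intro A hA hcoer hAM t ht htt β h1 h2
  have ht1 : t ≤ 1 := htt.trans (min_le_left _ _)
  have ht2 : (1 + 2 * n) * (2 * K * t) < lam / 2 := by
    have := htt.trans (min_le_right _ _)
    rw [le_div_iff₀ (by positivity)] at this
    linarith
  have qfle : ∀ k : Fin d → ℤ, ‖intVec k‖ = 1 → qf A k / 2 ≤ M / 2 := by
    intro k hk
    have := (real_inner_le_norm (A (intVec k)) (intVec k)).trans
      (mul_le_mul_of_nonneg_right (A.le_of_opNorm_le hAM _) (norm_nonneg _))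
    rw [hk] at this
    rw [qf]; linarith
  have bound : ∀ x : Space d, (∀ k : Fin d → ℤ, ‖intVec k‖ = 1 →
      inner ℝ x (A (intVec k)) ≤ qf A k / 2 + K) → ‖x‖ ≤ ρ := by
    intro x hx
    have := norm_le_of_inner_single_le hlam hA hcoer (x := x) (c := M / 2 + K) fun k hk =>
      (hx k hk).trans (by linarith [qfle k hk])
    linarith
  have hKt : K * t ≤ K := by nlinarith
  have hPρ : ∀ x ∈ cell A n β, ‖x‖ ≤ ρ := by
    intro x hx
    refine bound x fun k hk => ?_
    have hk0 : k ≠ 0 := by rintro rfl; simp at hk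
    have := hx k hk0 (hk ▸ hn1)
    have := (abs_le.1 (h1 k (hk ▸ hn1))).2
    linarith
  set sl : (Fin d → ℤ) → Set (Space d) := fun k => slab A ρ (qf A k - β (-k)) (β k) k with hsl
  have vol_sl : ∀ k ∈ S, volume (sl k) ≤ ENNReal.ofReal (V1 * t ^ 2) := by
    intro k hk
    obtain ⟨hkn, hk0⟩ := (memS k).1 hk
    refine (volume_slab_set_le hlam hA hcoer hk0 hkn (δ := K * t ^ 2) (by positivity) ?_).trans
      (le_of_eq ?_)
    · have := (abs_le.1 (h2 k hkn)).2; linarith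
    · congr 1; rw [hV1]; ring
  set sl' : (Fin d → ℤ) → Set (Space d) := fun k => slab A ρ (β k) (qf A k - β (-k)) k with hsl'
  have vol_sl' : ∀ k ∈ S, volume (sl' k) ≤ ENNReal.ofReal (V1 * t ^ 2) := by
    intro k hk
    obtain ⟨hkn, hk0⟩ := (memS k).1 hk
    refine (volume_slab_set_le hlam hA hcoer hk0 hkn (δ := K * t ^ 2) (by positivity) ?_).trans
      (le_of_eq ?_)
    · have := (abs_le.1 (h2 k hkn)).1; linarith
    · congr 1; rw [hV1]; ring
  have vol_sls : ∀ s : (Fin d → ℤ) → Set (Space d),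
      (∀ k ∈ S, volume (s k) ≤ ENNReal.ofReal (V1 * t ^ 2)) →
      volume (⋃ k ∈ S, s k) ≤ ENNReal.ofReal (S.card * V1 * t ^ 2) := by
    intro s hs
    refine (measure_biUnion_finset_le _ _).trans ((Finset.sum_le_sum hs).trans (le_of_eq ?_))
    rw [Finset.sum_const, nsmul_eq_mul, ← ENNReal.ofReal_natCast,
      ← ENNReal.ofReal_mul (by positivity)]
    congr 1; ring
  refine ⟨hPρ, ?_, ?_⟩
  · -- the cell without the slabs packs
    set P0 := cell A n β \ ⋃ k ∈ S, sl k with hP0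
    have m1 : MeasurableSet (⋃ k ∈ S, sl k) :=
      Finset.measurableSet_biUnion _ fun k _ => measurableSet_slab A _ _ _ _
    have v0 : volume P0 ≤ 1 := by
      refine volume_le_one_of_packing ((measurableSet_cell A n β).diff m1) ?_
      -- If `x` and `x - k` both lie in the cell, the constraint of `k` at `x` and that of `-k` at
      -- `x - k` trap `x` in the removed slab.
      rintro k hk x ⟨hx, hx'⟩ ⟨hy, -⟩
      have hkn : ‖intVec k‖ ≤ n := by
        have := norm_sub_le x (x - intVec k)
        rw [sub_sub_cancel] at this
        linarith [hPρ x hx, hPρ _ hy]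
      apply hx'
      refine mem_iUnion₂.2 ⟨k, (memS k).2 ⟨hkn, hk⟩, hPρ x hx, ?_, hx k hk hkn⟩
      have := hy (-k) (neg_ne_zero.2 hk) (by rwa [intVec_neg, norm_neg])
      rw [intVec_neg, map_neg, inner_neg_right, inner_sub_left] at this
      rw [qf, hA]
      linarith
    calc volume (cell A n β) ≤ volume (P0 ∪ ⋃ k ∈ S, sl k) := measure_mono (by
          rw [hP0, sdiff_union_self]; exact subset_union_left)
      _ ≤ volume P0 + volume (⋃ k ∈ S, sl k) := measure_union_le _ _
      _ ≤ ENNReal.ofReal 1 + ENNReal.ofReal (S.card * V1 * t ^ 2) := by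
          rw [ENNReal.ofReal_one]; exact add_le_add v0 (vol_sls sl vol_sl)
      _ = ENNReal.ofReal (1 + S.card * V1 * t ^ 2) :=
          (ENNReal.ofReal_add (by positivity) (by positivity)).symm
      _ ≤ _ := by
          gcongr
          rw [hC]
          have : 0 ≤ (S.card : ℝ) * S2.card * V2 := by positivity
          linarith
  · set N := ⋃ k ∈ S, ⋃ l ∈ S2.filter (· ≠ k), nearTwo A ρ (2 * K * t) k l with hN
    have volN : volume N ≤ ENNReal.ofReal (S.card * S2.card * V2 * t ^ 2) := by
      have st : ∀ k ∈ S, volume (⋃ l ∈ S2.filter (· ≠ k), nearTwo A ρ (2 * K * t) k l) ≤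
          ENNReal.ofReal (S2.card * V2 * t ^ 2) := by
        intro k hk
        obtain ⟨hkn, hk0⟩ := (memS k).1 hk
        have : ∀ l ∈ S2.filter (· ≠ k), volume (nearTwo A ρ (2 * K * t) k l) ≤
            ENNReal.ofReal (V2 * t ^ 2) := by
          intro l hl
          obtain ⟨hl, hlk⟩ := Finset.mem_filter.1 hl
          obtain ⟨hln, hl0⟩ := (memS2 l).1 hl
          refine (volume_nearTwo_le hlam hA hcoer (n := 2 * n) hk0 hl0 (Ne.symm hlk)
            (by linarith) hln (by positivity) ht2).trans (le_of_eq ?_)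
          congr 1; rw [hV2]; ring
        refine (measure_biUnion_finset_le _ _).trans ((Finset.sum_le_sum this).trans ?_)
        rw [Finset.sum_const, nsmul_eq_mul, ← ENNReal.ofReal_natCast,
          ← ENNReal.ofReal_mul (by positivity)]
        have hc : ((S2.filter (· ≠ k)).card : ℝ) ≤ S2.card := by
          exact_mod_cast Finset.card_le_card (Finset.filter_subset _ _)
        refine ENNReal.ofReal_le_ofReal ?_
        rw [mul_assoc (S2.card : ℝ)]
        exact mul_le_mul_of_nonneg_right hc (mul_nonneg V20 (sq_nonneg t))
      refine (measure_biUnion_finset_le _ _).trans ((Finset.sum_le_sum st).trans (le_of_eq ?_))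
      rw [Finset.sum_const, nsmul_eq_mul, ← ENNReal.ofReal_natCast,
        ← ENNReal.ofReal_mul (by positivity)]
      congr 1; ring
    have cov : (1 : ℝ≥0∞) ≤ volume (cell A n β ∪ ((⋃ k ∈ S, sl' k) ∪ N)) := by
      have m1 : MeasurableSet (⋃ k ∈ S, sl' k) :=
        Finset.measurableSet_biUnion _ fun k _ => measurableSet_slab A _ _ _ _
      have m2 : MeasurableSet N := by
        rw [hN]
        exact Finset.measurableSet_biUnion _ fun k _ => Finset.measurableSet_biUnion _ fun l _ =>
          measurableSet_nearTwo A _ _ _ _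
      refine one_le_volume_of_covering ((measurableSet_cell A n β).union (m1.union m2)) fun x => ?_
      obtain ⟨k0, hk0⟩ := exists_reduced hlam hA hcoer x
      set y := x - intVec k0 with hy
      have hyρ : ‖y‖ ≤ ρ := bound y fun k _ => (hk0 k).trans (by linarith)
      by_cases hyc : y ∈ cell A n β
      · exact ⟨-k0, Or.inl (by rwa [intVec_neg, ← sub_eq_add_neg])⟩
      by_cases hyb : y ∈ (⋃ k ∈ S, sl' k) ∪ N
      · exact ⟨-k0, Or.inr (by rwa [intVec_neg, ← sub_eq_add_neg])⟩
      rw [cell] at hyc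
      simp only [mem_ofPred_eq, not_forall, not_le] at hyc
      obtain ⟨k, hk, hkn, hkβ⟩ := hyc
      -- `y` lies just outside the facet of `k`, so `y - k` should lie just inside the opposite one.
      -- The constraint of `-k` holds because `y` avoids the slab of `k`. Violation of any other
      -- constraint `k'` would put `y` near the bisector of `k + k'` as well as that of `k`, which
      -- `N` excludes.
      refine ⟨-(k0 + k), Or.inl ?_⟩
      have e : x + intVec (-(k0 + k)) = y - intVec k := by
        rw [hy, intVec_neg, intVec_add]; abel
      rw [e]
      have hkS : k ∈ S := (memS k).2 ⟨hkn, hk⟩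
      have near_k : |inner ℝ y (A (intVec k)) - qf A k / 2| ≤ 2 * K * t := by
        have := (abs_le.1 (h1 k hkn)).1
        have hKt0 : 0 < K * t := by positivity
        rw [abs_le]; constructor <;> linarith [hk0 k]
      have far_k : qf A k - β (-k) < inner ℝ y (A (intVec k)) := by
        by_contra hcon
        exact hyb (Or.inl (mem_iUnion₂.2 ⟨k, hkS, hyρ, hkβ.le, not_lt.1 hcon⟩))
      intro k' hk' hkn'
      rw [inner_sub_left]
      by_cases hkk : k' = -k
      · subst hkk
        rw [intVec_neg, map_neg, inner_neg_right, inner_neg_right]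
        rw [qf, hA] at far_k
        linarith
      have hl0 : k + k' ≠ 0 := fun h => hkk (eq_neg_of_add_eq_zero_right h)
      have hlk : k + k' ≠ k := fun h => hk' (by simpa using h)
      have hln : ‖intVec (k + k')‖ ≤ 2 * n := by
        rw [intVec_add]; exact (norm_add_le _ _).trans (by linarith)
      have far_l : inner ℝ y (A (intVec (k + k'))) < qf A (k + k') / 2 - 2 * K * t := by
        by_contra hcon
        refine hyb (Or.inr (mem_iUnion₂.2 ⟨k, hkS, mem_iUnion₂.2 ⟨k + k', ?_, hyρ, near_k, ?_⟩⟩))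
        · exact Finset.mem_filter.2 ⟨(memS2 _).2 ⟨hln, hl0⟩, hlk⟩
        · have := hk0 (k + k')
          have : 0 < K * t := by positivity
          rw [abs_le]; constructor <;> linarith
      have e1 : qf A (k + k') = qf A k + 2 * inner ℝ (intVec k) (A (intVec k')) + qf A k' := by
        rw [qf, qf, qf, intVec_add, map_add]
        simp only [inner_add_left, inner_add_right]
        rw [hA (intVec k) (intVec k'), real_inner_comm (intVec k) (A (intVec k'))]
        ring
      rw [intVec_add, map_add, inner_add_right, e1] at far_l
      have := (abs_le.1 (h1 k hkn)).1
      have := (abs_le.1 (h1 k' hkn')).1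
      linarith
    calc ENNReal.ofReal 1 = 1 := ENNReal.ofReal_one
      _ ≤ _ := cov
      _ ≤ volume (cell A n β) + (volume (⋃ k ∈ S, sl' k) + volume N) :=
          (measure_union_le _ _).trans (by gcongr; exact measure_union_le _ _)
      _ ≤ volume (cell A n β) + (ENNReal.ofReal (S.card * V1 * t ^ 2) +
            ENNReal.ofReal (S.card * S2.card * V2 * t ^ 2)) := by
          gcongr
          exact vol_sls sl' vol_sl'
      _ = _ := by
          rw [← ENNReal.ofReal_add (by positivity) (by positivity)]
          congr 2; rw [hC]; ring

/-! ### Regular solutions: Taylor estimates -/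

/-- A convex solution of the Monge–Ampère equation with gradient `G` and Hessian `H`, together with
the Taylor estimates that hold for a solution of class `C^{3,1}`. -/
structure RegularSolution (lam M : ℝ) (Ω : Set (Space d)) (f u : Space d → ℝ)
    (G : Space d → Space d) (H : Space d → Space d →L[ℝ] Space d) : Prop where
  isOpen : IsOpen Ω
  nonempty : Ω.Nonempty
  isBounded : Bornology.IsBounded Ω
  convex : Convex ℝ Ω
  continuousOn : ContinuousOn u (closure Ω)
  convexOn : ConvexOn ℝ (closure Ω) u
  boundary : ∀ x ∈ frontier Ω, u x = 0
  abs_le : ∀ x ∈ Ω, |u x| ≤ M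
  grad : ∀ x ∈ Ω, HasFDerivAt G (H x) x
  symm : ∀ x ∈ Ω, ∀ v w, inner ℝ (H x v) w = inner ℝ v (H x w)
  coercive : ∀ x ∈ Ω, ∀ v, lam * ‖v‖ ^ 2 ≤ inner ℝ (H x v) v
  norm_le : ∀ x ∈ Ω, ‖H x‖ ≤ M
  lower : ∀ x ∈ Ω, ∀ y ∈ closure Ω,
    lam / 2 * ‖y - x‖ ^ 2 ≤ u y - u x - inner ℝ (G x) (y - x)
  upper : ∀ x ∈ Ω, ∀ y ∈ closure Ω,
    u y - u x - inner ℝ (G x) (y - x) ≤ M / 2 * ‖y - x‖ ^ 2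
  even : ∀ z ∈ Ω, ∀ v, z + v ∈ Ω → z - v ∈ Ω →
    |u (z + v) + u (z - v) - 2 * u z - inner ℝ (H z v) v| ≤ M * ‖v‖ ^ 4
  cubic : ∀ z ∈ Ω, ∀ v, z + v ∈ Ω →
    |u (z + v) - u z - inner ℝ (G z) v - inner ℝ (H z v) v / 2| ≤ M * ‖v‖ ^ 3
  det_eq : ∀ x ∈ Ω, f x = (H x).det
  f_continuousOn : ContinuousOn f (closure Ω)
  f_lower : ∀ x ∈ Ω, lam ^ d ≤ f x
  f_upper : ∀ x ∈ Ω, f x ≤ M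
  f_taylor : ∀ z ∈ Ω, ∃ L : Space d →L[ℝ] ℝ, ∀ x ∈ Ω,
    |f x - f z - L (x - z)| ≤ M * ‖x - z‖ ^ 2

lemma nonneg_of_second_deriv_nonneg {ψ ψ' ψ'' : ℝ → ℝ}
    (h1 : ∀ s ∈ Icc (0 : ℝ) 1, HasDerivAt ψ (ψ' s) s)
    (h2 : ∀ s ∈ Icc (0 : ℝ) 1, HasDerivAt ψ' (ψ'' s) s)
    (h0 : ψ 0 = 0) (h0' : ψ' 0 = 0) (hn : ∀ s ∈ Icc (0 : ℝ) 1, 0 ≤ ψ'' s) : 0 ≤ ψ 1 := by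
  have m1 : MonotoneOn ψ' (Icc 0 1) :=
    monotoneOn_of_hasDerivWithinAt_nonneg (convex_Icc 0 1)
      (fun s hs => (h2 s hs).continuousAt.continuousWithinAt)
      (fun s hs => (h2 s (interior_subset hs)).hasDerivWithinAt)
      (fun s hs => hn s (interior_subset hs))
  have p1 : ∀ s ∈ Icc (0 : ℝ) 1, 0 ≤ ψ' s := fun s hs => by
    rw [← h0']; exact m1 ⟨le_rfl, zero_le_one⟩ hs hs.1
  have m2 : MonotoneOn ψ (Icc 0 1) :=
    monotoneOn_of_hasDerivWithinAt_nonneg (convex_Icc 0 1)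
      (fun s hs => (h1 s hs).continuousAt.continuousWithinAt)
      (fun s hs => (h1 s (interior_subset hs)).hasDerivWithinAt)
      (fun s hs => p1 s (interior_subset hs))
  rw [← h0]
  exact m2 ⟨le_rfl, zero_le_one⟩ ⟨zero_le_one, le_rfl⟩ zero_le_one

lemma le_of_second_deriv_le {ψ ψ' ψ'' : ℝ → ℝ} {B : ℝ}
    (h1 : ∀ s ∈ Icc (0 : ℝ) 1, HasDerivAt ψ (ψ' s) s)
    (h2 : ∀ s ∈ Icc (0 : ℝ) 1, HasDerivAt ψ' (ψ'' s) s)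
    (h0 : ψ 0 = 0) (h0' : ψ' 0 = 0) (hn : ∀ s ∈ Icc (0 : ℝ) 1, ψ'' s ≤ B) : ψ 1 ≤ B / 2 := by
  have key := nonneg_of_second_deriv_nonneg (ψ := fun s => B / 2 * s ^ 2 - ψ s)
    (ψ' := fun s => B * s - ψ' s) (ψ'' := fun s => B - ψ'' s)
    (fun s hs => by
      convert! (((hasDerivAt_pow 2 s).const_mul (B / 2)).sub (h1 s hs)) using 1
      push_cast; ring)
    (fun s hs => by
      convert! (((hasDerivAt_id s).const_mul B).sub (h2 s hs)) using 1
      ring)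
    (by simp [h0]) (by simp [h0']) (fun s hs => by linarith [hn s hs])
  simp only [one_pow, mul_one] at key
  linarith

lemma abs_le_of_second_deriv_le {ψ ψ' ψ'' : ℝ → ℝ} {B : ℝ}
    (h1 : ∀ s ∈ Icc (0 : ℝ) 1, HasDerivAt ψ (ψ' s) s)
    (h2 : ∀ s ∈ Icc (0 : ℝ) 1, HasDerivAt ψ' (ψ'' s) s)
    (h0 : ψ 0 = 0) (h0' : ψ' 0 = 0) (hn : ∀ s ∈ Icc (0 : ℝ) 1, |ψ'' s| ≤ B) :
    |ψ 1| ≤ B / 2 := by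
  refine abs_le.2 ⟨?_, le_of_second_deriv_le h1 h2 h0 h0' fun s hs => (abs_le.1 (hn s hs)).2⟩
  have := le_of_second_deriv_le (ψ := fun s => -ψ s) (ψ' := fun s => -ψ' s)
    (ψ'' := fun s => -ψ'' s) (B := B) (fun s hs => (h1 s hs).neg) (fun s hs => (h2 s hs).neg)
    (by simp [h0]) (by simp [h0']) fun s hs => by linarith [(abs_le.1 (hn s hs)).1]
  linarith

section Taylor

variable {Ω : Set (Space d)} {u : Space d → ℝ} {G : Space d → Space d}
  {H : Space d → Space d →L[ℝ] Space d}

lemma hasDerivAt_line {F : Type*} [NormedAddCommGroup F] [NormedSpace ℝ F] {g : Space d → F}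
    {g' : Space d →L[ℝ] F} {z v : Space d} {s : ℝ} (h : HasFDerivAt g g' (z + s • v)) :
    HasDerivAt (fun s : ℝ => g (z + s • v)) (g' v) s := by
  have h1 : HasDerivAt (fun s : ℝ => z + s • v) v s := by
    simpa using ((hasDerivAt_id s).smul_const v).const_add z
  exact h.comp_hasDerivAt s h1

lemma line_mem (hc : Convex ℝ Ω) {z v : Space d} (hz : z ∈ Ω) (hv : z + v ∈ Ω) {s : ℝ}
    (hs : s ∈ Icc (0 : ℝ) 1) : z + s • v ∈ Ω := by
  have := hc.add_smul_sub_mem hz hv hs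
  simpa using this

variable (hc : Convex ℝ Ω) (hu : ∀ x ∈ Ω, HasFDerivAt u (innerSL ℝ (G x)) x)
  (hG : ∀ x ∈ Ω, HasFDerivAt G (H x) x)
include hc hu hG

lemma taylor_two_bounds {lam M : ℝ} {x y : Space d} (hx : x ∈ Ω) (hy : y ∈ Ω)
    (hl : ∀ x ∈ Ω, ∀ v, lam * ‖v‖ ^ 2 ≤ inner ℝ (H x v) v)
    (hM : ∀ x ∈ Ω, ‖H x‖ ≤ M) :
    lam / 2 * ‖y - x‖ ^ 2 ≤ u y - u x - inner ℝ (G x) (y - x) ∧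
      u y - u x - inner ℝ (G x) (y - x) ≤ M / 2 * ‖y - x‖ ^ 2 := by
  set v := y - x with hv
  have hy' : x + v ∈ Ω := by rw [hv]; simpa using hy
  have hm := fun s hs => line_mem hc hx hy' (s := s) hs
  have d1 : ∀ s ∈ Icc (0 : ℝ) 1, HasDerivAt (fun s : ℝ => u (x + s • v) - u x - s * inner ℝ (G x) v)
      (inner ℝ (G (x + s • v)) v - inner ℝ (G x) v) s := fun s hs => by
    have h1 := hasDerivAt_line (hu _ (hm s hs))
    have h2 := (h1.sub_const (u x)).sub ((hasDerivAt_id s).mul_const (inner ℝ (G x) v))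
    convert! h2 using 1
    simp
  have d2 : ∀ s ∈ Icc (0 : ℝ) 1, HasDerivAt
      (fun s : ℝ => inner ℝ (G (x + s • v)) v - inner ℝ (G x) v)
      (inner ℝ (H (x + s • v) v) v) s := fun s hs => by
    have h1 := hasDerivAt_line (hG _ (hm s hs))
    have h2 := (h1.inner ℝ (hasDerivAt_const s v)).sub_const (inner ℝ (G x) v)
    simpa using h2
  constructor
  · have := le_of_second_deriv_le (fun s hs => (d1 s hs).neg) (fun s hs => (d2 s hs).neg)
      (by simp) (by simp) (B := -(lam * ‖v‖ ^ 2)) fun s hs => neg_le_neg (hl _ (hm s hs) v)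
    simp only [Pi.neg_apply, one_smul, one_mul] at this
    rw [hv] at this ⊢
    rw [add_sub_cancel] at this
    linarith
  · have := le_of_second_deriv_le d1 d2 (by simp) (by simp) (B := M * ‖v‖ ^ 2) fun s hs => by
      calc inner ℝ (H (x + s • v) v) v ≤ ‖H (x + s • v) v‖ * ‖v‖ := real_inner_le_norm _ _
        _ ≤ (M * ‖v‖) * ‖v‖ := by gcongr; exact (H _).le_of_opNorm_le (hM _ (hm s hs)) v
        _ = _ := by ring
    simp only [one_smul, one_mul] at this
    rw [hv] at this ⊢
    rw [add_sub_cancel] at this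
    linarith

lemma taylor_cubic {M : ℝ} {z v : Space d} (hz : z ∈ Ω) (hv : z + v ∈ Ω) (hM0 : 0 ≤ M)
    (hM : ∀ x ∈ Ω, ∀ y ∈ Ω, ‖H x - H y‖ ≤ M * ‖x - y‖) :
    |u (z + v) - u z - inner ℝ (G z) v - inner ℝ (H z v) v / 2| ≤ M * ‖v‖ ^ 3 := by
  have hm := fun s hs => line_mem hc hz hv (s := s) hs
  have d1 : ∀ s ∈ Icc (0 : ℝ) 1, HasDerivAt
      (fun s : ℝ => u (z + s • v) - u z - s * inner ℝ (G z) v - s ^ 2 * (inner ℝ (H z v) v / 2))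
      (inner ℝ (G (z + s • v)) v - inner ℝ (G z) v - s * inner ℝ (H z v) v) s := fun s hs => by
    have h1 := hasDerivAt_line (hu _ (hm s hs))
    have h2 := ((h1.sub_const (u z)).sub ((hasDerivAt_id s).mul_const (inner ℝ (G z) v))).sub
      ((hasDerivAt_pow 2 s).mul_const (inner ℝ (H z v) v / 2))
    convert! h2 using 1
    simp
    ring
  have d2 : ∀ s ∈ Icc (0 : ℝ) 1, HasDerivAt
      (fun s : ℝ => inner ℝ (G (z + s • v)) v - inner ℝ (G z) v - s * inner ℝ (H z v) v)
      (inner ℝ ((H (z + s • v) - H z) v) v) s := fun s hs => by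
    have h1 := hasDerivAt_line (hG _ (hm s hs))
    have h2 := ((h1.inner ℝ (hasDerivAt_const s v)).sub_const (inner ℝ (G z) v)).sub
      ((hasDerivAt_id s).mul_const (inner ℝ (H z v) v))
    convert! h2 using 1
    simp [inner_sub_left]
  have := abs_le_of_second_deriv_le d1 d2 (by simp) (by simp) (B := M * ‖v‖ ^ 3) fun s hs => by
    have e1 : ‖H (z + s • v) - H z‖ ≤ M * ‖v‖ := by
      refine (hM _ (hm s hs) _ hz).trans ?_
      rw [add_sub_cancel_left, norm_smul, Real.norm_of_nonneg hs.1]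
      gcongr
      exact mul_le_of_le_one_left (norm_nonneg v) hs.2
    calc |inner ℝ ((H (z + s • v) - H z) v) v| ≤ ‖(H (z + s • v) - H z) v‖ * ‖v‖ :=
          abs_real_inner_le_norm _ _
      _ ≤ (M * ‖v‖ * ‖v‖) * ‖v‖ := by gcongr; exact ContinuousLinearMap.le_of_opNorm_le _ e1 v
      _ = _ := by ring
  simp only [one_smul, one_mul, one_pow] at this
  refine this.trans ?_
  have : 0 ≤ M * ‖v‖ ^ 3 := by positivity
  linarith

/-- The odd terms cancel in the symmetric sum. The quadratic bound on second differences of `H`,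
available for Lipschitz third derivatives, then gives a quartic remainder; this is the source of
second order consistency. -/
lemma taylor_even {M : ℝ} {z v : Space d} (hz : z ∈ Ω) (hv : z + v ∈ Ω) (hv' : z - v ∈ Ω)
    (hM0 : 0 ≤ M)
    (hM : ∀ w, z + w ∈ Ω → z - w ∈ Ω → ‖H (z + w) + H (z - w) - (2 : ℝ) • H z‖ ≤ M * ‖w‖ ^ 2) :
    |u (z + v) + u (z - v) - 2 * u z - inner ℝ (H z v) v| ≤ M * ‖v‖ ^ 4 := by
  have hm := fun s hs => line_mem hc hz hv (s := s) hs
  have hm' : ∀ s ∈ Icc (0 : ℝ) 1, z + s • (-v) ∈ Ω := fun s hs =>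
    line_mem hc hz (v := -v) (by rwa [← sub_eq_add_neg]) hs
  have d1 : ∀ s ∈ Icc (0 : ℝ) 1, HasDerivAt
      (fun s : ℝ => u (z + s • v) + u (z + s • (-v)) - 2 * u z - s ^ 2 * inner ℝ (H z v) v)
      (inner ℝ (G (z + s • v)) v + inner ℝ (G (z + s • (-v))) (-v) - 2 * s * inner ℝ (H z v) v) s :=
    fun s hs => by
    have h1 := hasDerivAt_line (hu _ (hm s hs))
    have h1' := hasDerivAt_line (hu _ (hm' s hs))
    have h2 := ((h1.add h1').sub_const (2 * u z)).sub
      ((hasDerivAt_pow 2 s).mul_const (inner ℝ (H z v) v))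
    convert! h2 using 1
    simp
  have d2 : ∀ s ∈ Icc (0 : ℝ) 1, HasDerivAt
      (fun s : ℝ => inner ℝ (G (z + s • v)) v + inner ℝ (G (z + s • (-v))) (-v) -
        2 * s * inner ℝ (H z v) v)
      (inner ℝ ((H (z + s • v) + H (z - s • v) - (2 : ℝ) • H z) v) v) s := fun s hs => by
    have h1 := hasDerivAt_line (hG _ (hm s hs))
    have h1' := hasDerivAt_line (hG _ (hm' s hs))
    have h2 := ((h1.inner ℝ (hasDerivAt_const s v)).add
      (h1'.inner ℝ (hasDerivAt_const s (-v)))).sub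
      (((hasDerivAt_id s).const_mul 2).mul_const (inner ℝ (H z v) v))
    convert! h2 using 1
    simp [inner_add_left, inner_smul_left, sub_eq_add_neg]
  have := abs_le_of_second_deriv_le d1 d2 (by simp; ring) (by simp) (B := M * ‖v‖ ^ 4)
    fun s hs => by
    have e1 : ‖H (z + s • v) + H (z - s • v) - (2 : ℝ) • H z‖ ≤ M * ‖v‖ ^ 2 := by
      refine (hM (s • v) (hm s hs) (by simpa [sub_eq_add_neg] using hm' s hs)).trans ?_
      rw [norm_smul, Real.norm_of_nonneg hs.1]
      have := mul_nonneg hs.1 (norm_nonneg v)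
      gcongr
      exact mul_le_of_le_one_left (norm_nonneg v) hs.2
    calc |inner ℝ ((H (z + s • v) + H (z - s • v) - (2 : ℝ) • H z) v) v|
        ≤ ‖(H (z + s • v) + H (z - s • v) - (2 : ℝ) • H z) v‖ * ‖v‖ :=
          abs_real_inner_le_norm _ _
      _ ≤ (M * ‖v‖ ^ 2 * ‖v‖) * ‖v‖ := by
          gcongr; exact ContinuousLinearMap.le_of_opNorm_le _ e1 v
      _ = _ := by ring
  simp only [one_smul, one_mul, one_pow, ← sub_eq_add_neg] at this
  refine this.trans ?_
  have : 0 ≤ M * ‖v‖ ^ 4 := by positivity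
  linarith

end Taylor

/-- Second order Taylor estimate for a function with Lipschitz derivative on a convex set. -/
lemma norm_sub_sub_le_of_lipschitz {E F : Type*} [NormedAddCommGroup E] [NormedSpace ℝ E]
    [NormedAddCommGroup F] [NormedSpace ℝ F] {s : Set E} (hs : Convex ℝ s) {g : E → F}
    {g' : E → E →L[ℝ] F} (hg : ∀ x ∈ s, HasFDerivAt g (g' x) x) {K : ℝ} (hK : 0 ≤ K)
    (hg' : ∀ x ∈ s, ∀ y ∈ s, ‖g' x - g' y‖ ≤ K * ‖x - y‖) {x y : E} (hx : x ∈ s) (hy : y ∈ s) :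
    ‖g y - g x - g' x (y - x)‖ ≤ K * ‖y - x‖ ^ 2 := by
  have key := Convex.norm_image_sub_le_of_norm_hasFDerivWithin_le' (𝕜 := ℝ)
    (s := s ∩ Metric.closedBall x ‖y - x‖) (f := g) (f' := g') (φ := g' x)
    (C := K * ‖y - x‖) (x := x) (y := y)
    (fun w hw => (hg w hw.1).hasFDerivWithinAt)
    (fun w hw => (hg' w hw.1 x hx).trans (by
      gcongr
      have := hw.2
      rwa [Metric.mem_closedBall, dist_eq_norm] at this))
    (hs.inter (convex_closedBall _ _)) ⟨hx, by simp⟩ ⟨hy, by simp [dist_eq_norm]⟩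
  refine key.trans (le_of_eq (by ring))

/-! ### The determinant -/

lemma contDiff_det : ContDiff ℝ 2 fun A : Space d →L[ℝ] Space d => A.det := by
  have : (fun A : Space d →L[ℝ] Space d => A.det) = fun A : Space d →L[ℝ] Space d =>
      (Matrix.of fun i j => (A (EuclideanSpace.single j (1 : ℝ))) i).det := by
    ext A
    rw [ContinuousLinearMap.det,
      ← LinearMap.det_toMatrix (EuclideanSpace.basisFun (Fin d) ℝ).toBasis]
    congr 1
  rw [this]
  simp only [Matrix.det_apply, Matrix.of_apply]
  fun_prop

/-- The determinant is a polynomial; `L` is its derivative at `A`, and compactness of the ball of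
radius `M` makes the constants uniform. -/
lemma exists_det_bounds (d : ℕ) (M : ℝ) : ∃ C : ℝ, 0 ≤ C ∧ ∀ A : Space d →L[ℝ] Space d,
    ‖A‖ ≤ M → |A.det| ≤ C ∧ ∃ L : (Space d →L[ℝ] Space d) →L[ℝ] ℝ, ‖L‖ ≤ C ∧
      ∀ B : Space d →L[ℝ] Space d, ‖B‖ ≤ M →
        |B.det - A.det - L (B - A)| ≤ C * ‖B - A‖ ^ 2 := by
  have hc := contDiff_det (d := d)
  set D : (Space d →L[ℝ] Space d) → ℝ := fun A => A.det with hD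
  have hD1 : ∀ A, HasFDerivAt D (fderiv ℝ D A) A := fun A =>
    (hc.differentiable (by norm_num) A).hasFDerivAt
  have hcomp : IsCompact (Metric.closedBall (0 : Space d →L[ℝ] Space d) M) :=
    isCompact_closedBall _ _
  have hf1 : ContDiff ℝ 1 (fderiv ℝ D) := hc.fderiv_right (by norm_num)
  obtain ⟨C1, hC1⟩ := hcomp.exists_bound_of_continuousOn hc.continuous.continuousOn
  obtain ⟨C2, hC2⟩ := IsCompact.exists_bound_of_continuousOn
    (E := (Space d →L[ℝ] Space d) →L[ℝ] ℝ) hcomp hf1.continuous.continuousOn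
  obtain ⟨K, hK⟩ := hf1.contDiffOn.exists_lipschitzOnWith one_ne_zero
    (convex_closedBall (0 : Space d →L[ℝ] Space d) M) hcomp
  refine ⟨max (max C1 C2) K, le_max_of_le_right K.2, fun A hA => ?_⟩
  have hA' : A ∈ Metric.closedBall (0 : Space d →L[ℝ] Space d) M := mem_closedBall_zero_iff.2 hA
  refine ⟨(hC1 A hA').trans ((le_max_left _ _).trans (le_max_left _ _)), fderiv ℝ D A,
    (hC2 A hA').trans ((le_max_right _ _).trans (le_max_left _ _)), fun B hB => ?_⟩
  have hB' : B ∈ Metric.closedBall (0 : Space d →L[ℝ] Space d) M := mem_closedBall_zero_iff.2 hB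
  have := norm_sub_sub_le_of_lipschitz (convex_closedBall (0 : Space d →L[ℝ] Space d) M)
    (fun x _ => hD1 x) K.2 (fun x hx y hy => by
      have := hK.dist_le_mul x hx y hy
      rwa [dist_eq_norm, dist_eq_norm] at this) hA' hB'
  refine this.trans ?_
  gcongr
  exact le_max_right _ _

/-- The determinant is the product of the eigenvalues, each at least `lam`. -/
lemma pow_le_det {A : Space d →L[ℝ] Space d} {lam : ℝ} (hlam : 0 < lam)
    (hA : ∀ x y, inner ℝ (A x) y = inner ℝ x (A y))
    (hcoer : ∀ x, lam * ‖x‖ ^ 2 ≤ inner ℝ (A x) x) : lam ^ d ≤ A.det := by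
  have hs : A.toLinearMap.IsSymmetric := fun x y => hA x y
  have hn : Module.finrank ℝ (Space d) = d := by simp
  rw [ContinuousLinearMap.det, hs.det_eq_prod_eigenvalues hn]
  have : lam ^ d = ∏ _i : Fin d, lam := by simp
  rw [this]
  refine Finset.prod_le_prod (fun _ _ => hlam.le) fun i _ => ?_
  have h1 := hcoer (hs.eigenvectorBasis hn i)
  have h2 : A (hs.eigenvectorBasis hn i) = hs.eigenvalues hn i • hs.eigenvectorBasis hn i :=
    hs.apply_eigenvectorBasis hn i
  rw [h2, inner_smul_left, real_inner_self_eq_norm_sq] at h1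
  simpa using h1

lemma dist_iteratedFDeriv_fderiv {E F : Type*} [NormedAddCommGroup E] [NormedSpace ℝ E]
    [NormedAddCommGroup F] [NormedSpace ℝ F] (g : E → F) (n : ℕ) (x y : E) :
    dist (iteratedFDeriv ℝ n (fderiv ℝ g) x) (iteratedFDeriv ℝ n (fderiv ℝ g) y) =
      dist (iteratedFDeriv ℝ (n + 1) g x) (iteratedFDeriv ℝ (n + 1) g y) := by
  rw [iteratedFDeriv_succ_eq_comp_right, iteratedFDeriv_succ_eq_comp_right]
  exact (LinearIsometryEquiv.dist_map _ _ _).symm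

lemma norm_fderiv_sub_apply_le {E F : Type*} [NormedAddCommGroup E] [NormedSpace ℝ E]
    [NormedAddCommGroup F] [NormedSpace ℝ F] (g : E → F) (x y v : E) :
    ‖fderiv ℝ g x v - fderiv ℝ g y v‖ ≤
      dist (iteratedFDeriv ℝ 1 g x) (iteratedFDeriv ℝ 1 g y) * ‖v‖ := by
  have h : ‖fderiv ℝ g x - fderiv ℝ g y‖ ≤
      dist (iteratedFDeriv ℝ 1 g x) (iteratedFDeriv ℝ 1 g y) := by
    rw [← dist_iteratedFDeriv_fderiv, ← dist_eq_norm, iteratedFDeriv_zero_eq_comp]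
    exact (LinearIsometryEquiv.dist_map _ _ _).ge
  exact ContinuousLinearMap.le_of_opNorm_le (fderiv ℝ g x - fderiv ℝ g y) h v

lemma norm_fderiv_apply_le {E F : Type*} [NormedAddCommGroup E] [NormedSpace ℝ E]
    [NormedAddCommGroup F] [NormedSpace ℝ F] (g : E → F) (x v : E) :
    ‖fderiv ℝ g x v‖ ≤ ‖iteratedFDeriv ℝ 1 g x‖ * ‖v‖ := by
  rw [norm_iteratedFDeriv_one]
  exact (fderiv ℝ g x).le_opNorm v

lemma norm_fderiv_three_sub_apply_le {E F : Type*} [NormedAddCommGroup E] [NormedSpace ℝ E]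
    [NormedAddCommGroup F] [NormedSpace ℝ F] (g : E → F) (x y v : E) :
    ‖fderiv ℝ (fderiv ℝ (fderiv ℝ g)) x v - fderiv ℝ (fderiv ℝ (fderiv ℝ g)) y v‖ ≤
      dist (iteratedFDeriv ℝ 3 g x) (iteratedFDeriv ℝ 3 g y) * ‖v‖ := by
  refine (norm_fderiv_sub_apply_le (fderiv ℝ (fderiv ℝ g)) x y v).trans (le_of_eq ?_)
  rw [dist_iteratedFDeriv_fderiv, dist_iteratedFDeriv_fderiv]

lemma norm_fderiv_three_apply_le {E F : Type*} [NormedAddCommGroup E] [NormedSpace ℝ E]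
    [NormedAddCommGroup F] [NormedSpace ℝ F] (g : E → F) (x v : E) :
    ‖fderiv ℝ (fderiv ℝ (fderiv ℝ g)) x v‖ ≤ ‖iteratedFDeriv ℝ 3 g x‖ * ‖v‖ := by
  refine (norm_fderiv_apply_le (fderiv ℝ (fderiv ℝ g)) x v).trans (le_of_eq ?_)
  rw [norm_iteratedFDeriv_fderiv, norm_iteratedFDeriv_fderiv]

lemma HasFDerivAt.clm_comp_left {E F F' E' : Type*} [NormedAddCommGroup E] [NormedSpace ℝ E]
    [NormedAddCommGroup F] [NormedSpace ℝ F] [NormedAddCommGroup F'] [NormedSpace ℝ F']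
    [NormedAddCommGroup E'] [NormedSpace ℝ E'] (J : F →L[ℝ] F') {D : E' → E →L[ℝ] F}
    {D' : E' →L[ℝ] (E →L[ℝ] F)} {x : E'} (h : HasFDerivAt D D' x) :
    HasFDerivAt (fun x => J ∘L D x) ((ContinuousLinearMap.compL ℝ E F F' J) ∘L D') x :=
  (ContinuousLinearMap.compL ℝ E F F' J).hasFDerivAt.comp x h

lemma norm_iteratedFDeriv_le_of_c31Norm {Ω : Set (Space d)} {u : Space d → ℝ} {M : ℝ}
    (hM : 0 ≤ M) (h : c31Norm Ω u ≤ ENNReal.ofReal M) {k : ℕ} (hk : k < 4) {x : Space d}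
    (hx : x ∈ Ω) : ‖iteratedFDeriv ℝ k u x‖ ≤ M := by
  have h1 : (⨆ x ∈ Ω, ENNReal.ofReal ‖iteratedFDeriv ℝ k u x‖) ≤ ENNReal.ofReal M :=
    le_trans (Finset.single_le_sum (f := fun k => ⨆ x ∈ Ω, ENNReal.ofReal ‖iteratedFDeriv ℝ k u x‖)
      (fun _ _ => zero_le) (Finset.mem_range.2 hk)) (le_trans le_self_add h)
  have h2 := (le_iSup₂ (f := fun x (_ : x ∈ Ω) => ENNReal.ofReal ‖iteratedFDeriv ℝ k u x‖) x
    hx).trans h1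
  exact (ENNReal.ofReal_le_ofReal_iff hM).1 h2

lemma dist_iteratedFDeriv_le_of_c31Norm {Ω : Set (Space d)} {u : Space d → ℝ} {M : ℝ}
    (hM : 0 ≤ M) (h : c31Norm Ω u ≤ ENNReal.ofReal M) {x y : Space d}
    (hx : x ∈ Ω) (hy : y ∈ Ω) :
    dist (iteratedFDeriv ℝ 3 u x) (iteratedFDeriv ℝ 3 u y) ≤ M * ‖x - y‖ := by
  rcases eq_or_ne x y with rfl | hxy
  · simp
  have h1 := ((le_iSup₂ (f := fun y (_ : y ∈ Ω) =>
    edist (iteratedFDeriv ℝ 3 u x) (iteratedFDeriv ℝ 3 u y) / edist x y) y hy).trans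
    (le_iSup₂ (f := fun x (_ : x ∈ Ω) => ⨆ y ∈ Ω,
    edist (iteratedFDeriv ℝ 3 u x) (iteratedFDeriv ℝ 3 u y) / edist x y) x hx)).trans
    (le_add_self.trans h)
  rw [ENNReal.div_le_iff (by simpa using hxy) (edist_ne_top _ _), edist_dist, edist_dist x y,
    ← ENNReal.ofReal_mul hM, ENNReal.ofReal_le_ofReal_iff (by positivity), dist_eq_norm x y] at h1
  exact h1

lemma det_hessian_eq {u : Space d → ℝ} {x : Space d} {A : Space d →L[ℝ] Space d}
    (hA : ∀ v w, fderiv ℝ (fderiv ℝ u) x v w = inner ℝ (A v) w) :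
    (hessian u x).det = A.det := by
  rw [ContinuousLinearMap.det,
    ← LinearMap.det_toMatrix (EuclideanSpace.basisFun (Fin d) ℝ).toBasis, ← Matrix.det_transpose]
  congr 1
  ext i j
  simp [hessian, iteratedFDeriv_two_apply, hA, LinearMap.toMatrix_apply,
    EuclideanSpace.inner_single_right]

lemma coercive_of_hessian {u : Space d → ℝ} {x : Space d} {A : Space d →L[ℝ] Space d} {lam : ℝ}
    (hA : ∀ v w, fderiv ℝ (fderiv ℝ u) x v w = inner ℝ (A v) w)
    (hp : (hessian u x - lam • (1 : Matrix (Fin d) (Fin d) ℝ)).PosSemidef) (v : Space d) :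
    lam * ‖v‖ ^ 2 ≤ inner ℝ (A v) v := by
  have h1 := hp.dotProduct_mulVec_nonneg v.ofLp
  have h2 : inner ℝ (A v) v = ∑ i, v i * ∑ j, hessian u x i j * v j := by
    have e : v = ∑ i, v i • EuclideanSpace.single i (1 : ℝ) := by
      ext j; simp [Finset.sum_apply, Pi.single_apply]
    calc inner ℝ (A v) v = inner ℝ (A (∑ i, v i • EuclideanSpace.single i (1 : ℝ)))
          (∑ j, v j • EuclideanSpace.single j (1 : ℝ)) := by rw [← e]
      _ = _ := by
        simp only [map_sum, map_smul, sum_inner, inner_sum, inner_smul_left, inner_smul_right,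
          RCLike.conj_to_real, ← hA, hessian, Matrix.of_apply, iteratedFDeriv_two_apply,
          Matrix.cons_val_zero, Matrix.cons_val_one, Finset.mul_sum]
        rw [Finset.sum_comm]
        refine Finset.sum_congr rfl fun i _ => Finset.sum_congr rfl fun j _ => by ring
  have h3 : star v.ofLp ⬝ᵥ ((hessian u x - lam • (1 : Matrix (Fin d) (Fin d) ℝ)).mulVec v.ofLp) =
      (∑ i, v i * ∑ j, hessian u x i j * v j) - lam * ‖v‖ ^ 2 := by
    rw [EuclideanSpace.norm_sq_eq, Matrix.sub_mulVec, Matrix.smul_mulVec, Matrix.one_mulVec,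
      dotProduct_sub, dotProduct_smul]
    simp [dotProduct, Matrix.mulVec, sq]
  rw [h3] at h1
  rw [h2]
  linarith

/-- The equation transfers regularity from `u` to `f`: as `f = det H` with `DH` bounded and
Lipschitz, `f` has a first order Taylor expansion with uniform quadratic remainder. -/
theorem exists_regularSolution (d : ℕ) {lam M₀ : ℝ} (hlam : 0 < lam) :
    ∃ M : ℝ, 1 ≤ M ∧ ∀ (Ω : Set (Space d)) (f u : Space d → ℝ), IsUniformlyConvexDomain Ω →
      ContinuousOn f (closure Ω) → IsConvexSolution Ω f u → IsC31 Ω u →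
      c31Norm Ω u ≤ ENNReal.ofReal M₀ →
      (∀ x ∈ Ω, (hessian u x - lam • (1 : Matrix (Fin d) (Fin d) ℝ)).PosSemidef) →
      ∃ G H, RegularSolution lam M Ω f u G H := by
  set m : ℝ := max M₀ 0 with hm
  have hm0 : 0 ≤ m := le_max_right _ _
  obtain ⟨C, hC0, hC⟩ := exists_det_bounds d m
  -- `2 m` serves the even remainder, `C` bounds the determinant, and `C (m² + m)` is the Taylor
  -- constant of `det ∘ H`.
  refine ⟨1 + 2 * m + C + C * (m ^ 2 + m), by nlinarith [mul_nonneg hC0 hm0, mul_nonneg hC0 (sq_nonneg m)], ?_⟩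
  intro Ω f u hΩ hf hsol hreg hnorm hpos
  set M := 1 + 2 * m + C + C * (m ^ 2 + m) with hMdef
  have hmM : 2 * m ≤ M := by nlinarith [mul_nonneg hC0 hm0, mul_nonneg hC0 (sq_nonneg m)]
  have hCM : C ≤ M := by nlinarith [mul_nonneg hC0 hm0, mul_nonneg hC0 (sq_nonneg m)]
  have hCM2 : C * (m ^ 2 + m) ≤ M := by linarith
  have hM1 : 0 ≤ M := hC0.trans hCM
  have hnorm' : c31Norm Ω u ≤ ENNReal.ofReal m :=
    hnorm.trans (ENNReal.ofReal_le_ofReal (le_max_left _ _))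
  have hnhds : ∀ x ∈ Ω, Ω ∈ nhds x := fun x hx => hΩ.isOpen.mem_nhds hx
  have c0 : ∀ x ∈ Ω, ContDiffAt ℝ 3 u x := fun x hx => hreg.contDiffOn.contDiffAt (hnhds x hx)
  have c1 : ∀ x ∈ Ω, ContDiffAt ℝ 2 (fderiv ℝ u) x := fun x hx =>
    (c0 x hx).fderiv_right (by norm_num)
  have c2 : ∀ x ∈ Ω, ContDiffAt ℝ 1 (fderiv ℝ (fderiv ℝ u)) x := fun x hx =>
    (c1 x hx).fderiv_right (by norm_num)
  let J : (Space d →L[ℝ] ℝ) →L[ℝ] Space d :=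
    LinearMap.toContinuousLinearMap
      { toFun := (InnerProductSpace.toDual ℝ (Space d)).symm
        map_add' := fun a b => map_add _ a b
        map_smul' := fun c a => by simp }
  have hJ : ∀ L w, inner ℝ (J L) w = L w := fun L w => InnerProductSpace.toDual_symm_apply
  have hJn : ∀ L, ‖J L‖ = ‖L‖ := fun L => (InnerProductSpace.toDual ℝ (Space d)).symm.norm_map L
  let G : Space d → Space d := fun x => J (fderiv ℝ u x)
  let H : Space d → Space d →L[ℝ] Space d := fun x => J ∘L fderiv ℝ (fderiv ℝ u) x
  let T : Space d → Space d →L[ℝ] (Space d →L[ℝ] Space d) := fun x =>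
    (ContinuousLinearMap.compL ℝ (Space d) (Space d →L[ℝ] ℝ) (Space d) J) ∘L
      fderiv ℝ (fderiv ℝ (fderiv ℝ u)) x
  have hH : ∀ x v w, fderiv ℝ (fderiv ℝ u) x v w = inner ℝ (H x v) w := fun x v w =>
    (hJ _ _).symm
  have hcompn : ∀ B : Space d →L[ℝ] (Space d →L[ℝ] ℝ), ‖J ∘L B‖ ≤ ‖B‖ := fun B =>
    ContinuousLinearMap.opNorm_le_bound _ (ContinuousLinearMap.opNorm_nonneg B) fun v => by
      rw [ContinuousLinearMap.comp_apply, hJn]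
      exact B.le_opNorm v
  have dU : ∀ x ∈ Ω, HasFDerivAt u (innerSL ℝ (G x)) x := fun x hx => by
    have h1 := ((c0 x hx).differentiableAt (by norm_num)).hasFDerivAt
    convert! h1 using 1
    ext w
    exact hJ _ _
  have dG : ∀ x ∈ Ω, HasFDerivAt G (H x) x := fun x hx =>
    J.hasFDerivAt.comp x ((c1 x hx).differentiableAt (by norm_num)).hasFDerivAt
  have dH : ∀ x ∈ Ω, HasFDerivAt H (T x) x := fun x hx =>
    HasFDerivAt.clm_comp_left J ((c2 x hx).differentiableAt (by norm_num)).hasFDerivAt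
  have nH : ∀ x ∈ Ω, ‖H x‖ ≤ m := fun x hx => by
    refine (hcompn _).trans ?_
    rw [← norm_iteratedFDeriv_one, norm_iteratedFDeriv_fderiv]
    exact norm_iteratedFDeriv_le_of_c31Norm hm0 hnorm' (by norm_num) hx
  have nT : ∀ x ∈ Ω, ‖T x‖ ≤ m := fun x hx => by
    refine ContinuousLinearMap.opNorm_le_bound _ hm0 fun v => (hcompn _).trans ?_
    refine (norm_fderiv_three_apply_le u x v).trans ?_
    gcongr
    exact norm_iteratedFDeriv_le_of_c31Norm hm0 hnorm' (by norm_num) hx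
  have lT : ∀ x ∈ Ω, ∀ y ∈ Ω, ‖T x - T y‖ ≤ m * ‖x - y‖ := fun x hx y hy => by
    refine ContinuousLinearMap.opNorm_le_bound _ (by positivity) fun v => ?_
    have e : (T x - T y) v = J ∘L ((fderiv ℝ (fderiv ℝ (fderiv ℝ u)) x -
        fderiv ℝ (fderiv ℝ (fderiv ℝ u)) y) v) := by
      simp [T, ContinuousLinearMap.comp_sub]
    rw [e]
    refine (hcompn _).trans ((norm_fderiv_three_sub_apply_le u x y v).trans ?_)
    gcongr
    exact dist_iteratedFDeriv_le_of_c31Norm hm0 hnorm' hx hy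
  have lH : ∀ x ∈ Ω, ∀ y ∈ Ω, ‖H x - H y‖ ≤ m * ‖x - y‖ := fun x hx y hy =>
    Convex.norm_image_sub_le_of_norm_hasFDerivWithin_le (𝕜 := ℝ)
      (fun w hw => (dH w hw).hasFDerivWithinAt) nT hΩ.convex hy hx
  have tH : ∀ x ∈ Ω, ∀ y ∈ Ω, ‖H y - H x - T x (y - x)‖ ≤ m * ‖y - x‖ ^ 2 := fun x hx y hy =>
    norm_sub_sub_le_of_lipschitz hΩ.convex dH hm0 lT hx hy
  have coer : ∀ x ∈ Ω, ∀ v, lam * ‖v‖ ^ 2 ≤ inner ℝ (H x v) v := fun x hx v =>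
    coercive_of_hessian (hH x) (hpos x hx) v
  have sym : ∀ x ∈ Ω, ∀ v w, inner ℝ (H x v) w = inner ℝ v (H x w) := fun x hx v w => by
    have h1 : IsSymmSndFDerivAt ℝ u x := (c0 x hx).isSymmSndFDerivAt (by simp; norm_num)
    rw [← hH, real_inner_comm, ← hH]
    exact h1 v w
  have deteq : ∀ x ∈ Ω, f x = (H x).det := fun x hx => by
    rw [← hsol.det_eq x hx, det_hessian_eq (hH x)]
  -- Derivatives are used inside `Ω` only; the two quadratic bounds reach boundary points `y` by
  -- continuity.
  have clos : ∀ x ∈ Ω, ∀ y ∈ closure Ω, ∀ c : ℝ,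
      ContinuousWithinAt (fun y => c * ‖y - x‖ ^ 2) Ω y ∧
      ContinuousWithinAt (fun y => u y - u x - inner ℝ (G x) (y - x)) Ω y := fun x _ y hy c =>
    ⟨by fun_prop, by
      have h1 : ContinuousWithinAt u Ω y := (hsol.continuousOn y hy).mono subset_closure
      have h2 : Continuous fun y => inner ℝ (G x) (y - x) := by fun_prop
      exact (h1.sub continuousWithinAt_const).sub h2.continuousWithinAt⟩
  refine ⟨G, H, ?_⟩
  refine
    { isOpen := hΩ.isOpen
      nonempty := hΩ.nonempty
      isBounded := hΩ.isBounded
      convex := hΩ.convex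
      continuousOn := hsol.continuousOn
      convexOn := hsol.convexOn
      boundary := hsol.boundary
      abs_le := fun x hx => ?_
      grad := dG
      symm := sym
      coercive := coer
      norm_le := fun x hx => (nH x hx).trans (by linarith)
      lower := fun x hx y hy => ?_
      upper := fun x hx y hy => ?_
      even := fun z hz v hv hv' => taylor_even hΩ.convex dU dG hz hv hv' hM1 fun w hw hw' => ?_
      cubic := fun z hz v hv => taylor_cubic hΩ.convex dU dG hz hv hM1
        fun x hx y hy => (lH x hx y hy).trans (by gcongr; linarith)
      det_eq := deteq
      f_continuousOn := hf
      f_lower := fun x hx => by rw [deteq x hx]; exact pow_le_det hlam (sym x hx) (coer x hx)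
      f_upper := fun x hx => by
        rw [deteq x hx]
        exact (le_abs_self _).trans ((hC _ (nH x hx)).1.trans hCM)
      f_taylor := fun z hz => ?_ }
  · have := norm_iteratedFDeriv_le_of_c31Norm hm0 hnorm' (k := 0) (by norm_num) hx
    rw [norm_iteratedFDeriv_zero] at this
    exact this.trans (by linarith)
  · exact (clos x hx y hy (lam / 2)).1.closure_le hy (clos x hx y hy 0).2 fun y hy =>
      (taylor_two_bounds hΩ.convex dU dG hx hy coer nH).1
  · have h1 := (clos x hx y hy 0).2.closure_le hy (clos x hx y hy (m / 2)).1 fun y hy =>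
      (taylor_two_bounds hΩ.convex dU dG hx hy coer nH).2
    refine h1.trans ?_
    gcongr
    linarith
  · have e : H (z + w) + H (z - w) - (2 : ℝ) • H z =
        (H (z + w) - H z - T z (z + w - z)) + (H (z - w) - H z - T z (z - w - z)) := by
      rw [add_sub_cancel_left, show z - w - z = -w by abel, map_neg]
      module
    rw [e]
    refine (norm_add_le _ _).trans ((add_le_add (tH z hz _ hw) (tH z hz _ hw')).trans ?_)
    rw [add_sub_cancel_left, show z - w - z = -w by abel, norm_neg]
    nlinarith [sq_nonneg ‖w‖]
  · obtain ⟨-, L, hL, hL'⟩ := hC (H z) (nH z hz)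
    refine ⟨L ∘L T z, fun x hx => ?_⟩
    rw [deteq x hx, deteq z hz]
    have e1 := hL' (H x) (nH x hx)
    have e2 : |L (H x - H z - T z (x - z))| ≤ C * (m * ‖x - z‖ ^ 2) :=
      (L.le_opNorm _).trans (mul_le_mul hL (tH z hz x hx) (norm_nonneg _) hC0)
    have e3 : ‖H x - H z‖ ^ 2 ≤ m ^ 2 * ‖x - z‖ ^ 2 := by
      rw [← mul_pow]
      exact pow_le_pow_left₀ (norm_nonneg _) (lH x hx z hz) 2
    have e4 : (H x).det - (H z).det - (L ∘L T z) (x - z) =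
        ((H x).det - (H z).det - L (H x - H z)) + L (H x - H z - T z (x - z)) := by
      rw [ContinuousLinearMap.comp_apply, map_sub L (H x - H z)]
      ring
    rw [e4]
    calc _ ≤ C * ‖H x - H z‖ ^ 2 + C * (m * ‖x - z‖ ^ 2) := (abs_add_le _ _).trans (add_le_add e1 e2)
      _ ≤ C * (m ^ 2 * ‖x - z‖ ^ 2) + C * (m * ‖x - z‖ ^ 2) := by gcongr
      _ = C * (m ^ 2 + m) * ‖x - z‖ ^ 2 := by ring
      _ ≤ M * ‖x - z‖ ^ 2 := by gcongr

/-! ### Geometry of the domain -/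

lemma exists_mem_segment_frontier {Ω : Set (Space d)} (ho : IsOpen Ω) {x y : Space d}
    (hx : x ∈ Ω) (hy : y ∉ Ω) : ∃ p ∈ segment ℝ x y, p ∈ frontier Ω := by
  by_contra! hcon
  refine hy ((convex_segment x y).isPreconnected.subset_of_closure_inter_subset ho
    ⟨x, left_mem_segment ℝ x y, hx⟩ ?_ (right_mem_segment ℝ x y))
  rintro p ⟨hp, hps⟩
  by_contra hpn
  exact hcon p hps ⟨hp, by rwa [ho.interior_eq]⟩

lemma notMem_of_mem_frontier {Ω : Set (Space d)} (ho : IsOpen Ω) {x : Space d}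
    (hx : x ∈ frontier Ω) : x ∉ Ω := by
  rw [ho.frontier_eq] at hx
  exact hx.2

lemma mem_or_mem_frontier {Ω : Set (Space d)} {x : Space d} (hx : x ∈ closure Ω) :
    x ∈ Ω ∨ x ∈ frontier Ω := by
  by_cases h : x ∈ Ω
  · exact Or.inl h
  · exact Or.inr ⟨hx, fun h' => h (interior_subset h')⟩

lemma dist_le_of_mem_segment {x y p : Space d} (hp : p ∈ segment ℝ x y) : dist p x ≤ dist y x :=
  (convex_closedBall x (dist y x)).segment_subset (Metric.mem_closedBall_self dist_nonneg)
    (Metric.mem_closedBall.2 le_rfl) hp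

/-- Depth is mostly measured by contained balls below. A segment from `x` to a point outside crosses
the frontier, which links both notions. -/
lemma ball_subset_iff_le_infDist {Ω : Set (Space d)} (ho : IsOpen Ω) (hf : (frontier Ω).Nonempty)
    {x : Space d} (hx : x ∈ Ω) {r : ℝ} :
    Metric.ball x r ⊆ Ω ↔ r ≤ Metric.infDist x (frontier Ω) := by
  rw [Metric.le_infDist hf]
  constructor
  · intro h y hy
    by_contra! hlt
    exact notMem_of_mem_frontier ho hy (h (by rwa [Metric.mem_ball, dist_comm]))
  · intro h y hy
    by_contra hyn
    obtain ⟨p, hp, hpf⟩ := exists_mem_segment_frontier ho hx hyn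
    have h1 := h hpf
    have h2 := dist_le_of_mem_segment hp
    rw [Metric.mem_ball] at hy
    rw [dist_comm] at h1
    linarith

lemma frontier_nonempty (hd : 1 ≤ d) {Ω : Set (Space d)} (hn : Ω.Nonempty)
    (hb : Bornology.IsBounded Ω) : (frontier Ω).Nonempty := by
  have : Nonempty (Fin d) := ⟨⟨0, hd⟩⟩
  refine nonempty_frontier_iff.2 ⟨hn, ?_⟩
  rintro rfl
  exact NormedSpace.unbounded_univ ℝ (Space d) hb

lemma ball_subset_ball_of_le {x y : Space d} {r s : ℝ} (h : s + dist y x ≤ r) :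
    Metric.ball y s ⊆ Metric.ball x r := Metric.ball_subset_ball' h

lemma ball_combo_subset {Ω : Set (Space d)} (hc : Convex ℝ Ω) {x y : Space d} {r t : ℝ}
    (hx : x ∈ Ω) (ht : 0 < t) (ht1 : t ≤ 1)
    (hy : Metric.ball y r ⊆ Ω) : Metric.ball ((1 - t) • x + t • y) (t * r) ⊆ Ω := by
  intro p hp
  have h1 : y + t⁻¹ • (p - ((1 - t) • x + t • y)) ∈ Ω := by
    apply hy
    rw [Metric.mem_ball, dist_eq_norm, add_sub_cancel_left, norm_smul, norm_inv,
      Real.norm_of_nonneg ht.le, inv_mul_lt_iff₀ ht, ← dist_eq_norm]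
    exact hp
  have h2 := hc hx h1 (sub_nonneg.2 ht1) ht.le (by ring)
  convert h2 using 1
  rw [smul_add, smul_smul, mul_inv_cancel₀ ht.ne', one_smul]
  abel

/-- The set of points at depth at least `s` in `Ω`. -/
def inset (Ω : Set (Space d)) (s : ℝ) : Set (Space d) := {x | Metric.ball x s ⊆ Ω}

lemma inset_subset {Ω : Set (Space d)} {s : ℝ} (hs : 0 < s) : inset Ω s ⊆ Ω :=
  fun _ hx => hx (Metric.mem_ball_self hs)

lemma measurableSet_inset (Ω : Set (Space d)) (s : ℝ) : MeasurableSet (inset Ω s) := by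
  have : inset Ω s = (⋃ y ∈ Ωᶜ, Metric.ball y s)ᶜ := by
    ext x
    simp only [inset, mem_ofPred_eq, subset_def, mem_compl_iff, mem_iUnion, not_exists,
      Metric.mem_ball]
    constructor
    · intro h y hy hxy
      exact hy (h y (by rwa [dist_comm]))
    · intro h y hy
      by_contra hyn
      exact h y hyn (by rwa [dist_comm])
  rw [this]
  exact (isOpen_biUnion fun y _ => Metric.isOpen_ball).measurableSet.compl

/-- Quantitative geometry of a solution with minimum `-μ²`, attained at `x₀`. -/
structure IsRound (c C : ℝ) (Ω : Set (Space d)) (u : Space d → ℝ) (G : Space d → Space d)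
    (x₀ : Space d) (μ : ℝ) : Prop where
  pos : 0 < μ
  le : μ ≤ C
  center : Metric.ball x₀ (c * μ) ⊆ Ω
  bounded : ∀ x ∈ closure Ω, ‖x - x₀‖ ≤ C * μ
  min : u x₀ = -μ ^ 2
  min_le : ∀ x ∈ closure Ω, -μ ^ 2 ≤ u x
  nonpos : ∀ x ∈ closure Ω, u x ≤ 0
  neg : ∀ x ∈ Ω, u x < 0
  grad_le : ∀ x ∈ Ω, ‖G x‖ ≤ C * μ
  lip : ∀ x ∈ Ω, ∀ y ∈ closure Ω, |u y - u x| ≤ C * μ * ‖y - x‖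
  growth : ∀ z ∈ Ω, ∀ δ, 0 < δ → Metric.ball z δ ⊆ Ω → c * μ * δ ≤ -u z

section

variable {lam M : ℝ} {Ω : Set (Space d)} {f u : Space d → ℝ}
  {G : Space d → Space d} {H : Space d → Space d →L[ℝ] Space d}

lemma RegularSolution.norm_grad_sub_le (S : RegularSolution lam M Ω f u G H) {x y : Space d}
    (hx : x ∈ Ω) (hy : y ∈ Ω) : ‖G x - G y‖ ≤ M * ‖x - y‖ :=
  Convex.norm_image_sub_le_of_norm_hasFDerivWithin_le (𝕜 := ℝ)
    (fun w hw => (S.grad w hw).hasFDerivWithinAt) S.norm_le S.convex hy hx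

/-- By strict convexity `u` increases in any direction along which its slope is nonnegative. -/
lemma RegularSolution.notMem_of_isMax (S : RegularSolution lam M Ω f u G H) (hd : 1 ≤ d)
    (hlam : 0 < lam) {x : Space d} (hx : x ∈ Ω) : ¬ ∀ y ∈ closure Ω, u y ≤ u x := by
  intro hmax
  obtain ⟨r, hr, hball⟩ := Metric.isOpen_iff.1 S.isOpen x hx
  obtain ⟨v, hv, hGv⟩ : ∃ v : Space d, ‖v‖ = 1 ∧ 0 ≤ inner ℝ (G x) v := by
    set e : Space d := EuclideanSpace.single ⟨0, hd⟩ 1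
    have he : ‖e‖ = 1 := by simp [e]
    rcases le_total 0 (inner ℝ (G x) e) with h | h
    · exact ⟨e, he, h⟩
    · exact ⟨-e, by rw [norm_neg, he], by rw [inner_neg_right]; linarith⟩
  have hm : x + (r / 2) • v ∈ Ω := hball (by
    rw [Metric.mem_ball, dist_eq_norm, add_sub_cancel_left, norm_smul, hv,
      Real.norm_of_nonneg (by positivity)]; linarith)
  have h1 := S.lower x hx _ (subset_closure hm)
  have h2 := hmax _ (subset_closure hm)
  rw [add_sub_cancel_left, norm_smul, hv, inner_smul_right, Real.norm_of_nonneg (by positivity)]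
    at h1
  have h3 : 0 < lam / 2 * (r / 2 * 1) ^ 2 := by positivity
  have h4 : 0 ≤ r / 2 * inner ℝ (G x) v := by positivity
  linarith

lemma RegularSolution.neg (S : RegularSolution lam M Ω f u G H) (hd : 1 ≤ d) (hlam : 0 < lam) :
    (∀ x ∈ closure Ω, u x ≤ 0) ∧ ∀ x ∈ Ω, u x < 0 := by
  have hcomp : IsCompact (closure Ω) := S.isBounded.isCompact_closure
  obtain ⟨y, hy, hmax⟩ := hcomp.exists_isMaxOn (S.nonempty.mono subset_closure) S.continuousOn
  have hle : ∀ x ∈ closure Ω, u x ≤ 0 := by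
    rcases mem_or_mem_frontier hy with h | h
    · exact absurd (fun z hz => hmax hz) (S.notMem_of_isMax hd hlam h)
    · intro x hx
      rw [← S.boundary y h]
      exact hmax hx
  refine ⟨hle, fun x hx => lt_of_le_of_ne (hle x (subset_closure hx)) fun h0 => ?_⟩
  exact S.notMem_of_isMax hd hlam hx fun z hz => by rw [h0]; exact hle z hz

lemma RegularSolution.grad_eq_zero (S : RegularSolution lam M Ω f u G H) (hM : 1 ≤ M)
    {x : Space d} (hx : x ∈ Ω) (hmin : ∀ y ∈ closure Ω, u x ≤ u y) : G x = 0 := by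
  obtain ⟨r, hr, hball⟩ := Metric.isOpen_iff.1 S.isOpen x hx
  by_contra hG
  have hG' : 0 < ‖G x‖ := norm_pos_iff.2 hG
  set t : ℝ := min (r / (2 * ‖G x‖)) (1 / M) with ht
  have ht0 : 0 < t := by positivity
  have ht1 : t * ‖G x‖ < r := by
    calc t * ‖G x‖ ≤ r / (2 * ‖G x‖) * ‖G x‖ := by gcongr; exact min_le_left _ _
      _ = r / 2 := by field_simp
      _ < r := by linarith
  have ht2 : M * t ≤ 1 := by
    calc M * t ≤ M * (1 / M) := by gcongr; exact min_le_right _ _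
      _ = 1 := by field_simp
  have hm : x + (-t) • G x ∈ Ω := hball (by
    rw [Metric.mem_ball, dist_eq_norm, add_sub_cancel_left, norm_smul, norm_neg,
      Real.norm_of_nonneg ht0.le]; exact ht1)
  have h1 := S.upper x hx _ (subset_closure hm)
  have h2 := hmin _ (subset_closure hm)
  rw [add_sub_cancel_left, norm_smul, inner_smul_right, norm_neg, Real.norm_of_nonneg ht0.le,
    real_inner_self_eq_norm_sq] at h1
  have h3 : t * ‖G x‖ ^ 2 ≤ M / 2 * (t * ‖G x‖) ^ 2 := by linarith
  have h4 : M / 2 * (t * ‖G x‖) ^ 2 = (M * t) / 2 * (t * ‖G x‖ ^ 2) := by ring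
  have h5 : 0 < t * ‖G x‖ ^ 2 := by positivity
  nlinarith

end

/-- At the minimum point the gradient vanishes, so `u + μ²` lies between `lam / 2` and `M / 2` times
the squared distance to `x₀`. As `u = 0` on the boundary, the domain is pinched between balls of
radii `√(2 / M) μ` and `√(2 / lam) μ`. The gradient is Lipschitz, hence `O(μ)`; convexity gives
linear growth away from the boundary. -/
theorem exists_isRound (hd : 1 ≤ d) {lam M : ℝ} (hlam : 0 < lam) (hM : 1 ≤ M) :
    ∃ c C : ℝ, 0 < c ∧ 1 ≤ C ∧ ∀ (Ω : Set (Space d)) (f u : Space d → ℝ) (G : Space d → Space d)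
      (H : Space d → Space d →L[ℝ] Space d), RegularSolution lam M Ω f u G H →
      ∃ x₀ ∈ Ω, ∃ μ, IsRound c C Ω u G x₀ μ := by
  set c₁ : ℝ := √(2 / M) with hc₁
  set C₁ : ℝ := √(2 / lam) with hC₁
  have hc₁0 : 0 < c₁ := by positivity
  have hC₁0 : 0 < C₁ := by positivity
  have hc₁s : c₁ ^ 2 = 2 / M := Real.sq_sqrt (by positivity)
  have hC₁s : C₁ ^ 2 = 2 / lam := Real.sq_sqrt (by positivity)
  set C : ℝ := 1 + M + C₁ + 2 * M * C₁ with hC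
  have hMC : 0 < M * C₁ := by positivity
  refine ⟨min c₁ (1 / (2 * C₁)), C, by positivity, by linarith, ?_⟩
  intro Ω f u G H S
  obtain ⟨hle, hneg⟩ := S.neg hd hlam
  have hcomp : IsCompact (closure Ω) := S.isBounded.isCompact_closure
  obtain ⟨x₀, hx₀c, hmin⟩ := hcomp.exists_isMinOn (S.nonempty.mono subset_closure) S.continuousOn
  have hmin' : ∀ y ∈ closure Ω, u x₀ ≤ u y := fun y hy => hmin hy
  have hx₀ : x₀ ∈ Ω := by
    rcases mem_or_mem_frontier hx₀c with h | h
    · exact h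
    · obtain ⟨z, hz⟩ := S.nonempty
      have := hmin' z (subset_closure hz)
      rw [S.boundary _ h] at this
      linarith [hneg z hz]
  have hG0 := S.grad_eq_zero hM hx₀ hmin'
  set μ : ℝ := √(-u x₀) with hμ
  have hux₀ := hneg x₀ hx₀
  have hμ0 : 0 < μ := Real.sqrt_pos.2 (by linarith)
  have hμ2 : μ ^ 2 = -u x₀ := Real.sq_sqrt (by linarith)
  have hbd : ∀ x ∈ closure Ω, ‖x - x₀‖ ≤ C₁ * μ := fun x hx => by
    have h1 := S.lower x₀ hx₀ x hx
    rw [hG0, inner_zero_left] at h1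
    have h2 := hle x hx
    refine abs_le_of_sq_le_sq' ?_ (by positivity) |>.2
    rw [mul_pow, hC₁s, div_mul_eq_mul_div, le_div_iff₀ hlam]
    linarith
  have hfr : ∀ x ∈ frontier Ω, c₁ * μ ≤ ‖x - x₀‖ := fun x hx => by
    have h1 := S.upper x₀ hx₀ x (frontier_subset_closure hx)
    rw [hG0, inner_zero_left, S.boundary x hx] at h1
    refine abs_le_of_sq_le_sq' ?_ (norm_nonneg _) |>.2
    rw [mul_pow, hc₁s, div_mul_eq_mul_div, div_le_iff₀ (by linarith)]
    linarith
  have hgr : ∀ x ∈ Ω, ‖G x‖ ≤ M * (C₁ * μ) := fun x hx => by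
    have h1 := S.norm_grad_sub_le hx hx₀
    rw [hG0, sub_zero] at h1
    exact h1.trans (by gcongr; exact hbd x (subset_closure hx))
  have hf := frontier_nonempty hd S.nonempty S.isBounded
  refine ⟨x₀, hx₀, μ, ?_⟩
  refine
    { pos := hμ0
      le := ?_
      center := ?_
      bounded := fun x hx => (hbd x hx).trans (by gcongr; linarith)
      min := by rw [hμ2]; ring
      min_le := fun x hx => by rw [hμ2, neg_neg]; exact hmin' x hx
      nonpos := hle
      neg := hneg
      grad_le := fun x hx => (hgr x hx).trans (by rw [← mul_assoc]; gcongr; linarith)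
      lip := fun x hx y hy => ?_
      growth := fun z hz δ hδ hball => ?_ }
  · have h1 := S.abs_le x₀ hx₀
    rw [abs_of_neg hux₀, ← hμ2] at h1
    have : μ ≤ M := by
      by_contra! hlt
      nlinarith
    linarith
  · rw [ball_subset_iff_le_infDist S.isOpen hf hx₀, Metric.le_infDist hf]
    intro y hy
    rw [dist_comm, dist_eq_norm]
    refine le_trans ?_ (hfr y hy)
    gcongr
    exact min_le_left _ _
  · have hyx : ‖y - x‖ ≤ 2 * (C₁ * μ) := by
      have := norm_sub_le (y - x₀) (x - x₀)
      rw [sub_sub_sub_cancel_right] at this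
      linarith [hbd y hy, hbd x (subset_closure hx)]
    have h1 := S.lower x hx y hy
    have h2 := S.upper x hx y hy
    have h3 : |inner ℝ (G x) (y - x)| ≤ M * (C₁ * μ) * ‖y - x‖ :=
      (abs_real_inner_le_norm _ _).trans (by gcongr; exact hgr x hx)
    have h4 := abs_le.1 h3
    have h5 : M / 2 * ‖y - x‖ ^ 2 ≤ M * (C₁ * μ) * ‖y - x‖ := by
      calc M / 2 * ‖y - x‖ ^ 2 = M / 2 * ‖y - x‖ * ‖y - x‖ := by ring
        _ ≤ M / 2 * (2 * (C₁ * μ)) * ‖y - x‖ := by gcongr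
        _ = _ := by ring
    have h6 : 0 ≤ lam / 2 * ‖y - x‖ ^ 2 := by positivity
    have h7 : 2 * (M * (C₁ * μ) * ‖y - x‖) ≤ C * μ * ‖y - x‖ := by
      calc 2 * (M * (C₁ * μ) * ‖y - x‖) = 2 * M * C₁ * (μ * ‖y - x‖) := by ring
        _ ≤ C * (μ * ‖y - x‖) := by gcongr; linarith
        _ = _ := by ring
    have h8 : 0 ≤ M * (C₁ * μ) * ‖y - x‖ := by positivity
    exact abs_le.2 ⟨by linarith, by linarith⟩
  · have hδ1 : δ ≤ C₁ * μ := by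
      set e : Space d := EuclideanSpace.single ⟨0, hd⟩ 1
      have he : ‖e‖ = 1 := by simp [e]
      have hcl : Metric.closedBall z δ ⊆ closure Ω := by
        rw [← closure_ball z hδ.ne']
        exact closure_mono hball
      have p1 := hbd _ (hcl (show z + δ • e ∈ _ by
        simp [he, norm_smul, abs_of_pos hδ]))
      have p2 := hbd _ (hcl (show z - δ • e ∈ _ by
        simp [he, norm_smul, abs_of_pos hδ]))
      have p3 := norm_sub_le (z + δ • e - x₀) (z - δ • e - x₀)
      rw [show z + δ • e - x₀ - (z - δ • e - x₀) = (2 * δ) • e by module, norm_smul, he,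
        Real.norm_of_nonneg (by positivity)] at p3
      linarith
    set s : ℝ := δ / (C₁ * μ) with hs
    have hs0 : 0 < s := by positivity
    have hs1 : s ≤ 1 := (div_le_one (by positivity)).2 hδ1
    have hcl : Metric.closedBall z δ ⊆ closure Ω := by
      rw [← closure_ball z hδ.ne']
      exact closure_mono hball
    -- The ray from `x₀` through `z` is prolonged by at most `δ`. At its end `u ≤ 0`, at `x₀` it is
    -- `-μ²`, and convexity bounds `u z` in between.
    have hξ : z + s • (z - x₀) ∈ closure Ω := hcl (by
      rw [Metric.mem_closedBall, dist_eq_norm, add_sub_cancel_left, norm_smul,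
        Real.norm_of_nonneg hs0.le]
      calc s * ‖z - x₀‖ ≤ s * (C₁ * μ) := by gcongr; exact hbd z (subset_closure hz)
        _ = δ := by rw [hs]; field_simp)
    have hconv := S.convexOn.2 hξ hx₀c (show 0 ≤ 1 / (1 + s) by positivity)
      (show 0 ≤ s / (1 + s) by positivity) (by field_simp)
    have e1 : (1 / (1 + s)) • (z + s • (z - x₀)) + (s / (1 + s)) • x₀ = z := by
      have : (1 / (1 + s)) • (z + s • (z - x₀)) + (s / (1 + s)) • x₀ =
        ((1 + s) / (1 + s)) • z := by module
      rw [this, div_self (by positivity), one_smul]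
    rw [e1, smul_eq_mul, smul_eq_mul, ← neg_eq_iff_eq_neg.2 hμ2] at hconv
    have h1 : 1 / (1 + s) * u (z + s • (z - x₀)) ≤ 0 :=
      mul_nonpos_of_nonneg_of_nonpos (by positivity) (hle _ hξ)
    have h2 : s / 2 * μ ^ 2 ≤ s / (1 + s) * μ ^ 2 := by
      gcongr
      linarith
    have h3 : s / 2 * μ ^ 2 = 1 / (2 * C₁) * μ * δ := by rw [hs]; field_simp
    have h4 : min c₁ (1 / (2 * C₁)) * μ * δ ≤ 1 / (2 * C₁) * μ * δ := by
      gcongr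
      exact min_le_right _ _
    linarith

/-! ### Volumes of the domain and of its boundary layers -/

lemma ballVol_eq {r : ℝ} (hr : 0 ≤ r) : ballVol d r = r ^ d * ballVol d 1 := by
  rw [ballVol, ballVol, Measure.addHaar_closedBall' volume _ hr, ENNReal.toReal_mul,
    ENNReal.toReal_ofReal (by positivity), finrank_euclideanSpace_fin]

lemma volume_closedBall_center_eq (x : Space d) {r : ℝ} (hr : 0 ≤ r) :
    volume (Metric.closedBall x r) = ENNReal.ofReal (r ^ d * ballVol d 1) := by
  rw [← ballVol_eq hr, ← volume_closedBall_eq, Measure.addHaar_closedBall_center]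

lemma ballVol_pos {r : ℝ} (hr : 0 < r) : 0 < ballVol d r :=
  ENNReal.toReal_pos (Metric.measure_closedBall_pos volume _ hr).ne' measure_closedBall_lt_top.ne

section

variable {lam M c C μ : ℝ} {Ω : Set (Space d)} {f u : Space d → ℝ}
  {G : Space d → Space d} {H : Space d → Space d →L[ℝ] Space d} {x₀ : Space d}

lemma IsRound.volume_le_pow (R : IsRound c C Ω u G x₀ μ) (hC : 1 ≤ C) :
    volume Ω ≤ ENNReal.ofReal (C ^ d * ballVol d 1 * μ ^ d) := by
  have hsub : Ω ⊆ Metric.closedBall x₀ (C * μ) := fun x hx => by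
    rw [Metric.mem_closedBall, dist_eq_norm]
    exact R.bounded x (subset_closure hx)
  refine (measure_mono hsub).trans (le_of_eq ?_)
  rw [volume_closedBall_center_eq _ (by have := R.pos; positivity), mul_pow]
  ring_nf

lemma IsRound.pow_le (R : IsRound c C Ω u G x₀ μ) (hd : 1 ≤ d) (hC : 1 ≤ C) :
    μ ^ d ≤ C ^ d * μ := by
  obtain ⟨k, rfl⟩ : ∃ k, d = k + 1 := ⟨d - 1, by omega⟩
  have := R.pos
  calc μ ^ (k + 1) = μ ^ k * μ := pow_succ _ _
    _ ≤ C ^ k * μ := by gcongr; exact R.le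
    _ ≤ C ^ (k + 1) * μ := by gcongr; omega

/-- The constant in the volume estimates for a round domain. -/
def layerConst (d : ℕ) (c C : ℝ) : ℝ := C ^ d * ballVol d 1 * C ^ d * (1 + (d + 1) / c)

lemma IsRound.volume_le (R : IsRound c C Ω u G x₀ μ) (hd : 1 ≤ d) (hc : 0 < c) (hC : 1 ≤ C) :
    volume Ω ≤ ENNReal.ofReal (layerConst d c C * μ) := by
  refine (R.volume_le_pow hC).trans (ENNReal.ofReal_le_ofReal ?_)
  have h0 := ballVol_nonneg (d := d) 1
  have hμ := R.pos
  calc C ^ d * ballVol d 1 * μ ^ d ≤ C ^ d * ballVol d 1 * (C ^ d * μ) := by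
        gcongr; exact R.pow_le hd hC
    _ = C ^ d * ballVol d 1 * C ^ d * 1 * μ := by ring
    _ ≤ _ := by rw [layerConst]; gcongr; exact le_add_of_nonneg_right (by positivity)

/-- The homothety with centre `x₀` and ratio `1 - s / (c μ)` maps `Ω` into the inset, since `x₀` has
depth `c μ`; Bernoulli's inequality bounds the lost volume. If `s ≥ c μ`, the volume of all of `Ω`
is already small enough. -/
lemma IsRound.volume_diff_inset_le (R : IsRound c C Ω u G x₀ μ) (hΩ : Convex ℝ Ω)
    (hd : 1 ≤ d) (hc : 0 < c) (hC : 1 ≤ C) {s : ℝ} (hs : 0 < s) :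
    volume (Ω \ inset Ω s) ≤ ENNReal.ofReal (layerConst d c C * s) := by
  have h0 := ballVol_nonneg (d := d) 1
  have hμ := R.pos
  set V : ℝ := C ^ d * ballVol d 1 with hV
  have hV0 : 0 ≤ V := by positivity
  rcases le_or_gt (c * μ) s with hlt | hlt
  · refine (measure_mono sdiff_subset).trans ((R.volume_le_pow hC).trans
      (ENNReal.ofReal_le_ofReal ?_))
    have h1 : μ ≤ s / c := by rw [le_div_iff₀ hc]; linarith
    calc V * μ ^ d ≤ V * (C ^ d * μ) := by gcongr; exact R.pow_le hd hC
      _ ≤ V * (C ^ d * (s / c)) := by gcongr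
      _ = V * C ^ d * (1 / c) * s := by ring
      _ ≤ V * C ^ d * (1 + (d + 1) / c) * s := by
        gcongr
        have : 1 / c ≤ (d + 1) / c := by gcongr; linarith [Nat.cast_nonneg (α := ℝ) d]
        linarith
  · set θ : ℝ := s / (c * μ) with hθ
    have hθ0 : 0 < θ := by positivity
    have hθ1 : θ < 1 := (div_lt_one (by positivity)).2 hlt
    have hsub : AffineMap.homothety x₀ (1 - θ) '' Ω ⊆ Ω ∩ inset Ω s := by
      rintro _ ⟨x, hx, rfl⟩
      have h1 := ball_combo_subset hΩ hx hθ0 hθ1.le R.center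
      have h2 : (1 - θ) • x + θ • x₀ = AffineMap.homothety x₀ (1 - θ) x := by
        rw [AffineMap.homothety_apply, vsub_eq_sub, vadd_eq_add]; module
      rw [h2, hθ, div_mul_cancel₀ _ (by positivity)] at h1
      exact ⟨inset_subset hs h1, h1⟩
    have hfin : volume Ω ≠ ∞ := ((R.volume_le_pow hC).trans_lt ENNReal.ofReal_lt_top).ne
    set v : ℝ := (volume Ω).toReal with hv
    have hv0 : 0 ≤ v := ENNReal.toReal_nonneg
    have hvΩ : volume Ω = ENNReal.ofReal v := (ENNReal.ofReal_toReal hfin).symm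
    have hvle : v ≤ V * μ ^ d := by
      have := R.volume_le_pow hC
      rw [hvΩ] at this
      exact (ENNReal.ofReal_le_ofReal_iff (by positivity)).1 this
    have h1 : ENNReal.ofReal ((1 - θ) ^ d * v) + volume (Ω \ inset Ω s) ≤ ENNReal.ofReal v := by
      rw [← hvΩ, ← measure_inter_add_sdiff Ω (measurableSet_inset Ω s)]
      gcongr
      refine le_trans (le_of_eq ?_) (measure_mono hsub)
      rw [Measure.addHaar_image_homothety, finrank_euclideanSpace_fin, hvΩ,
        ← ENNReal.ofReal_mul (by positivity), abs_of_nonneg (by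
          have := sub_nonneg.2 hθ1.le; positivity)]
    have hpow : 0 ≤ (1 - θ) ^ d * v := by have := sub_nonneg.2 hθ1.le; positivity
    have h2 : volume (Ω \ inset Ω s) ≤ ENNReal.ofReal (v - (1 - θ) ^ d * v) := by
      rw [ENNReal.ofReal_sub _ hpow]
      exact ENNReal.le_sub_of_add_le_left ENNReal.ofReal_ne_top h1
    refine h2.trans (ENNReal.ofReal_le_ofReal ?_)
    have h3 : 1 + (d : ℝ) * (-θ) ≤ (1 + -θ) ^ d := one_add_mul_le_pow (by linarith) d
    rw [← sub_eq_add_neg] at h3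
    calc v - (1 - θ) ^ d * v = (1 - (1 - θ) ^ d) * v := by ring
      _ ≤ (d * θ) * v := by gcongr; linarith
      _ ≤ (d * θ) * (V * (C ^ d * μ)) := by
        gcongr; exact hvle.trans (by gcongr; exact R.pow_le hd hC)
      _ = V * C ^ d * (d / c) * s := by rw [hθ]; field_simp
      _ ≤ V * C ^ d * (1 + (d + 1) / c) * s := by
        gcongr
        have : d / c ≤ (d + 1) / c := by gcongr; linarith
        linarith

end

/-- A point near the boundary is a convex combination, with weight at least `1/2`, of a given nearby
boundary point and a nearby point of the interior at given depth. -/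
lemma exists_deep_extension {lam M c C A r : ℝ} (hM : 1 ≤ M) (hc : 0 < c) (hC : 1 ≤ C)
    (hA : 0 < A) (hr : 0 < r) (hd : 1 ≤ d) : ∃ L C₀ : ℝ, 0 < L ∧ 0 < C₀ ∧
    ∀ (Ω : Set (Space d)) (f u : Space d → ℝ) (G : Space d → Space d)
      (H : Space d → Space d →L[ℝ] Space d), RegularSolution lam M Ω f u G H →
      ∀ x₀ μ, IsRound c C Ω u G x₀ μ → ∀ h, 0 < h → C₀ * h ≤ μ →
      ∀ z ∈ Ω, Metric.ball z (h / 2) ⊆ Ω → ∀ x' ∈ frontier Ω, ‖z - x'‖ ≤ A * h →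
      ∃ (w : Space d) (θ : ℝ), 1 / 2 ≤ θ ∧ θ ≤ 1 ∧ z = θ • x' + (1 - θ) • w ∧
        Metric.ball w (r * h) ⊆ Ω ∧ ‖w - z‖ ≤ L * h := by
  set L : ℝ := A + 8 * A * (C * r + 1) / c with hL
  have hL0 : 0 < L := by positivity
  have hLA : A ≤ L := le_add_of_nonneg_right (by positivity)
  have hLr : C * r < L * (c / (8 * A)) := by
    have : 8 * A * (C * r + 1) / c * (c / (8 * A)) = C * r + 1 := by field_simp
    have h2 : 0 < A * (c / (8 * A)) := by positivity
    rw [hL, add_mul, this]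
    linarith
  refine ⟨L, 2 * M * A ^ 2 / c + 4 * A * M * L / c, hL0, by positivity, ?_⟩
  intro Ω f u G H S x₀ μ R h hh hμh z hz hball x' hx' hzx
  have hμ := R.pos
  have hfr := frontier_nonempty hd S.nonempty S.isBounded
  have h1 : 2 * M * A ^ 2 / c * h ≤ μ := le_trans (by
    gcongr; exact le_add_of_nonneg_right (by positivity)) hμh
  have h2 : 4 * A * M * L / c * h ≤ μ := le_trans (by
    gcongr; exact le_add_of_nonneg_left (by positivity)) hμh
  rw [div_mul_eq_mul_div, div_le_iff₀ hc] at h1 h2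
  set t : ℝ := ‖z - x'‖ with ht
  have ht0 : 0 < t := by
    rw [ht, norm_pos_iff, sub_ne_zero]
    rintro rfl
    exact notMem_of_mem_frontier S.isOpen hx' hz
  have hg := R.growth z hz (h / 2) (by positivity) hball
  set ν : Space d := t⁻¹ • (z - x') with hν
  have hνn : ‖ν‖ = 1 := by rw [hν, norm_smul, norm_inv, Real.norm_of_nonneg ht0.le, ← ht,
    inv_mul_cancel₀ ht0.ne']
  have hzx' : z - x' = t • ν := by rw [hν, smul_smul, mul_inv_cancel₀ ht0.ne', one_smul]
  -- The growth bound gives `-u z ≥ c μ h / 2`, while `u x' = 0` at distance at most `A h`, so `u`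
  -- descends steeply from `x'` towards `z`.
  have hslope : inner ℝ (G z) ν ≤ -(c * μ / (4 * A)) := by
    have h3 := S.upper z hz x' (frontier_subset_closure hx')
    rw [S.boundary x' hx', ← neg_sub z x', inner_neg_right, hzx', inner_smul_right, norm_neg,
      ← hzx', ← ht] at h3
    have h4 : t * (c * μ / (2 * A)) ≤ c * μ * (h / 2) := by
      rw [← mul_div_assoc, div_le_iff₀ (by positivity)]
      nlinarith [mul_pos hc hμ]
    have h5 : t * (inner ℝ (G z) ν) ≤ t * (-(c * μ / (2 * A)) + M / 2 * t) := by nlinarith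
    have h6 := le_of_mul_le_mul_left h5 ht0
    have h7 : M / 2 * t ≤ c * μ / (4 * A) := by
      rw [le_div_iff₀ (by positivity)]
      have : M / 2 * t * (4 * A) ≤ M / 2 * (A * h) * (4 * A) := by gcongr
      nlinarith
    have h8 : c * μ / (2 * A) = 2 * (c * μ / (4 * A)) := by field_simp; norm_num
    linarith
  have hdec : ∀ s, 0 ≤ s → s ≤ L * h → z + s • ν ∈ closure Ω →
      u (z + s • ν) ≤ u z - s * (c * μ / (8 * A)) := fun s hs0 hs hmem => by
    have h3 := S.upper z hz _ hmem
    rw [add_sub_cancel_left, inner_smul_right, norm_smul, hνn, Real.norm_of_nonneg hs0] at h3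
    have h4 : M / 2 * s ≤ c * μ / (8 * A) := by
      rw [le_div_iff₀ (by positivity)]
      have : M / 2 * s * (8 * A) ≤ M / 2 * (L * h) * (8 * A) := by gcongr
      nlinarith
    have h5 : s * inner ℝ (G z) ν ≤ s * -(c * μ / (4 * A)) := by gcongr
    have h6 : s * (M / 2 * s) ≤ s * (c * μ / (8 * A)) := by gcongr
    have h8 : c * μ / (4 * A) = 2 * (c * μ / (8 * A)) := by field_simp; norm_num
    rw [h8] at h5
    nlinarith
  set w : Space d := z + (L * h) • ν with hw
  have hLh : 0 < L * h := by positivity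
  -- On leaving the domain `u` would have to return to zero, but it decreases along the ray.
  have hwΩ : w ∈ Ω := by
    by_contra hwn
    obtain ⟨p, hp, hpf⟩ := exists_mem_segment_frontier S.isOpen hz hwn
    rw [segment_eq_image'] at hp
    obtain ⟨a, ha, rfl⟩ := hp
    have e : z + a • (w - z) = z + (a * (L * h)) • ν := by rw [hw]; module
    have h3 := hdec (a * (L * h)) (mul_nonneg ha.1 hLh.le) (mul_le_of_le_one_left hLh.le ha.2)
      (by simp only [e] at hpf; exact frontier_subset_closure hpf)
    simp only [e] at hpf
    rw [S.boundary _ hpf] at h3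
    have h4 : 0 ≤ a * (L * h) * (c * μ / (8 * A)) := by have := ha.1; positivity
    linarith [R.neg z hz]
  have hθ : 0 < L * h + t := by positivity
  refine ⟨w, L * h / (L * h + t), ?_, ?_, ?_, ?_, ?_⟩
  · rw [div_le_div_iff₀ two_pos hθ]
    nlinarith
  · exact (div_le_one hθ).2 (by linarith)
  · have e1 : 1 - L * h / (L * h + t) = t / (L * h + t) := by field_simp; ring
    have e2 : x' = z - t • ν := by rw [← hzx']; abel
    rw [e1, e2, hw]
    have : (L * h / (L * h + t)) • (z - t • ν) + (t / (L * h + t)) • (z + (L * h) • ν) =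
      ((L * h + t) / (L * h + t)) • z := by module
    rw [this, div_self hθ.ne', one_smul]
  -- `-u w` exceeds `C μ r h` by the choice of `L`, and `u` has Lipschitz constant `C μ`.
  · rw [ball_subset_iff_le_infDist S.isOpen hfr hwΩ, Metric.le_infDist hfr]
    intro y hy
    by_contra! hlt
    have h3 := R.lip w hwΩ y (frontier_subset_closure hy)
    rw [S.boundary y hy, zero_sub, abs_neg] at h3
    have h4 := hdec (L * h) hLh.le le_rfl (subset_closure hwΩ)
    rw [dist_comm, dist_eq_norm] at hlt
    have h5 : C * μ * ‖y - w‖ ≤ C * μ * (r * h) := by gcongr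
    have h6 : μ * h * (C * r) < μ * h * (L * (c / (8 * A))) := by gcongr
    have h7 : L * h * (c * μ / (8 * A)) = μ * h * (L * (c / (8 * A))) := by ring
    have h8 := neg_abs_le (u w)
    have h9 := R.neg z hz
    rw [← hw] at h4
    nlinarith
  · rw [hw, add_sub_cancel_left, norm_smul, hνn, mul_one, Real.norm_of_nonneg hLh.le]

/-! ### Simplicial complexes and piecewise linear interpolation -/

lemma weights_unique {s : Finset (Space d)} (hs : AffineIndependent ℝ ((↑) : s → Space d))
    {w w' : Space d → ℝ} (h1 : ∑ y ∈ s, w y = ∑ y ∈ s, w' y)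
    (h2 : ∑ y ∈ s, w y • y = ∑ y ∈ s, w' y • y) : ∀ y ∈ s, w y = w' y := by
  intro y hy
  have := hs.eq_zero_of_sum_eq_zero_subtype (w := fun y => w y - w' y)
    (by rw [Finset.sum_sub_distrib, h1, sub_self])
    (by simp only [sub_smul]; rw [Finset.sum_sub_distrib, h2, sub_self]) y hy
  linarith

section Complex

variable {K : Geometry.SimplicialComplex ℝ (Space d)}

/-- Two simplices meet in the hull of their common vertices; uniqueness of barycentric coordinates
then excludes every other vertex. -/
lemma mem_of_weight_ne_zero {s t : Finset (Space d)} (hs : s ∈ K.faces) (ht : t ∈ K.faces)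
    {w : Space d → ℝ} (h0 : ∀ y ∈ s, 0 ≤ w y) (h1 : ∑ y ∈ s, w y = 1)
    (hx : ∑ y ∈ s, w y • y ∈ convexHull ℝ (t : Set (Space d))) {y : Space d} (hy : y ∈ s)
    (hwy : w y ≠ 0) : y ∈ t := by
  classical
  have hx' := K.inter_subset_convexHull hs ht ⟨Finset.mem_convexHull'.2 ⟨w, h0, h1, rfl⟩, hx⟩
  rw [← Finset.coe_inter, Finset.mem_convexHull'] at hx'
  obtain ⟨w', -, h1', hw'⟩ := hx'
  have e := weights_unique (K.indep hs) (w := w) (w' := fun y => if y ∈ t then w' y else 0)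
    (by rw [h1, ← h1', ← Finset.sum_ite_mem])
    (by rw [← hw', ← Finset.sum_ite_mem]; simp only [ite_smul, zero_smul]) y hy
  by_contra hyt
  exact hwy (by rw [e]; simp [hyt])

/-- The interpolated value does not depend on the chosen simplex, so the supremum defining `interp`
is taken over one value. -/
lemma sum_weights_eq {s t : Finset (Space d)} (hs : s ∈ K.faces) (ht : t ∈ K.faces)
    {w w' : Space d → ℝ} (h0 : ∀ y ∈ s, 0 ≤ w y) (h1 : ∑ y ∈ s, w y = 1)
    (h0' : ∀ y ∈ t, 0 ≤ w' y) (h1' : ∑ y ∈ t, w' y = 1)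
    (hx : ∑ y ∈ s, w y • y = ∑ y ∈ t, w' y • y) (v : Space d → ℝ) :
    ∑ y ∈ s, w y * v y = ∑ y ∈ t, w' y * v y := by
  classical
  have hm' : ∀ y ∈ t, y ∉ s → w' y = 0 := fun y hy hys => by
    by_contra hne
    exact hys (mem_of_weight_ne_zero ht hs h0' h1'
      (by rw [← hx]; exact Finset.mem_convexHull'.2 ⟨w, h0, h1, rfl⟩) hy hne)
  have hsum : ∀ {X : Type} [AddCommMonoid X] (g : Space d → X), (∀ y, w' y = 0 → g y = 0) →
      ∑ y ∈ s, (if y ∈ t then g y else 0) = ∑ y ∈ t, g y := fun g hg => by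
    rw [Finset.sum_ite_mem]
    refine Finset.sum_subset Finset.inter_subset_right fun y hy hyn => hg y (hm' y hy fun hys => ?_)
    exact hyn (Finset.mem_inter.2 ⟨hys, hy⟩)
  have e := weights_unique (K.indep hs) (w := w) (w' := fun y => if y ∈ t then w' y else 0)
    (by rw [h1, hsum w' (fun y hy => hy), h1'])
    (by
      rw [hx, ← hsum (fun y => w' y • y) (fun y hy => by rw [hy, zero_smul])]
      simp only [ite_smul, zero_smul])
  rw [← hsum (fun y => w' y * v y) (fun y hy => by rw [hy, zero_mul])]
  refine Finset.sum_congr rfl fun y hy => ?_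
  rw [e y hy, ite_mul, zero_mul]

lemma interp_sum {s : Finset (Space d)} (hs : s ∈ K.faces) {w : Space d → ℝ}
    (h0 : ∀ y ∈ s, 0 ≤ w y) (h1 : ∑ y ∈ s, w y = 1) (v : Space d → ℝ) :
    interp K v (∑ y ∈ s, w y • y) = ∑ y ∈ s, w y * v y := by
  have : {t : ℝ | ∃ s' ∈ K.faces, ∃ w' : Space d → ℝ, (∀ y ∈ s', 0 ≤ w' y) ∧ ∑ y ∈ s', w' y = 1 ∧
      ∑ y ∈ s', w' y • y = ∑ y ∈ s, w y • y ∧ t = ∑ y ∈ s', w' y * v y} =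
      {∑ y ∈ s, w y * v y} := by
    ext t
    simp only [mem_ofPred_eq, mem_singleton_iff]
    constructor
    · rintro ⟨s', hs', w', h0', h1', hx, rfl⟩
      exact sum_weights_eq hs' hs h0' h1' h0 h1 hx v
    · rintro rfl
      exact ⟨s, hs, w, h0, h1, rfl, rfl⟩
  rw [interp, this, csSup_singleton]

lemma exists_weights {x : Space d} (hx : x ∈ K.space) : ∃ s ∈ K.faces, ∃ w : Space d → ℝ,
    (∀ y ∈ s, 0 ≤ w y) ∧ ∑ y ∈ s, w y = 1 ∧ ∑ y ∈ s, w y • y = x := by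
  obtain ⟨s, hs, hx⟩ := Geometry.SimplicialComplex.mem_space_iff.1 hx
  exact ⟨s, hs, Finset.mem_convexHull'.1 hx⟩

lemma interp_of_notMem {x : Space d} (hx : x ∉ K.space) (v : Space d → ℝ) : interp K v x = 0 := by
  have : {t : ℝ | ∃ s ∈ K.faces, ∃ w : Space d → ℝ, (∀ y ∈ s, 0 ≤ w y) ∧ ∑ y ∈ s, w y = 1 ∧
      ∑ y ∈ s, w y • y = x ∧ t = ∑ y ∈ s, w y * v y} = ∅ := by
    refine eq_empty_of_forall_notMem fun t => ?_
    rintro ⟨s, hs, w, h0, h1, hxw, -⟩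
    exact hx (Geometry.SimplicialComplex.mem_space_iff.2
      ⟨s, hs, Finset.mem_convexHull'.2 ⟨w, h0, h1, hxw⟩⟩)
  rw [interp, this, Real.sSup_empty]

lemma mem_vertices_of_mem {s : Finset (Space d)} (hs : s ∈ K.faces) {y : Space d} (hy : y ∈ s) :
    y ∈ K.vertices := by
  rw [Geometry.SimplicialComplex.vertices_eq]
  exact mem_biUnion hs hy

lemma interp_vertex {y : Space d} (hy : y ∈ K.vertices) (v : Space d → ℝ) :
    interp K v y = v y := by
  have := interp_sum (K := K) (s := {y}) hy (w := fun _ => 1) (fun _ _ => zero_le_one) (by simp) v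
  simpa using this

lemma abs_interp_le {B : ℝ} (hB : 0 ≤ B) {v : Space d → ℝ} (hv : ∀ y ∈ K.vertices, |v y| ≤ B)
    (x : Space d) : |interp K v x| ≤ B := by
  by_cases hx : x ∈ K.space
  · obtain ⟨s, hs, w, h0, h1, rfl⟩ := exists_weights hx
    rw [interp_sum hs h0 h1]
    calc |∑ y ∈ s, w y * v y| ≤ ∑ y ∈ s, |w y * v y| := Finset.abs_sum_le_sum_abs _ _
      _ ≤ ∑ y ∈ s, w y * B := Finset.sum_le_sum fun y hy => by
          rw [abs_mul, abs_of_nonneg (h0 y hy)]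
          exact mul_le_mul_of_nonneg_left (hv y (mem_vertices_of_mem hs hy)) (h0 y hy)
      _ = B := by rw [← Finset.sum_mul, h1, one_mul]
  · rwa [interp_of_notMem hx, abs_zero]

/-- Barycentric coordinates with respect to a full-dimensional simplex. -/
lemma exists_coord {s : Finset (Space d)} (hs : AffineIndependent ℝ ((↑) : s → Space d))
    (hcard : s.card = d + 1) : ∃ c : Space d → Space d → ℝ, (∀ y, Continuous (c y)) ∧
      (∀ x, ∑ y ∈ s, c y x = 1) ∧ ∀ x, ∑ y ∈ s, c y x • y = x := by
  have htop : affineSpan ℝ (range ((↑) : s → Space d)) = ⊤ := by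
    rw [hs.affineSpan_eq_top_iff_card_eq_finrank_add_one]
    simp [hcard]
  let b : AffineBasis s ℝ (Space d) := ⟨(↑), hs, htop⟩
  have hb : ∀ i : s, b i = (i : Space d) := fun i => rfl
  classical
  refine ⟨fun y x => if h : y ∈ s then b.coord ⟨y, h⟩ x else 0, fun y => ?_, fun x => ?_,
    fun x => ?_⟩
  · by_cases h : y ∈ s
    · simp only [h, dite_true]
      exact continuous_barycentric_coord b _
    · simp only [h, dite_false]
      exact continuous_const
  · rw [← b.sum_coord_apply_eq_one x, ← Finset.sum_coe_sort s]
    exact Finset.sum_congr rfl fun i _ => by simp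
  · conv_rhs => rw [← b.linear_combination_coord_eq_self x]
    rw [← Finset.sum_coe_sort s]
    exact Finset.sum_congr rfl fun i _ => by simp [hb]

lemma mem_convexHull_iff_coord {s : Finset (Space d)}
    (hs : AffineIndependent ℝ ((↑) : s → Space d)) {c : Space d → Space d → ℝ}
    (hc1 : ∀ x, ∑ y ∈ s, c y x = 1) (hc2 : ∀ x, ∑ y ∈ s, c y x • y = x) {x : Space d} :
    x ∈ convexHull ℝ (s : Set (Space d)) ↔ ∀ y ∈ s, 0 ≤ c y x := by
  constructor
  · intro hx y hy
    obtain ⟨w, h0, h1, h2⟩ := Finset.mem_convexHull'.1 hx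
    rw [weights_unique hs (w := fun y => c y x) (w' := w) (by rw [hc1, h1]) (by rw [hc2, h2]) y hy]
    exact h0 y hy
  · exact fun h => Finset.mem_convexHull'.2 ⟨fun y => c y x, h, hc1 x, hc2 x⟩

lemma isClosed_convexHull_finset (s : Finset (Space d)) :
    IsClosed (convexHull ℝ (s : Set (Space d))) :=
  (s.finite_toSet.isCompact_convexHull ℝ).isClosed

/-- The full-dimensional simplices of a complex. -/
def fullFaces (K : Geometry.SimplicialComplex ℝ (Space d)) : Set (Finset (Space d)) :=
  {s | s ∈ K.faces ∧ s.card = d + 1}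

/-- On each of the finitely many closed full simplices the interpolant agrees with a continuous
function built from barycentric coordinates. -/
lemma measurable_interp (hfin : K.faces.Finite)
    (hpure : ∀ s ∈ K.faces, ∃ t ∈ K.faces, s ⊆ t ∧ t.card = d + 1) (v : Space d → ℝ) :
    Measurable (interp K v) := by
  have hfull : (fullFaces K).Finite := hfin.subset fun s hs => hs.1
  have hcoord : ∀ s : Finset (Space d), ∃ g : Space d → ℝ, s ∈ fullFaces K → Continuous g ∧
      ∀ x ∈ convexHull ℝ (s : Set (Space d)), interp K v x = g x := fun s => by
    by_cases hs : s ∈ fullFaces K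
    · obtain ⟨c, hc, hc1, hc2⟩ := exists_coord (K.indep hs.1) hs.2
      refine ⟨fun x => ∑ y ∈ s, c y x * v y, fun _ => ⟨by fun_prop, fun x hx => ?_⟩⟩
      have := interp_sum hs.1 ((mem_convexHull_iff_coord (K.indep hs.1) hc1 hc2).1 hx) (hc1 x) v
      rwa [hc2] at this
    · exact ⟨fun _ => 0, fun h => absurd h hs⟩
  choose g hg using hcoord
  have hspace : K.space = ⋃ s ∈ fullFaces K, convexHull ℝ (s : Set (Space d)) := by
    refine Subset.antisymm (fun x hx => ?_) (fun x hx => ?_)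
    · obtain ⟨s, hs, hxs⟩ := Geometry.SimplicialComplex.mem_space_iff.1 hx
      obtain ⟨t, ht, hst, hcard⟩ := hpure s hs
      exact mem_biUnion (show t ∈ fullFaces K from ⟨ht, hcard⟩)
        (convexHull_mono (Finset.coe_subset.2 hst) hxs)
    · obtain ⟨s, hs, hxs⟩ := mem_iUnion₂.1 hx
      exact Geometry.SimplicialComplex.mem_space_iff.2 ⟨s, hs.1, hxs⟩
  intro U hU
  have : interp K v ⁻¹' U = (⋃ s ∈ fullFaces K, (convexHull ℝ (s : Set (Space d)) ∩ g s ⁻¹' U)) ∪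
      (K.spaceᶜ ∩ {_x | (0 : ℝ) ∈ U}) := by
    ext x
    simp only [mem_preimage, mem_union, mem_iUnion, mem_inter_iff, mem_compl_iff, mem_ofPred_eq,
      exists_prop]
    constructor
    · intro hx
      by_cases hxs : x ∈ K.space
      · rw [hspace] at hxs
        obtain ⟨s, hs, hxs⟩ := mem_iUnion₂.1 hxs
        exact Or.inl ⟨s, hs, hxs, by rwa [← (hg s hs).2 x hxs]⟩
      · exact Or.inr ⟨hxs, by rwa [interp_of_notMem hxs] at hx⟩
    · rintro (⟨s, hs, hxs, hx⟩ | ⟨hxs, hx⟩)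
      · rwa [(hg s hs).2 x hxs]
      · rwa [interp_of_notMem hxs]
  rw [this]
  have hm : ∀ s : Finset (Space d), MeasurableSet (convexHull ℝ (s : Set (Space d))) := fun s =>
    (isClosed_convexHull_finset s).measurableSet
  refine (hfull.measurableSet_biUnion fun s hs =>
    (hm s).inter ((hg s hs).1.measurable hU)).union (MeasurableSet.inter ?_ (.const _))
  rw [hspace]
  exact (hfull.measurableSet_biUnion fun s _ => hm s).compl

end Complex

/-! ### Nodes, mesh size, and the region covered by the triangulation -/

/-- The properties of the domain that the triangulation arguments use. -/
structure IsConvexDomain (Ω : Set (Space d)) : Prop where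
  isOpen : IsOpen Ω
  convex : Convex ℝ Ω
  isBounded : Bornology.IsBounded Ω
  nonempty : Ω.Nonempty

section

variable {Ω : Set (Space d)} {h : ℝ} {N : NodalSet Ω h}
  {K : Geometry.SimplicialComplex ℝ (Space d)}

lemma mem_inner_iff (hΩ : IsConvexDomain Ω) (hd : 1 ≤ d) {z : Space d} : z ∈ N.inner ↔
    z ∈ Ω ∧ (∃ k : Fin d → ℤ, z = N.base + h • intVec k) ∧ Metric.ball z (h / 2) ⊆ Ω := by
  rw [N.mem_inner]
  constructor
  · rintro ⟨h1, h2, h3⟩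
    exact ⟨h1, h2, (ball_subset_iff_le_infDist hΩ.isOpen
      (frontier_nonempty hd hΩ.nonempty hΩ.isBounded) h1).2 h3⟩
  · rintro ⟨h1, h2, h3⟩
    exact ⟨h1, h2, (ball_subset_iff_le_infDist hΩ.isOpen
      (frontier_nonempty hd hΩ.nonempty hΩ.isBounded) h1).1 h3⟩

lemma mem_of_mem_inner {z : Space d} (hz : z ∈ N.inner) : z ∈ Ω := ((N.mem_inner z).1 hz).1

lemma mem_closure_of_mem_nodes {z : Space d} (hz : z ∈ N.nodes) : z ∈ closure Ω := by
  rcases hz with hz | hz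
  · exact subset_closure (mem_of_mem_inner hz)
  · exact frontier_subset_closure (N.bdry_subset z hz)

lemma mem_inner_of_mem_nodes (ho : IsOpen Ω) {z : Space d} (hz : z ∈ N.nodes) (hzΩ : z ∈ Ω) :
    z ∈ N.inner := by
  rcases hz with hz | hz
  · exact hz
  · exact absurd hzΩ (notMem_of_mem_frontier ho (N.bdry_subset z hz))

lemma mem_inner_of_lattice (hΩ : IsConvexDomain Ω) (hd : 1 ≤ d) (hh : 0 < h) {z : Space d} {r : ℝ}
    (hlat : ∃ k : Fin d → ℤ, z = N.base + h • intVec k) (hball : Metric.ball z r ⊆ Ω)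
    (hr : h / 2 ≤ r) : z ∈ N.inner := by
  rw [mem_inner_iff hΩ hd]
  exact ⟨hball (Metric.mem_ball_self (by linarith)), hlat, (Metric.ball_subset_ball hr).trans hball⟩

lemma exists_lattice_near (hh : 0 < h) (b x : Space d) :
    ∃ z : Space d, (∃ k : Fin d → ℤ, z = b + h • intVec k) ∧ ‖x - z‖ ≤ d * h := by
  refine ⟨b + h • intVec (floorVec (h⁻¹ • (x - b))), ⟨_, rfl⟩, ?_⟩
  have h1 := norm_le_of_mem_unitCube (sub_floorVec_mem (h⁻¹ • (x - b)))
  have h2 : x - (b + h • intVec (floorVec (h⁻¹ • (x - b)))) =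
      h • (h⁻¹ • (x - b) - intVec (floorVec (h⁻¹ • (x - b)))) := by
    rw [smul_sub h (h⁻¹ • (x - b)), smul_smul, mul_inv_cancel₀ hh.ne', one_smul]; abel
  rw [h2, norm_smul, Real.norm_of_nonneg hh.le, mul_comm]
  gcongr

lemma exists_inner_near (hΩ : IsConvexDomain Ω) (hd : 1 ≤ d) (hh : 0 < h) {x : Space d} {r : ℝ}
    (hball : Metric.ball x r ⊆ Ω) (hr : (d + 1) * h ≤ r) :
    ∃ z ∈ N.inner, ‖x - z‖ ≤ d * h := by
  obtain ⟨z, hlat, hxz⟩ := exists_lattice_near hh N.base x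
  refine ⟨z, mem_inner_of_lattice hΩ hd hh (r := h) hlat ?_ (by linarith), hxz⟩
  refine (ball_subset_ball_of_le ?_).trans hball
  rw [dist_comm, dist_eq_norm]
  linarith

lemma finite_faces (hK : IsTriangulation N K) : K.faces.Finite := by
  classical
  refine ((N.inner ∪ N.bdry).powerset.finite_toSet).subset fun s hs => ?_
  rw [Finset.mem_coe, Finset.mem_powerset]
  intro y hy
  have := mem_vertices_of_mem hs hy
  rw [hK.vertices_eq] at this
  simpa [NodalSet.nodes] using this

lemma convexHull_subset_closure (hΩ : IsConvexDomain Ω) (hK : IsTriangulation N K)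
    {s : Finset (Space d)} (hs : s ∈ K.faces) : convexHull ℝ (s : Set (Space d)) ⊆ closure Ω := by
  refine convexHull_min (fun y hy => ?_) hΩ.convex.closure
  have := mem_vertices_of_mem hs hy
  rw [hK.vertices_eq] at this
  exact mem_closure_of_mem_nodes this

lemma interior_closure_eq (hΩ : IsConvexDomain Ω) : interior (closure Ω) = Ω := by
  have h1 := hΩ.convex.interior_closure_eq_interior_of_nonempty_interior
    (by rw [hΩ.isOpen.interior_eq]; exact hΩ.nonempty)
  rwa [hΩ.isOpen.interior_eq] at h1

lemma exists_mem_ne {s : Finset (Space d)} (hd : 1 ≤ d) (hcard : s.card = d + 1) (z : Space d) :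
    ∃ y ∈ s, y ≠ z := Finset.exists_mem_ne (by omega) z

/-- Moving past the vertex `z` away from another vertex `y` makes the weight of `y` negative. -/
lemma notMem_interior_convexHull (hd : 1 ≤ d) {s : Finset (Space d)}
    (hs : AffineIndependent ℝ ((↑) : s → Space d)) (hcard : s.card = d + 1) {z : Space d}
    (hz : z ∈ s) : z ∉ interior (convexHull ℝ (s : Set (Space d))) := by
  intro hint
  obtain ⟨y, hy, hyz⟩ := exists_mem_ne hd hcard z
  obtain ⟨r, hr, hball⟩ := Metric.isOpen_iff.1 isOpen_interior z hint
  have hyz' : 0 < ‖z - y‖ := norm_pos_iff.2 (sub_ne_zero.2 hyz.symm)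
  set t : ℝ := r / (2 * ‖z - y‖) with ht
  have ht0 : 0 < t := by positivity
  have hp : z + t • (z - y) ∈ convexHull ℝ (s : Set (Space d)) := interior_subset (hball (by
    rw [Metric.mem_ball, dist_eq_norm, add_sub_cancel_left, norm_smul, Real.norm_of_nonneg ht0.le,
      ht, div_mul_eq_mul_div, div_lt_iff₀ (by positivity)]
    nlinarith))
  obtain ⟨w, h0, h1, h2⟩ := Finset.mem_convexHull'.1 hp
  classical
  have := weights_unique hs (w := w)
    (w' := fun x => (if x = z then 1 + t else 0) - (if x = y then t else 0))
    (by rw [h1, Finset.sum_sub_distrib]; simp [hz, hy])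
    (by
      rw [h2]; simp only [sub_smul, ite_smul, zero_smul]
      rw [Finset.sum_sub_distrib]; simp [hz, hy]; module) y hy
  have h3 := h0 y hy
  rw [this] at h3
  simp [hyz] at h3
  linarith

/-- The constant bounding the ratio between the diameter of a simplex and `h`. -/
def meshConst (d : ℕ) (σ : ℝ) : ℝ := |σ| * (2 * (d + 2)) + 1

lemma meshConst_pos (σ : ℝ) : 1 ≤ meshConst d σ := by
  rw [meshConst]; exact le_add_of_nonneg_left (by positivity)

/-- A ball in a simplex with radius above `(d + 2) h` would contain a lattice point together with
its `h`-ball. That point would be an interior node, hence a vertex of the simplex, in the interior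
of the same simplex. So inscribed balls have diameter `O(h)`, and shape regularity bounds the
diameter. -/
lemma dist_le_of_mem_face {σ : ℝ} (hΩ : IsConvexDomain Ω) (hd : 1 ≤ d) (hh : 0 < h)
    (hK : IsTriangulation N K) (hσ : IsShapeRegular σ K) {s : Finset (Space d)} (hs : s ∈ K.faces)
    {x y : Space d} (hx : x ∈ convexHull ℝ (s : Set (Space d)))
    (hy : y ∈ convexHull ℝ (s : Set (Space d))) : ‖x - y‖ ≤ meshConst d σ * h := by
  obtain ⟨t, ht, hst, hcard⟩ := hK.pure s hs
  have hsub := convexHull_mono (𝕜 := ℝ) (Finset.coe_subset.2 hst)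
  have hb : Bornology.IsBounded (convexHull ℝ (t : Set (Space d))) :=
    (t.finite_toSet.isCompact_convexHull ℝ).isBounded
  have h1 := Metric.dist_le_diam_of_mem hb (hsub hx) (hsub hy)
  have h2 : inballDiam (convexHull ℝ (t : Set (Space d))) ≤ 2 * (d + 2) * h := by
    refine Real.sSup_le (fun r hr => ?_) (by positivity)
    obtain ⟨hr0, c, hc⟩ := hr
    by_contra! hlt
    obtain ⟨z, hlat, hcz⟩ := exists_lattice_near hh N.base c
    have hzball : Metric.ball z h ⊆ convexHull ℝ (t : Set (Space d)) := by
      refine Subset.trans ?_ hc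
      refine Metric.ball_subset_closedBall.trans (Metric.closedBall_subset_closedBall' ?_)
      rw [dist_comm, dist_eq_norm]
      linarith
    have hzint : z ∈ interior (convexHull ℝ (t : Set (Space d))) :=
      interior_maximal hzball Metric.isOpen_ball (Metric.mem_ball_self hh)
    have hzΩ : Metric.ball z h ⊆ Ω := by
      rw [← interior_closure_eq hΩ]
      exact interior_maximal (hzball.trans (convexHull_subset_closure hΩ hK ht)) Metric.isOpen_ball
    have hzin : z ∈ N.inner := mem_inner_of_lattice hΩ hd hh hlat hzΩ (by linarith)
    have hzv : z ∈ K.vertices := by rw [hK.vertices_eq]; exact Or.inl hzin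
    have hzt := (Geometry.SimplicialComplex.vertex_mem_convexHull_iff hzv ht).1
      (interior_subset hzint)
    exact notMem_interior_convexHull hd (K.indep ht) hcard hzt hzint
  have h3 : 0 ≤ inballDiam (convexHull ℝ (t : Set (Space d))) :=
    Real.sSup_nonneg fun r hr => hr.1
  calc ‖x - y‖ = dist x y := (dist_eq_norm x y).symm
    _ ≤ σ * inballDiam (convexHull ℝ (t : Set (Space d))) := h1.trans (hσ t ht hcard)
    _ ≤ |σ| * inballDiam (convexHull ℝ (t : Set (Space d))) := by
      gcongr; exact le_abs_self σ
    _ ≤ |σ| * (2 * (d + 2) * h) := by gcongr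
    _ = |σ| * (2 * (d + 2)) * h := by ring
    _ ≤ meshConst d σ * h := by rw [meshConst]; gcongr; linarith

/-- Near a vertex `z` of positive weight the triangulated region is a neighbourhood. The homothety
towards `z` brings points near `p` there, into a simplex that has `z` as a vertex. Undoing the
homothety rescales the other barycentric coordinates by a positive factor and keeps that of `z`
positive, so the point itself stays in this simplex. -/
lemma eventually_mem_space (hK : IsTriangulation N K) {s : Finset (Space d)} (hs : s ∈ K.faces)
    {p : Space d} (hp : p ∈ convexHull ℝ (s : Set (Space d))) (hin : ∀ y ∈ s, y ∈ N.inner) :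
    ∀ᶠ x in nhds p, x ∈ K.space := by
  obtain ⟨w, h0, h1, h2⟩ := Finset.mem_convexHull'.1 hp
  obtain ⟨z, hz, hwz⟩ : ∃ z ∈ s, w z ≠ 0 := Finset.exists_ne_zero_of_sum_ne_zero
    (by rw [h1]; exact one_ne_zero)
  have hwz0 : 0 < w z := lt_of_le_of_ne (h0 z hz) hwz.symm
  classical
  have hcont : Continuous fun τ : ℝ => z + τ • (p - z) := by fun_prop
  obtain ⟨τ, hτ0, hτ1, hτ⟩ : ∃ τ : ℝ, 0 < τ ∧ τ ≤ 1 ∧ z + τ • (p - z) ∈ interior K.space := by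
    have hn : ∀ᶠ τ in nhdsWithin (0 : ℝ) (Ioi 0), z + τ • (p - z) ∈ interior K.space := by
      refine (hcont.tendsto 0).mono_left nhdsWithin_le_nhds |>.eventually
        (isOpen_interior.mem_nhds ?_)
      simpa using hK.inner_interior z (hin z hz)
    obtain ⟨τ, h3, h4⟩ := (hn.and (Ioc_mem_nhdsGT one_pos)).exists
    exact ⟨τ, h4.1, h4.2, h3⟩
  have hy : Continuous fun x : Space d => z + τ • (x - z) := by fun_prop
  have hfull : (fullFaces K).Finite := (finite_faces hK).subset fun s hs => hs.1
  have hev1 : ∀ᶠ x in nhds p, z + τ • (x - z) ∈ K.space :=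
    (hy.tendsto p).eventually (mem_interior_iff_mem_nhds.1 hτ)
  have hev2 : ∀ᶠ x in nhds p, ∀ t ∈ fullFaces K,
      z + τ • (x - z) ∈ convexHull ℝ (t : Set (Space d)) → x ∈ convexHull ℝ (t : Set (Space d)) := by
    refine (Filter.eventually_all_finite hfull).2 fun t ht => ?_
    by_cases hyt : z + τ • (p - z) ∈ convexHull ℝ (t : Set (Space d))
    swap
    · have : ∀ᶠ x in nhds p, z + τ • (x - z) ∈ (convexHull ℝ (t : Set (Space d)))ᶜ :=
        (hy.tendsto p).eventually ((isClosed_convexHull_finset t).isOpen_compl.mem_nhds hyt)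
      exact this.mono fun x hx hx' => absurd hx' hx
    set w' : Space d → ℝ := fun y => τ * w y + if y = z then 1 - τ else 0 with hw'
    have h0' : ∀ y ∈ s, 0 ≤ w' y := fun y hy => by
      have := mul_nonneg hτ0.le (h0 y hy)
      rw [hw']; dsimp only; split_ifs <;> linarith
    have h1' : ∑ y ∈ s, w' y = 1 := by
      simp only [hw', Finset.sum_add_distrib, ← Finset.mul_sum, h1, Finset.sum_ite_eq', hz, if_true]
      ring
    have h2' : ∑ y ∈ s, w' y • y = z + τ • (p - z) := by
      simp only [hw', add_smul, mul_smul, Finset.sum_add_distrib, ← Finset.smul_sum, h2, ite_smul,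
        zero_smul, Finset.sum_ite_eq', hz, if_true]
      module
    have hsupp : ∀ y ∈ s, w' y ≠ 0 → y ∈ t := fun y hys hne =>
      mem_of_weight_ne_zero hs ht.1 h0' h1' (by rwa [h2']) hys hne
    have hzt : z ∈ t := hsupp z hz (by
      have := mul_pos hτ0 hwz0
      have h3 := sub_nonneg.2 hτ1
      simp only [hw', if_true]
      linarith)
    obtain ⟨c, hc, hc1, hc2⟩ := exists_coord (K.indep ht.1) ht.2
    have hcz : ∀ x, ∀ y ∈ t, c y (z + τ • (x - z)) = τ * c y x + if y = z then 1 - τ else 0 :=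
      fun x => weights_unique (K.indep ht.1) (by
        rw [hc1, Finset.sum_add_distrib, ← Finset.mul_sum, hc1]; simp [hzt]) (by
        rw [hc2]
        simp only [add_smul, mul_smul, Finset.sum_add_distrib, ← Finset.smul_sum, hc2, ite_smul,
          zero_smul, Finset.sum_ite_eq', hzt, if_true]
        module)
    have hcp : 0 < c z p := by
      have hpt : ∑ y ∈ t, (if y ∈ s then w y else 0) • y = p := by
        rw [← h2]
        simp only [ite_smul, zero_smul]
        rw [Finset.sum_ite_mem, Finset.inter_comm]
        refine Finset.sum_subset Finset.inter_subset_left fun y hys hyn => ?_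
        have : w y = 0 := by
          by_contra hne
          refine hyn (Finset.mem_inter.2 ⟨hys, hsupp y hys ?_⟩)
          have h3 : 0 < τ * w y := mul_pos hτ0 (lt_of_le_of_ne (h0 y hys) (Ne.symm hne))
          have h4 := sub_nonneg.2 hτ1
          simp only [hw']; split_ifs <;> linarith
        rw [this, zero_smul]
      have hpt1 : ∑ y ∈ t, (if y ∈ s then w y else 0) = 1 := by
        rw [← h1, Finset.sum_ite_mem, Finset.inter_comm]
        refine Finset.sum_subset Finset.inter_subset_left fun y hys hyn => ?_
        by_contra hne
        refine hyn (Finset.mem_inter.2 ⟨hys, hsupp y hys ?_⟩)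
        have h3 : 0 < τ * w y := mul_pos hτ0 (lt_of_le_of_ne (h0 y hys) (Ne.symm hne))
        have h4 := sub_nonneg.2 hτ1
        simp only [hw']; split_ifs <;> linarith
      have := weights_unique (K.indep ht.1) (w := fun y => c y p)
        (w' := fun y => if y ∈ s then w y else 0) (by rw [hc1, hpt1]) (by rw [hc2, hpt]) z hzt
      rw [this, if_pos hz]
      exact hwz0
    have hev : ∀ᶠ x in nhds p, 0 < c z x := (hc z).continuousAt.eventually (lt_mem_nhds hcp)
    refine hev.mono fun x hx hxt => ?_
    rw [mem_convexHull_iff_coord (K.indep ht.1) hc1 hc2] at hxt ⊢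
    intro y hyt'
    by_cases hyz : y = z
    · rw [hyz]; exact hx.le
    · have h3 := hxt y hyt'
      rw [hcz x y hyt', if_neg hyz, add_zero] at h3
      exact nonneg_of_mul_nonneg_right h3 hτ0
  filter_upwards [hev1, hev2] with x hx1 hx2
  obtain ⟨t, ht, hxt⟩ := Geometry.SimplicialComplex.mem_space_iff.1 hx1
  obtain ⟨t', ht', htt', hcard⟩ := hK.pure t ht
  exact Geometry.SimplicialComplex.mem_space_iff.2 ⟨t', ht',
    hx2 t' ⟨ht', hcard⟩ (convexHull_mono (Finset.coe_subset.2 htt') hxt)⟩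

/-- Continuation along the segment from a nearby interior node: the parameters whose points are
covered form a closed set, and deep points lie in faces with interior nodes only, so the covering
extends beyond each of them. -/
lemma mem_space_of_ball_subset {σ : ℝ} (hΩ : IsConvexDomain Ω) (hd : 1 ≤ d) (hh : 0 < h)
    (hK : IsTriangulation N K) (hσ : IsShapeRegular σ K) {x : Space d} {r : ℝ}
    (hball : Metric.ball x r ⊆ Ω) (hr : (meshConst d σ + 2 * d + 1) * h ≤ r) : x ∈ K.space := by
  have hm := meshConst_pos (d := d) σ
  obtain ⟨z, hz, hxz⟩ := exists_inner_near (N := N) hΩ hd hh hball (by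
    refine le_trans ?_ hr; gcongr; linarith [Nat.cast_nonneg (α := ℝ) d])
  have hclosed : IsClosed K.space :=
    (finite_faces hK).isClosed_biUnion fun s _ => isClosed_convexHull_finset s
  have hline : Continuous fun t : ℝ => z + t • (x - z) := by fun_prop
  have hdeep : ∀ t ∈ Icc (0 : ℝ) 1, Metric.ball (z + t • (x - z)) ((meshConst d σ + 1) * h) ⊆ Ω := by
    intro t ht
    refine (ball_subset_ball_of_le ?_).trans hball
    rw [dist_eq_norm, show z + t • (x - z) - x = -((1 - t) • (x - z)) by module, norm_neg,
      norm_smul, Real.norm_of_nonneg (by linarith [ht.2])]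
    have : (1 - t) * ‖x - z‖ ≤ 1 * (d * h) := by gcongr; linarith [ht.1]
    nlinarith [mul_nonneg (Nat.cast_nonneg (α := ℝ) d) hh.le]
  have key : (1 : ℝ) ∈ {t : ℝ | z + t • (x - z) ∈ K.space} := by
    refine IsClosed.mem_of_ge_of_forall_exists_gt (a := 0) (b := 1)
      ((hclosed.preimage hline).inter isClosed_Icc) ?_ zero_le_one ?_
    · simpa using interior_subset (hK.inner_interior z hz)
    · rintro t ⟨ht, ht01⟩
      obtain ⟨s, hs, hps⟩ := Geometry.SimplicialComplex.mem_space_iff.1 ht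
      have hin : ∀ y ∈ s, y ∈ N.inner := fun y hy => by
        have hyv := mem_vertices_of_mem hs hy
        rw [hK.vertices_eq] at hyv
        refine mem_inner_of_mem_nodes hΩ.isOpen hyv (hdeep t ⟨ht01.1, ht01.2.le⟩ ?_)
        rw [Metric.mem_ball, dist_eq_norm]
        have := dist_le_of_mem_face hΩ hd hh hK hσ hs (subset_convexHull ℝ _ hy) hps
        linarith
      have hev := (hline.tendsto t).eventually (eventually_mem_space hK hs hps hin)
      have hev' : ∀ᶠ t' in nhdsWithin t (Ioi t), z + t' • (x - z) ∈ K.space :=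
        hev.filter_mono nhdsWithin_le_nhds
      obtain ⟨t', h1, h2⟩ := (hev'.and (Ioc_mem_nhdsGT ht01.2)).exists
      exact ⟨t', h1, h2⟩
  simpa using key

end

/-! ### Hat functions -/

section Hat

variable {K : Geometry.SimplicialComplex ℝ (Space d)}

open Classical in
lemma hat_sum {s : Finset (Space d)} (hs : s ∈ K.faces) {w : Space d → ℝ}
    (h0 : ∀ y ∈ s, 0 ≤ w y) (h1 : ∑ y ∈ s, w y = 1) (z : Space d) :
    hat K z (∑ y ∈ s, w y • y) = if z ∈ s then w z else 0 := by
  rw [hat, interp_sum hs h0 h1]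
  simp

lemma hat_of_notMem {x : Space d} (hx : x ∉ K.space) (z : Space d) : hat K z x = 0 :=
  interp_of_notMem hx _

lemma hat_nonneg (z x : Space d) : 0 ≤ hat K z x := by
  by_cases hx : x ∈ K.space
  · obtain ⟨s, hs, w, h0, h1, rfl⟩ := exists_weights hx
    rw [hat_sum hs h0 h1]
    split_ifs with hz
    · exact h0 z hz
    · exact le_rfl
  · rw [hat_of_notMem hx]

lemma hat_le_one (z x : Space d) : hat K z x ≤ 1 := by
  refine (le_abs_self _).trans (abs_interp_le zero_le_one (fun y _ => ?_) x)
  split_ifs <;> simp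

lemma sum_hat_le_one (I : Finset (Space d)) (x : Space d) : ∑ z ∈ I, hat K z x ≤ 1 := by
  classical
  by_cases hx : x ∈ K.space
  · obtain ⟨s, hs, w, h0, h1, rfl⟩ := exists_weights hx
    simp only [hat_sum hs h0 h1]
    rw [Finset.sum_ite_mem, ← h1]
    exact Finset.sum_le_sum_of_subset_of_nonneg Finset.inter_subset_right fun y hy _ => h0 y hy
  · simp [hat_of_notMem hx]

lemma sum_hat_smul {s : Finset (Space d)} (hs : s ∈ K.faces) {x : Space d}
    (hx : x ∈ convexHull ℝ (s : Set (Space d))) {I : Finset (Space d)} (hI : ∀ y ∈ s, y ∈ I) :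
    ∑ z ∈ I, hat K z x = 1 ∧ ∑ z ∈ I, hat K z x • z = x := by
  classical
  obtain ⟨w, h0, h1, rfl⟩ := Finset.mem_convexHull'.1 hx
  simp only [hat_sum hs h0 h1, ite_smul, zero_smul]
  rw [Finset.sum_ite_mem, Finset.sum_ite_mem, Finset.inter_eq_right.2 hI]
  exact ⟨h1, rfl⟩

lemma exists_face_of_hat_ne_zero {z x : Space d} (hne : hat K z x ≠ 0) :
    ∃ s ∈ K.faces, z ∈ s ∧ x ∈ convexHull ℝ (s : Set (Space d)) := by
  classical
  by_cases hx : x ∈ K.space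
  · obtain ⟨s, hs, w, h0, h1, rfl⟩ := exists_weights hx
    refine ⟨s, hs, ?_, Finset.mem_convexHull'.2 ⟨w, h0, h1, rfl⟩⟩
    by_contra hz
    exact hne (by rw [hat_sum hs h0 h1, if_neg hz])
  · exact absurd (hat_of_notMem hx z) hne

open Classical in
lemma hat_translate_of_ne_zero {z a x : Space d}
    (htr : ∀ s ∈ K.faces, z ∈ s → s.image (fun x => x + a) ∈ K.faces) (hne : hat K z x ≠ 0) :
    hat K (z + a) (x + a) = hat K z x := by
  by_cases hx : x ∈ K.space
  · obtain ⟨s, hs, w, h0, h1, rfl⟩ := exists_weights hx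
    have hz : z ∈ s := by
      by_contra hz
      exact hne (by rw [hat_sum hs h0 h1, if_neg hz])
    have hinj : Set.InjOn (fun x : Space d => x + a) s := fun x _ y _ h => add_right_cancel h
    have h0' : ∀ y ∈ s.image (fun x => x + a), 0 ≤ w (y - a) := fun y hy => by
      obtain ⟨y', hy', rfl⟩ := Finset.mem_image.1 hy
      simpa using h0 y' hy'
    have h1' : ∑ y ∈ s.image (fun x => x + a), w (y - a) = 1 := by
      rw [Finset.sum_image hinj, ← h1]
      simp
    have h2' : ∑ y ∈ s.image (fun x => x + a), w (y - a) • y = (∑ y ∈ s, w y • y) + a := by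
      rw [Finset.sum_image hinj]
      simp only [add_sub_cancel_right, smul_add, Finset.sum_add_distrib, ← Finset.sum_smul, h1,
        one_smul]
    rw [← h2', hat_sum (htr s hs hz) h0' h1', hat_sum hs h0 h1, if_pos hz, if_pos
      (Finset.mem_image_of_mem _ hz), add_sub_cancel_right]
  · exact absurd (hat_of_notMem hx z) hne

end Hat

section

variable {Ω : Set (Space d)} {h σ R₀ : ℝ} {N : NodalSet Ω h}
  {K : Geometry.SimplicialComplex ℝ (Space d)}

/-- The data of an admissible triangulation. -/
structure IsAdmissible (σ R₀ : ℝ) (N : NodalSet Ω h) (K : Geometry.SimplicialComplex ℝ (Space d)) :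
    Prop where
  dim : 1 ≤ d
  domain : IsConvexDomain Ω
  pos : 0 < h
  triangulation : IsTriangulation N K
  shape : IsShapeRegular σ K
  invariant : IsTranslationInvariant N R₀ K

lemma IsAdmissible.norm_sub_le_of_hat_ne_zero (T : IsAdmissible σ R₀ N K) {z x : Space d}
    (hne : hat K z x ≠ 0) : ‖x - z‖ ≤ meshConst d σ * h := by
  obtain ⟨s, hs, hz, hx⟩ := exists_face_of_hat_ne_zero hne
  exact dist_le_of_mem_face T.domain T.dim T.pos T.triangulation T.shape hs hx
    (subset_convexHull ℝ _ hz)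

lemma measurable_hat (hK : IsTriangulation N K) (z : Space d) : Measurable (hat K z) :=
  measurable_interp (finite_faces hK) hK.pure _

/-- The depth, in units of `h`, from which on the triangulation is periodic. -/
def depthConst (d : ℕ) (σ R₀ : ℝ) : ℝ := |R₀| + meshConst d σ + 3 * d + 2

lemma depthConst_ge (σ R₀ : ℝ) : meshConst d σ ≤ depthConst d σ R₀ ∧ 3 * (d : ℝ) + 3 ≤
    depthConst d σ R₀ := by
  have := meshConst_pos (d := d) σ
  have := abs_nonneg R₀
  have := Nat.cast_nonneg (α := ℝ) d
  constructor <;> rw [depthConst] <;> linarith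

/-- Translation of simplices gives the identity where the hat function is nonzero; using it in both
directions settles the zeros as well. -/
lemma IsAdmissible.hat_translate (T : IsAdmissible σ R₀ N K) {z z' : Space d} (hz : z ∈ N.inner)
    (hz' : z' ∈ N.inner) (hball : Metric.ball z (R₀ * h) ⊆ Ω) (hball' : Metric.ball z' (R₀ * h) ⊆ Ω)
    (x : Space d) : hat K z' (x + (z' - z)) = hat K z x := by
  have hfr := frontier_nonempty T.dim T.domain.nonempty T.domain.isBounded
  have h1 := (ball_subset_iff_le_infDist T.domain.isOpen hfr (mem_of_mem_inner hz)).1 hball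
  have h2 := (ball_subset_iff_le_infDist T.domain.isOpen hfr (mem_of_mem_inner hz')).1 hball'
  by_cases hne : hat K z x = 0
  · by_contra hne'
    rw [hne] at hne'
    have h3 := hat_translate_of_ne_zero (T.invariant z' hz' z hz h2 h1) hne'
    rw [show z' + (z - z') = z by abel, show x + (z' - z) + (z - z') = x by abel, hne] at h3
    exact hne' h3.symm
  · have h3 := hat_translate_of_ne_zero (T.invariant z hz z' hz' h1 h2) hne
    rwa [add_sub_cancel] at h3

lemma lintegral_scale {F : Space d → ℝ≥0∞} (hF : Measurable F) (z : Space d) {h : ℝ} (hh : 0 < h) :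
    ∫⁻ x, F x = ENNReal.ofReal (h ^ d) * ∫⁻ y, F (z + h • y) := by
  have h1 : ∫⁻ y, F (z + h • y) = ∫⁻ x, F (z + x) ∂(Measure.map (h • ·) volume) :=
    (lintegral_map (f := fun x => F (z + x)) (hF.comp (measurable_const_add z))
      (measurable_const_smul h)).symm
  rw [h1, Measure.map_addHaar_smul volume hh.ne', finrank_euclideanSpace_fin, lintegral_smul_measure,
    lintegral_add_left_eq_self, smul_eq_mul, ← mul_assoc, ← ENNReal.ofReal_mul (by positivity),
    abs_of_pos (by positivity), mul_inv_cancel₀ (by positivity), ENNReal.ofReal_one, one_mul]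

/-- The integral of an affine function against the hat function of a node away from the
boundary. -/
lemma IsAdmissible.lintegral_affine_mul_hat (T : IsAdmissible σ R₀ N K) {z : Space d}
    (hz : z ∈ N.inner) (hball : Metric.ball z (depthConst d σ R₀ * h) ⊆ Ω) {a : ℝ}
    {ℓ : Space d →L[ℝ] ℝ} (hpos : ∀ x, ‖x - z‖ ≤ meshConst d σ * h → 0 ≤ a + ℓ (x - z)) :
    ∫⁻ x, ENNReal.ofReal ((a + ℓ (x - z)) * hat K z x) = ENNReal.ofReal (a * h ^ d) := by
  have hh := T.pos
  have hm := meshConst_pos (d := d) σ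
  have hd0 := Nat.cast_nonneg (α := ℝ) d
  have hR := abs_nonneg R₀
  have ha : 0 ≤ a := by simpa using hpos z (by simp; positivity)
  have hmeas : Measurable fun x => ENNReal.ofReal ((a + ℓ (x - z)) * hat K z x) := by
    have := measurable_hat T.triangulation z
    fun_prop
  rw [lintegral_scale hmeas z hh, mul_comm a, ENNReal.ofReal_mul (by positivity)]
  congr 1
  have hmeas' : Measurable fun y : Space d =>
      ENNReal.ofReal ((a + ℓ (z + h • y - z)) * hat K z (z + h • y)) :=
    hmeas.comp (by fun_prop)
  rw [lintegral_eq_lintegral_unitCube_tsum hmeas', ← mul_one (ENNReal.ofReal a),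
    ← volume_unitCube (d := d), ← setLIntegral_const]
  refine setLIntegral_congr_fun measurableSet_unitCube fun y hy => ?_
  set x : Space d := z + h • y with hx
  have hxz : ‖x - z‖ ≤ d * h := by
    rw [hx, add_sub_cancel_left, norm_smul, Real.norm_of_nonneg hh.le, mul_comm]
    gcongr
    exact norm_le_of_mem_unitCube hy
  -- After folding, the value of the hat of `z` at `z + h (y + k)` becomes, by periodicity, the
  -- value at `x` of the hat of the node `z - h k`. The sum over translates of one hat turns into a
  -- sum over all hats at one point.
  set φ : (Fin d → ℤ) → Space d := fun k => z - h • intVec k with hφ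
  have hφinj : Function.Injective φ := fun k l hkl => by
    have h1 : h • intVec k = h • intVec l := sub_right_injective hkl
    exact intVec_injective (smul_right_injective _ hh.ne' h1)
  obtain ⟨-, ⟨k₀, hk₀⟩, -⟩ := (mem_inner_iff T.domain T.dim).1 hz
  have hlat : ∀ k, ∃ k' : Fin d → ℤ, φ k = N.base + h • intVec k' := fun k =>
    ⟨k₀ - k, by rw [intVec_sub, smul_sub, hφ, hk₀]; dsimp only; abel⟩
  set g : Space d → ℝ := fun z' => (a + ℓ (x - z')) * hat K z' x with hg
  have hterm : ∀ k, (φ k ∈ N.inner → (a + ℓ (z + h • (y + intVec k) - z)) *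
      hat K z (z + h • (y + intVec k)) = g (φ k)) ∧
      (φ k ∉ N.inner → hat K z (z + h • (y + intVec k)) = 0) := fun k => by
    have e1 : z + h • (y + intVec k) = x + (z - φ k) := by
      rw [hx, hφ]; dsimp only; rw [smul_add]; abel
    have e2 : x + (z - φ k) - z = x - φ k := by abel
    have hnear : ‖x - φ k‖ ≤ meshConst d σ * h → Metric.ball (φ k) ((|R₀| + 1) * h) ⊆ Ω :=
      fun hle => (ball_subset_ball_of_le (by
        rw [dist_eq_norm]
        have := norm_sub_le (x - z) (x - φ k)
        rw [sub_sub_sub_cancel_left] at this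
        rw [depthConst]
        nlinarith)).trans hball
    have hR0 : R₀ * h ≤ (|R₀| + 1) * h := by
      gcongr; linarith [le_abs_self R₀]
    rw [e1, e2]
    constructor
    · intro hin
      rw [hg]
      dsimp only
      congr 1
      by_cases hle : ‖x - φ k‖ ≤ meshConst d σ * h
      · refine T.hat_translate hin hz ((Metric.ball_subset_ball hR0).trans (hnear hle))
          ((Metric.ball_subset_ball ?_).trans hball) x
        rw [depthConst]
        exact hR0.trans (mul_le_mul_of_nonneg_right (by linarith) hh.le)
      · have h1 : hat K (φ k) x = 0 := by
          by_contra hne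
          exact hle (T.norm_sub_le_of_hat_ne_zero hne)
        rw [h1]
        by_contra hne
        have h2 := T.norm_sub_le_of_hat_ne_zero hne
        rw [e2] at h2
        exact hle h2
    · intro hnot
      by_contra hne
      have h2 := T.norm_sub_le_of_hat_ne_zero hne
      rw [e2] at h2
      exact hnot (mem_inner_of_lattice T.domain T.dim hh (hlat k) (hnear h2) (by nlinarith))
  classical
  set S : Finset (Fin d → ℤ) := N.inner.preimage φ hφinj.injOn with hS
  rw [tsum_eq_sum (s := S) fun k hk => by
    rw [hS, Finset.mem_preimage] at hk
    rw [(hterm k).2 hk, mul_zero, ENNReal.ofReal_zero]]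
  have h1 : ∑ k ∈ S, ENNReal.ofReal ((a + ℓ (z + h • (y + intVec k) - z)) *
      hat K z (z + h • (y + intVec k))) = ∑ k ∈ S, ENNReal.ofReal (g (φ k)) :=
    Finset.sum_congr rfl fun k hk => by
      rw [hS, Finset.mem_preimage] at hk
      rw [(hterm k).1 hk]
  rw [h1, hS, Finset.sum_preimage φ N.inner hφinj.injOn (fun z' => ENNReal.ofReal (g z'))]
  swap
  · intro z' hz' hnr
    obtain ⟨-, ⟨k', hk'⟩, -⟩ := (mem_inner_iff T.domain T.dim).1 hz'
    exact absurd ⟨k₀ - k', by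
      rw [hφ]; dsimp only; rw [intVec_sub, smul_sub, hk₀, hk']; abel⟩ hnr
  have hxball : Metric.ball x ((meshConst d σ + 2 * d + 1) * h) ⊆ Ω :=
    (ball_subset_ball_of_le (by
      rw [dist_eq_norm, depthConst]
      nlinarith)).trans hball
  have hxs := mem_space_of_ball_subset T.domain T.dim hh T.triangulation T.shape hxball le_rfl
  obtain ⟨s, hs, hxs⟩ := Geometry.SimplicialComplex.mem_space_iff.1 hxs
  have hsI : ∀ y ∈ s, y ∈ N.inner := fun y hy => by
    have hyv := mem_vertices_of_mem hs hy
    rw [T.triangulation.vertices_eq] at hyv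
    refine mem_inner_of_mem_nodes T.domain.isOpen hyv (hxball ?_)
    rw [Metric.mem_ball, dist_eq_norm]
    have := dist_le_of_mem_face T.domain T.dim hh T.triangulation T.shape hs
      (subset_convexHull ℝ _ hy) hxs
    nlinarith
  obtain ⟨hs1, hs2⟩ := sum_hat_smul hs hxs hsI
  rw [← ENNReal.ofReal_sum_of_nonneg]
  · congr 1
    -- The hats form a partition of unity that reproduces the identity map, so the linear parts
    -- cancel and the sum is `a`.
    have e : ∀ z' ∈ N.inner, g z' = (a + ℓ x) * hat K z' x - ℓ (hat K z' x • z') := fun z' _ => by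
      rw [hg]; dsimp only; rw [map_sub, map_smul, smul_eq_mul]; ring
    rw [Finset.sum_congr rfl e, Finset.sum_sub_distrib, ← Finset.mul_sum, hs1, ← map_sum, hs2]
    ring
  · intro z' hz'
    by_cases hne : hat K z' x = 0
    · rw [hg]; dsimp only; rw [hne, mul_zero]
    · refine mul_nonneg ?_ (hat_nonneg _ _)
      have h2 := T.norm_sub_le_of_hat_ne_zero hne
      have h3 := hpos (x - z' + z) (by rwa [add_sub_cancel_right])
      rwa [add_sub_cancel_right] at h3

end

/-! ### The weights -/

section

variable {lam M : ℝ} {Ω : Set (Space d)} {f u : Space d → ℝ}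
  {G : Space d → Space d} {H : Space d → Space d →L[ℝ] Space d} {h σ R₀ : ℝ} {N : NodalSet Ω h}
  {K : Geometry.SimplicialComplex ℝ (Space d)}

lemma RegularSolution.isConvexDomain (S : RegularSolution lam M Ω f u G H) : IsConvexDomain Ω :=
  ⟨S.isOpen, S.convex, S.isBounded, S.nonempty⟩

lemma RegularSolution.f_pos (S : RegularSolution lam M Ω f u G H) (hlam : 0 < lam) {x : Space d}
    (hx : x ∈ Ω) : 0 < f x := (pow_pos hlam d).trans_le (S.f_lower x hx)

lemma RegularSolution.aemeasurable_f (S : RegularSolution lam M Ω f u G H) :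
    AEMeasurable f (volume.restrict Ω) :=
  (S.f_continuousOn.mono subset_closure).aemeasurable S.isOpen.measurableSet

lemma ofReal_weight (S : RegularSolution lam M Ω f u G H) (hlam : 0 < lam)
    (hK : IsTriangulation N K) (z : Space d) :
    ENNReal.ofReal (weight Ω f K z) = ∫⁻ x in Ω, ENNReal.ofReal (f x * hat K z x) := by
  have hm := S.isOpen.measurableSet
  refine ofReal_integral_eq_lintegral_ofReal ?_ ?_
  · have : IsFiniteMeasure (volume.restrict Ω) :=
      ⟨by rw [Measure.restrict_apply_univ]; exact S.isBounded.measure_lt_top⟩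
    refine Integrable.of_bound (S.aemeasurable_f.mul
      (measurable_hat hK z).aemeasurable).aestronglyMeasurable M
      ((ae_restrict_iff' hm).2 (Filter.Eventually.of_forall fun x hx => ?_))
    have h1 := (S.f_pos hlam hx).le
    rw [Real.norm_of_nonneg (mul_nonneg h1 (hat_nonneg z x))]
    exact (mul_le_of_le_one_right h1 (hat_le_one z x)).trans (S.f_upper x hx)
  · exact (ae_restrict_iff' hm).2 (Filter.Eventually.of_forall fun x hx =>
      mul_nonneg (S.f_pos hlam hx).le (hat_nonneg z x))

lemma weight_nonneg (S : RegularSolution lam M Ω f u G H) (hlam : 0 < lam) (z : Space d) :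
    0 ≤ weight Ω f K z :=
  setIntegral_nonneg S.isOpen.measurableSet fun x hx =>
    mul_nonneg (S.f_pos hlam hx).le (hat_nonneg z x)

lemma IsAdmissible.weight_le (T : IsAdmissible σ R₀ N K) (S : RegularSolution lam M Ω f u G H)
    (hlam : 0 < lam) (hM : 1 ≤ M) (z : Space d) :
    weight Ω f K z ≤ M * meshConst d σ ^ d * ballVol d 1 * h ^ d := by
  have hh := T.pos
  have hm := meshConst_pos (d := d) σ
  have hV := ballVol_nonneg (d := d) 1
  rw [← ENNReal.ofReal_le_ofReal_iff (by positivity), ofReal_weight S hlam T.triangulation]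
  calc ∫⁻ x in Ω, ENNReal.ofReal (f x * hat K z x)
      ≤ ∫⁻ x in Ω, (Metric.closedBall z (meshConst d σ * h)).indicator
          (fun _ => ENNReal.ofReal M) x := by
        refine setLIntegral_mono' S.isOpen.measurableSet fun x hx => ?_
        by_cases hne : hat K z x = 0
        · rw [hne, mul_zero, ENNReal.ofReal_zero]; exact zero_le
        · rw [indicator_of_mem (by
            rw [Metric.mem_closedBall, dist_eq_norm]; exact T.norm_sub_le_of_hat_ne_zero hne)]
          refine ENNReal.ofReal_le_ofReal ?_
          calc f x * hat K z x ≤ M * 1 :=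
                mul_le_mul (S.f_upper x hx) (hat_le_one z x) (hat_nonneg z x) (by linarith)
            _ = M := mul_one M
    _ ≤ ∫⁻ x, (Metric.closedBall z (meshConst d σ * h)).indicator
          (fun _ => ENNReal.ofReal M) x := setLIntegral_le_lintegral _ _
    _ = ENNReal.ofReal (M * meshConst d σ ^ d * ballVol d 1 * h ^ d) := by
        rw [lintegral_indicator measurableSet_closedBall, setLIntegral_const,
          volume_closedBall_center_eq _ (by positivity), ← ENNReal.ofReal_mul (by linarith)]
        congr 1
        ring

lemma IsAdmissible.sum_weight_le (T : IsAdmissible σ R₀ N K) (S : RegularSolution lam M Ω f u G H)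
    (hlam : 0 < lam) :
    ∑ z ∈ N.inner, ENNReal.ofReal (weight Ω f K z) ≤ ∫⁻ x in Ω, ENNReal.ofReal (f x) := by
  have hm : ∀ z, AEMeasurable (fun x => ENNReal.ofReal (f x * hat K z x)) (volume.restrict Ω) :=
    fun z => (S.aemeasurable_f.mul (measurable_hat T.triangulation z).aemeasurable).ennreal_ofReal
  simp only [ofReal_weight S hlam T.triangulation]
  rw [← lintegral_finsetSum' _ fun z _ => hm z]
  refine setLIntegral_mono' S.isOpen.measurableSet fun x hx => ?_
  have hf := (S.f_pos hlam hx).le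
  rw [← ENNReal.ofReal_sum_of_nonneg fun z _ => mul_nonneg hf (hat_nonneg z x), ← Finset.mul_sum]
  exact ENNReal.ofReal_le_ofReal (mul_le_of_le_one_right hf (sum_hat_le_one _ x))

lemma lintegral_f_le (S : RegularSolution lam M Ω f u G H) {A : Set (Space d)}
    (hA : MeasurableSet A) (hAΩ : A ⊆ Ω) :
    ∫⁻ x in A, ENNReal.ofReal (f x) ≤ ENNReal.ofReal M * volume A := by
  rw [← setLIntegral_const]
  exact setLIntegral_mono' hA fun x hx => ENNReal.ofReal_le_ofReal (S.f_upper x (hAΩ hx))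

/-- The affine Taylor polynomial of `f` at `z` integrates against the hat function exactly to `f z *
h ^ d`, so only the quadratic remainder contributes. -/
lemma IsAdmissible.abs_weight_sub_le (T : IsAdmissible σ R₀ N K)
    (S : RegularSolution lam M Ω f u G H) (hlam : 0 < lam) (hM : 1 ≤ M) {z : Space d}
    (hz : z ∈ N.inner) (hball : Metric.ball z (depthConst d σ R₀ * h) ⊆ Ω) :
    |weight Ω f K z - f z * h ^ d| ≤ M * meshConst d σ ^ 2 * h ^ 2 * h ^ d := by
  have hh := T.pos
  have hm := meshConst_pos (d := d) σ
  have hzΩ := mem_of_mem_inner hz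
  have hfz := (S.f_pos hlam hzΩ).le
  set B : ℝ := M * meshConst d σ ^ 2 * h ^ 2 with hB
  have hB0 : 0 ≤ B := by positivity
  obtain ⟨ℓ, hℓ⟩ := S.f_taylor z hzΩ
  have hin : ∀ x, ‖x - z‖ ≤ meshConst d σ * h → x ∈ Ω := fun x hx => hball (by
    rw [Metric.mem_ball, dist_eq_norm]
    have := (depthConst_ge (d := d) σ R₀).2
    have h2 : meshConst d σ < depthConst d σ R₀ := by
      rw [depthConst]; linarith [abs_nonneg R₀, Nat.cast_nonneg (α := ℝ) d]
    exact hx.trans_lt (by gcongr))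
  have htay : ∀ x, ‖x - z‖ ≤ meshConst d σ * h → |f x - f z - ℓ (x - z)| ≤ B := fun x hx => by
    refine (hℓ x (hin x hx)).trans ?_
    calc M * ‖x - z‖ ^ 2 ≤ M * (meshConst d σ * h) ^ 2 := by gcongr
      _ = B := by rw [hB]; ring
  -- `f z + B + ℓ` majorizes `f` on the support by at most `2 B`. Both comparison functions are
  -- nonnegative there, as the extended nonnegative integral needs.
  have hA := T.lintegral_affine_mul_hat hz hball (a := f z + B) (ℓ := ℓ) fun x hx => by
    have := abs_le.1 (htay x hx)
    linarith [S.f_pos hlam (hin x hx)]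
  have hC := T.lintegral_affine_mul_hat hz hball (a := 2 * B) (ℓ := 0) fun x hx => by
    rw [zero_apply]; linarith
  have hw := weight_nonneg (K := K) S hlam z
  have hweight := ofReal_weight S hlam T.triangulation z
  have upper : weight Ω f K z ≤ (f z + B) * h ^ d := by
    rw [← ENNReal.ofReal_le_ofReal_iff (by positivity), hweight, ← hA]
    refine le_trans (setLIntegral_mono' S.isOpen.measurableSet fun x hx => ?_)
      (setLIntegral_le_lintegral _ _)
    refine ENNReal.ofReal_le_ofReal ?_
    by_cases hne : hat K z x = 0
    · rw [hne, mul_zero, mul_zero]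
    · have := abs_le.1 (htay x (T.norm_sub_le_of_hat_ne_zero hne))
      exact mul_le_mul_of_nonneg_right (by linarith) (hat_nonneg z x)
  have lower : (f z + B) * h ^ d ≤ weight Ω f K z + 2 * B * h ^ d := by
    rw [← ENNReal.ofReal_le_ofReal_iff (by positivity), ENNReal.ofReal_add hw (by positivity),
      hweight, ← hA, ← hC, ← lintegral_indicator S.isOpen.measurableSet]
    have hmeas : Measurable fun x => ENNReal.ofReal ((2 * B + (0 : Space d →L[ℝ] ℝ) (x - z)) *
        hat K z x) := by
      have := measurable_hat T.triangulation z
      fun_prop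
    rw [← lintegral_add_right _ hmeas]
    refine lintegral_mono fun x => ?_
    by_cases hne : hat K z x = 0
    · simp [hne]
    · have hx := T.norm_sub_le_of_hat_ne_zero hne
      have := abs_le.1 (htay x hx)
      have h0 := hat_nonneg (K := K) z x
      have hfx := (S.f_pos hlam (hin x hx)).le
      rw [indicator_of_mem (hin x hx), zero_apply,
        ← ENNReal.ofReal_add (by positivity) (by positivity), ← add_mul]
      exact ENNReal.ofReal_le_ofReal (mul_le_mul_of_nonneg_right (by linarith) h0)
  rw [abs_le]
  constructor <;> nlinarith

end

/-! ### Consistency of the method -/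

lemma bijective_of_coercive {A : Space d →L[ℝ] Space d} {lam : ℝ} (hlam : 0 < lam)
    (hcoer : ∀ x, lam * ‖x‖ ^ 2 ≤ inner ℝ (A x) x) : Function.Bijective A := by
  have hinj : Function.Injective A := by
    refine (injective_iff_map_eq_zero A).2 fun x hx => ?_
    have h := hcoer x
    rw [hx, inner_zero_left] at h
    have h2 : ‖x‖ ^ 2 ≤ 0 := by nlinarith [sq_nonneg ‖x‖]
    simpa using h2.antisymm (sq_nonneg _)
  exact ⟨hinj, (LinearMap.injective_iff_surjective (f := A.toLinearMap)).1 hinj⟩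

lemma volume_image_affine (b : Space d) {h : ℝ} (hh : 0 < h) (A : Space d →L[ℝ] Space d)
    (s : Set (Space d)) : volume ((fun x => b + h • A x) '' s) =
      ENNReal.ofReal (h ^ d * |A.det|) * volume s := by
  have : (fun x => b + h • A x) '' s = b +ᵥ (h • (A '' s)) := by
    ext y; simp [mem_vadd_set, mem_smul_set]
  rw [this, measure_vadd, Measure.addHaar_smul, Measure.addHaar_image_continuousLinearMap,
    finrank_euclideanSpace_fin, abs_of_pos (by positivity), ENNReal.ofReal_mul (by positivity),
    mul_assoc]

lemma inner_map_smul_smul (A : Space d →L[ℝ] Space d) (a : ℝ) (v : Space d) :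
    inner ℝ (A (a • v)) (a • v) = a ^ 2 * inner ℝ (A v) v := by
  rw [map_smul, real_inner_smul_left, real_inner_smul_right]
  ring

lemma relative_bounds {F w v B C x : ℝ} (hF : 0 < F) (hB : 0 ≤ B) (hC : 0 ≤ C) (hx0 : 0 ≤ x)
    (hx1 : x ≤ 1) (hw : |w - F| ≤ B * x * F) (hBx : B * x ≤ 1 / 2) (hv0 : 0 ≤ v)
    (hv : v ≤ 1 + C * x) (hv' : 1 ≤ v + C * x) :
    0 < w ∧ F * v ≤ w * (1 + (2 * B + C + 2 * B * C) * x) ∧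
      w * (1 - (2 * B + C + 2 * B * C) * x) ≤ F * v := by
  obtain ⟨hw1, hw2⟩ := abs_le.1 hw
  have hB1 : 0 ≤ B * x := by positivity
  have hC1 : 0 ≤ C * x := by positivity
  have hBF : B * x * F ≤ 1 / 2 * F := by gcongr
  have hw0 : 0 < w := by linarith
  refine ⟨hw0, ?_, ?_⟩
  · have h1 : F * (1 - B * x) * (1 + 2 * (B * x)) ≤ w * (1 + 2 * (B * x)) := by
      gcongr; linarith
    have h3 : 0 ≤ F * (B * x) * (1 - 2 * (B * x)) := mul_nonneg (by positivity) (by linarith)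
    have hFw : F ≤ w * (1 + 2 * (B * x)) := by linarith
    calc F * v ≤ (w * (1 + 2 * (B * x))) * (1 + C * x) := by gcongr
      _ = w * (1 + (2 * B + C + 2 * B * C * x) * x) := by ring
      _ ≤ w * (1 + (2 * B + C + 2 * B * C) * x) := by
        have h5 : 2 * B * C * x ≤ 2 * B * C := mul_le_of_le_one_right (by positivity) hx1
        have h6 := mul_le_mul_of_nonneg_right h5 hx0
        exact mul_le_mul_of_nonneg_left (by linarith) hw0.le
  · rcases le_or_gt 0 (1 - (2 * B + C + 2 * B * C) * x) with hs | hs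
    · have h2 : w ≤ F * (1 + B * x) := by linarith
      have h4 : F * (1 - C * x) ≤ F * v := by gcongr; linarith
      refine le_trans ?_ h4
      calc w * (1 - (2 * B + C + 2 * B * C) * x)
          ≤ F * (1 + B * x) * (1 - (2 * B + C + 2 * B * C) * x) := by gcongr
        _ = F * ((1 - C * x) - (B * x + 2 * (B * C * x) +
            B * x * ((2 * B + C + 2 * B * C) * x))) := by ring
        _ ≤ F * (1 - C * x) := by
          exact mul_le_mul_of_nonneg_left (sub_le_self _ (by positivity)) hF.le
    · exact (mul_nonpos_of_nonneg_of_nonpos hw0.le hs.le).trans (by positivity)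

section

variable {lam M : ℝ} {Ω : Set (Space d)} {f u : Space d → ℝ}
  {G : Space d → Space d} {H : Space d → Space d →L[ℝ] Space d} {h σ R₀ : ℝ} {N : NodalSet Ω h}
  {K : Geometry.SimplicialComplex ℝ (Space d)}

/-- The rescaled Taylor remainders at the lattice neighbours of `z`. -/
def taylorRem (u : Space d → ℝ) (G : Space d → Space d) (h : ℝ) (z : Space d) (k : Fin d → ℤ) : ℝ :=
  (u (z + h • intVec k) - u z - inner ℝ (G z) (h • intVec k)) / h ^ 2

lemma mem_domain_of_ball {z v : Space d} {r n : ℝ} (hh : 0 < h) (hball : Metric.ball z (r * h) ⊆ Ω)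
    (hv : ‖v‖ ≤ n) (hn : n < r) : z + h • v ∈ Ω := hball (by
  rw [Metric.mem_ball, dist_eq_norm, add_sub_cancel_left, norm_smul, Real.norm_of_nonneg hh.le,
    mul_comm]
  exact mul_lt_mul_of_pos_right (hv.trans_lt hn) hh)

lemma abs_taylorRem_sub_le (S : RegularSolution lam M Ω f u G H) (hh : 0 < h) (hM : 1 ≤ M) {n : ℝ}
    (hn1 : 1 ≤ n) {z : Space d} (hz : z ∈ Ω) {k : Fin d → ℤ} (hk : ‖intVec k‖ ≤ n)
    (hzk : z + h • intVec k ∈ Ω) : |taylorRem u G h z k - qf (H z) k / 2| ≤ M * n ^ 4 * h := by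
  have h1 := S.cubic z hz _ hzk
  have e : taylorRem u G h z k - qf (H z) k / 2 = (u (z + h • intVec k) - u z -
      inner ℝ (G z) (h • intVec k) - inner ℝ (H z (h • intVec k)) (h • intVec k) / 2) / h ^ 2 := by
    rw [taylorRem, qf, inner_map_smul_smul]
    field_simp
  rw [e, abs_div, abs_of_pos (show 0 < h ^ 2 by positivity), div_le_iff₀ (by positivity)]
  refine h1.trans ?_
  rw [norm_smul, Real.norm_of_nonneg hh.le, mul_pow]
  calc M * (h ^ 3 * ‖intVec k‖ ^ 3) ≤ M * (h ^ 3 * n ^ 3) := by gcongr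
    _ ≤ M * (h ^ 3 * n ^ 4) := by gcongr; norm_num
    _ = _ := by ring

lemma abs_taylorRem_add_le (S : RegularSolution lam M Ω f u G H) (hh : 0 < h) (hM : 1 ≤ M) {n : ℝ}
    (hn1 : 1 ≤ n) {z : Space d} (hz : z ∈ Ω) {k : Fin d → ℤ} (hk : ‖intVec k‖ ≤ n)
    (hzk : z + h • intVec k ∈ Ω) (hzk' : z - h • intVec k ∈ Ω) :
    |taylorRem u G h z k + taylorRem u G h z (-k) - qf (H z) k| ≤ (M * n ^ 4 * h) ^ 2 := by
  have h1 := S.even z hz _ hzk hzk'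
  have e : taylorRem u G h z k + taylorRem u G h z (-k) - qf (H z) k =
      (u (z + h • intVec k) + u (z - h • intVec k) - 2 * u z -
      inner ℝ (H z (h • intVec k)) (h • intVec k)) / h ^ 2 := by
    rw [taylorRem, taylorRem, qf, inner_map_smul_smul, intVec_neg, smul_neg, inner_neg_right,
      ← sub_eq_add_neg]
    field_simp
    ring
  rw [e, abs_div, abs_of_pos (show 0 < h ^ 2 by positivity), div_le_iff₀ (by positivity)]
  refine h1.trans ?_
  rw [norm_smul, Real.norm_of_nonneg hh.le, mul_pow]
  have hMn : 1 ≤ M * n ^ 4 := one_le_mul_of_one_le_of_one_le hM (one_le_pow₀ hn1)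
  calc M * (h ^ 4 * ‖intVec k‖ ^ 4) ≤ M * (h ^ 4 * n ^ 4) := by gcongr
    _ = (M * n ^ 4) * 1 * h ^ 4 := by ring
    _ ≤ (M * n ^ 4) * (M * n ^ 4) * h ^ 4 := by gcongr
    _ = _ := by ring

/-- The nodes within distance `n h` are lattice neighbours and impose exactly the constraints of the
cell with `β = taylorRem`. More distant nodes impose nothing new: the uniform convexity of `u`
exceeds the slope change `O(h)` there. -/
lemma subdiff_eq_image (T : IsAdmissible σ R₀ N K) (S : RegularSolution lam M Ω f u G H)
    (hlam : 0 < lam) (hM : 1 ≤ M) {ρ n r : ℝ} {z : Space d} (hz : z ∈ N.inner)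
    (hball : Metric.ball z (r * h) ⊆ Ω) (hr : n + 1 ≤ r) (hn : 2 * M * ρ / lam ≤ n)
    (hcell : ∀ x ∈ cell (H z) n (taylorRem u G h z), ‖x‖ ≤ ρ) :
    subdiff N u z = (fun x => G z + h • H z x) '' cell (H z) n (taylorRem u G h z) := by
  have hh := T.pos
  have hzΩ := mem_of_mem_inner hz
  obtain ⟨-, ⟨k₀, hk₀⟩, -⟩ := (mem_inner_iff T.domain T.dim).1 hz
  have hrem : ∀ k, u (z + h • intVec k) = u z + inner ℝ (G z) (h • intVec k) +
      h ^ 2 * taylorRem u G h z k := fun k => by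
    rw [taylorRem, mul_div_cancel₀ _ (by positivity)]; ring
  have hinner : ∀ x : Space d, ∀ k : Fin d → ℤ, inner ℝ (h • H z x) (h • intVec k) =
      h ^ 2 * inner ℝ x (H z (intVec k)) := fun x k => by
    rw [inner_smul_left, inner_smul_right, S.symm z hzΩ, RCLike.conj_to_real]; ring
  refine Subset.antisymm (fun q hq => ?_) ?_
  · obtain ⟨x, hx⟩ := (bijective_of_coercive hlam (S.coercive z hzΩ)).2 (h⁻¹ • (q - G z))
    have hqx : q = G z + h • H z x := by
      rw [hx, smul_smul, mul_inv_cancel₀ hh.ne', one_smul]; abel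
    refine ⟨x, fun k _ hk => ?_, hqx.symm⟩
    have hkin : z + h • intVec k ∈ N.inner := by
      refine mem_inner_of_lattice T.domain T.dim hh (r := h)
        ⟨k₀ + k, by rw [intVec_add, smul_add, hk₀]; abel⟩
        ((ball_subset_ball_of_le ?_).trans hball) (by linarith)
      rw [dist_eq_norm, add_sub_cancel_left, norm_smul, Real.norm_of_nonneg hh.le]
      nlinarith
    have h1 := hq _ (Or.inl hkin)
    rw [add_sub_cancel_left, hrem, hqx, inner_add_left, hinner] at h1
    have h2 : h ^ 2 * inner ℝ x (H z (intVec k)) ≤ h ^ 2 * taylorRem u G h z k := by linarith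
    exact le_of_mul_le_mul_left h2 (by positivity)
  · rintro _ ⟨x, hx, rfl⟩ y hy
    by_cases hfar : n * h ≤ ‖y - z‖
    · have h1 := S.lower z hzΩ y (mem_closure_of_mem_nodes hy)
      have h2 : inner ℝ (h • H z x) (y - z) ≤ h * (M * ρ) * ‖y - z‖ := by
        refine (real_inner_le_norm _ _).trans ?_
        gcongr
        rw [norm_smul, Real.norm_of_nonneg hh.le]
        gcongr
        refine ((H z).le_of_opNorm_le (S.norm_le z hzΩ) x).trans ?_
        gcongr
        exact hcell x hx
      have h3 : h * (M * ρ) * ‖y - z‖ ≤ lam / 2 * ‖y - z‖ ^ 2 := by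
        rw [div_le_iff₀ hlam] at hn
        have : h * (M * ρ) ≤ lam / 2 * ‖y - z‖ := by nlinarith
        calc h * (M * ρ) * ‖y - z‖ ≤ lam / 2 * ‖y - z‖ * ‖y - z‖ := by gcongr
          _ = _ := by ring
      rw [inner_add_left]
      linarith
    · push Not at hfar
      have hyΩ : y ∈ Ω := hball (by
        rw [Metric.mem_ball, dist_eq_norm]
        nlinarith)
      have hyin := mem_inner_of_mem_nodes T.domain.isOpen hy hyΩ
      obtain ⟨-, ⟨k₁, hk₁⟩, -⟩ := (mem_inner_iff T.domain T.dim).1 hyin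
      have hyk : y = z + h • intVec (k₁ - k₀) := by
        rw [intVec_sub, smul_sub, hk₁, hk₀]; abel
      rw [hyk, add_sub_cancel_left, hrem, inner_add_left, hinner]
      by_cases hk : k₁ - k₀ = 0
      · rw [hk, intVec_zero, map_zero, inner_zero_right, taylorRem, intVec_zero, smul_zero]
        simp
      · have hkn : ‖intVec (k₁ - k₀)‖ ≤ n := by
          rw [hyk, add_sub_cancel_left, norm_smul, Real.norm_of_nonneg hh.le] at hfar
          nlinarith
        have h1 := hx _ hk hkn
        have h2 : h ^ 2 * inner ℝ x (H z (intVec (k₁ - k₀))) ≤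
          h ^ 2 * taylorRem u G h z (k₁ - k₀) := by gcongr
        linarith

end

/-- The subdifferential of the restriction of the exact solution to the nodes has the prescribed
volume up to a relative error of order `h²`, at all nodes away from the boundary. -/
theorem exists_consistency {lam M σ R₀ : ℝ} (hlam : 0 < lam) (hM : 1 ≤ M) :
    ∃ D C t₀ : ℝ, 1 ≤ D ∧ 0 < C ∧ 0 < t₀ ∧ t₀ ≤ 1 ∧
      ∀ (Ω : Set (Space d)) (f u : Space d → ℝ) (G : Space d → Space d)
      (H : Space d → Space d →L[ℝ] Space d) (h : ℝ) (N : NodalSet Ω h)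
      (K : Geometry.SimplicialComplex ℝ (Space d)), RegularSolution lam M Ω f u G H →
      IsAdmissible σ R₀ N K → h ≤ t₀ → ∀ z ∈ N.inner, Metric.ball z (D * h) ⊆ Ω →
      0 < weight Ω f K z ∧
      volume (subdiff N u z) ≤ ENNReal.ofReal (weight Ω f K z * (1 + C * h ^ 2)) ∧
      ENNReal.ofReal (weight Ω f K z * (1 - C * h ^ 2)) ≤ volume (subdiff N u z) := by
  obtain ⟨ρ, hρ, hcell⟩ := cell_volume (K := 1) d hlam (zero_le_one.trans hM) one_pos
  -- The range must exceed `2 ρ` for the cell estimate and `2 M ρ / lam` for the irrelevance of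
  -- distant nodes.
  set n : ℝ := 2 * ρ + 1 + 2 * M * ρ / lam with hn
  have hq : 0 ≤ 2 * M * ρ / lam := by positivity
  have hn1 : 1 ≤ n := by linarith
  obtain ⟨C₁, t₁, hC₁, ht₁, -, hcell⟩ := hcell n (by linarith) hn1
  have hm := meshConst_pos (d := d) σ
  have hD := depthConst_ge (d := d) σ R₀
  have hd0 := Nat.cast_nonneg (α := ℝ) d
  set B : ℝ := M * meshConst d σ ^ 2 / lam ^ d with hB
  have hB0 : 0 < B := by positivity
  set C₂ : ℝ := C₁ * (M * n ^ 4) ^ 2 with hC₂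
  have hC₂0 : 0 ≤ C₂ := by positivity
  clear_value n B C₂
  refine ⟨depthConst d σ R₀ + n + 1, 2 * B + C₂ + 2 * B * C₂,
    min (min 1 (t₁ / (M * n ^ 4))) (1 / (2 * B)), by linarith, by positivity, by positivity,
    (min_le_left _ _).trans (min_le_left _ _), ?_⟩
  intro Ω f u G H h N K S T hht z hz hball
  have hh := T.pos
  have hh1 : h ≤ 1 := hht.trans ((min_le_left _ _).trans (min_le_left _ _))
  have hh2 : M * n ^ 4 * h ≤ t₁ := by
    have := hht.trans ((min_le_left _ _).trans (min_le_right _ _))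
    rw [le_div_iff₀ (by positivity)] at this
    linarith
  have hh3 : B * h ^ 2 ≤ 1 / 2 := by
    have := hht.trans (min_le_right _ _)
    rw [le_div_iff₀ (by positivity)] at this
    nlinarith
  have hzΩ := mem_of_mem_inner hz
  have hmem : ∀ k : Fin d → ℤ, ‖intVec k‖ ≤ n → z + h • intVec k ∈ Ω := fun k hk =>
    mem_domain_of_ball hh hball hk (by linarith)
  -- The perturbation parameter of the cell is `t = M n⁴ h`: the cubic Taylor bound gives size `t`
  -- and the even one gives the defect `t²` of opposite facets.
  obtain ⟨hc1, hc2, hc3⟩ := hcell (H z) (S.symm z hzΩ) (S.coercive z hzΩ) (S.norm_le z hzΩ)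
    (M * n ^ 4 * h) (by positivity) hh2 (taylorRem u G h z)
    (fun k hk => (abs_taylorRem_sub_le S hh hM hn1 hzΩ hk (hmem k hk)).trans_eq (one_mul _).symm)
    (fun k hk => (abs_taylorRem_add_le S hh hM hn1 hzΩ hk (hmem k hk) (by
      have := hmem (-k) (by rwa [intVec_neg, norm_neg])
      rwa [intVec_neg, smul_neg, ← sub_eq_add_neg] at this)).trans_eq (one_mul _).symm)
  have hvol : volume (subdiff N u z) =
      ENNReal.ofReal (h ^ d * f z) * volume (cell (H z) n (taylorRem u G h z)) := by
    rw [subdiff_eq_image T S hlam hM hz hball (by linarith) (by linarith) hc1,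
      volume_image_affine _ hh, ← S.det_eq z hzΩ, abs_of_pos (S.f_pos hlam hzΩ)]
  have hCt : C₁ * (M * n ^ 4 * h) ^ 2 = C₂ * h ^ 2 := by rw [hC₂]; ring
  rw [hCt] at hc2 hc3
  set V := volume (cell (H z) n (taylorRem u G h z)) with hV
  have hVfin : V ≠ ∞ := (hc2.trans_lt ENNReal.ofReal_lt_top).ne
  have hVv : V = ENNReal.ofReal V.toReal := (ENNReal.ofReal_toReal hVfin).symm
  set v := V.toReal with hv
  have hv0 : 0 ≤ v := ENNReal.toReal_nonneg
  rw [hVv, ENNReal.ofReal_le_ofReal_iff (by positivity)] at hc2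
  rw [hVv, ← ENNReal.ofReal_add hv0 (by positivity),
    ENNReal.ofReal_le_ofReal_iff (by positivity)] at hc3
  have hw := T.abs_weight_sub_le S hlam hM hz ((Metric.ball_subset_ball (by
    gcongr; linarith)).trans hball)
  have hfz := S.f_pos hlam hzΩ
  set w := weight Ω f K z with hwdef
  set F : ℝ := h ^ d * f z with hF
  have hF0 : 0 < F := by positivity
  have hw' : |w - F| ≤ B * h ^ 2 * F := by
    rw [hF, mul_comm (h ^ d)]
    refine hw.trans ?_
    have h1 : M * meshConst d σ ^ 2 = B * lam ^ d := by rw [hB]; field_simp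
    rw [h1]
    have := S.f_lower z hzΩ
    calc B * lam ^ d * h ^ 2 * h ^ d ≤ B * f z * h ^ 2 * h ^ d := by gcongr
      _ = _ := by ring
  obtain ⟨h1, h2, h3⟩ := relative_bounds hF0 hB0.le hC₂0 (by positivity) (by nlinarith) hw' hh3
    hv0 hc2 hc3
  rw [hvol, hVv, ← ENNReal.ofReal_mul hF0.le]
  exact ⟨h1, ENNReal.ofReal_le_ofReal h2, ENNReal.ofReal_le_ofReal h3⟩

/-! ### Comparison principles -/

section

variable {Ω : Set (Space d)} {h σ R₀ : ℝ} {N : NodalSet Ω h}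
  {K : Geometry.SimplicialComplex ℝ (Space d)}

/-- Discrete comparison principle: a plane supporting `a` at `z`, moved vertically to the value of
`b`, supports `b`. -/
lemma subdiff_subset_of_max {a b : Space d → ℝ} {z : Space d}
    (hmax : ∀ y ∈ N.nodes, a y - b y ≤ a z - b z) : subdiff N a z ⊆ subdiff N b z :=
  fun q hq y hy => by linarith [hmax y hy, hq y hy]

lemma finite_nodes (N : NodalSet Ω h) : N.nodes.Finite :=
  N.inner.finite_toSet.union N.bdry.finite_toSet

lemma exists_bdry (hd : 1 ≤ d) (hΩ : IsConvexDomain Ω) (N : NodalSet Ω h) : ∃ z, z ∈ N.bdry := by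
  obtain ⟨x, hx⟩ := frontier_nonempty hd hΩ.nonempty hΩ.isBounded
  obtain ⟨z, hz, -⟩ := N.bdry_dense x hx
  exact ⟨z, hz⟩

lemma exists_max_nodes (hd : 1 ≤ d) (hΩ : IsConvexDomain Ω) (N : NodalSet Ω h)
    (g : Space d → ℝ) : ∃ z ∈ N.nodes, ∀ y ∈ N.nodes, g y ≤ g z := by
  obtain ⟨z, hz⟩ := exists_bdry hd hΩ N
  exact exists_max_image _ g (finite_nodes N) ⟨z, Or.inr hz⟩

/-- Lattice nodes are `h` apart, and the depth condition on interior nodes keeps boundary nodes at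
distance `h / 2`. -/
lemma half_le_norm_sub (hΩ : IsConvexDomain Ω) (hd : 1 ≤ d) (hh : 0 < h) {z y : Space d}
    (hz : z ∈ N.inner) (hy : y ∈ N.nodes) (hyz : y ≠ z) : h / 2 ≤ ‖y - z‖ := by
  obtain ⟨-, ⟨k, hk⟩, hball⟩ := (mem_inner_iff hΩ hd).1 hz
  by_contra! hlt
  have hyΩ : y ∈ Ω := hball (by rwa [Metric.mem_ball, dist_eq_norm])
  obtain ⟨-, ⟨k', hk'⟩, -⟩ := (mem_inner_iff hΩ hd).1 (mem_inner_of_mem_nodes hΩ.isOpen hy hyΩ)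
  have e : y - z = h • intVec (k' - k) := by rw [intVec_sub, smul_sub, hk', hk]; abel
  have hne : k' - k ≠ 0 := fun h0 => hyz (by rw [hk', hk, sub_eq_zero.1 h0])
  have h1 := one_le_norm_intVec hne
  rw [e, norm_smul, Real.norm_of_nonneg hh.le] at hlt
  nlinarith

lemma image_subset_subdiff {W : Space d → ℝ} {z p : Space d} {A : Set (Space d)}
    (hA : ∀ q ∈ A, ∀ y ∈ N.nodes, y ≠ z → inner ℝ q (y - z) ≤ W y - W z - inner ℝ p (y - z)) :
    (fun q => p + q) '' A ⊆ subdiff N W z := by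
  rintro _ ⟨q, hq, rfl⟩ y hy
  by_cases hyz : y = z
  · simp [hyz]
  · have := hA q hq y hy hyz
    rw [inner_add_left]
    linarith

lemma smul_subdiff_subset {u W : Space d → ℝ} {z : Space d} {s : ℝ} (hs : 0 ≤ s)
    (hW : ∀ y ∈ N.nodes, s * (u y - u z) ≤ W y - W z) :
    s • subdiff N u z ⊆ subdiff N W z := by
  rintro _ ⟨q, hq, rfl⟩ y hy
  have h1 := mul_le_mul_of_nonneg_left (sub_nonneg.2 (hq y hy)) hs
  have h2 := hW y hy
  simp only [real_inner_smul_left]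
  linarith

lemma volume_smul_set (s : ℝ) (hs : 0 ≤ s) (A : Set (Space d)) :
    volume (s • A) = ENNReal.ofReal (s ^ d) * volume A := by
  rw [Measure.addHaar_smul, finrank_euclideanSpace_fin, abs_of_nonneg (by positivity)]

end

/-- The ellipsoid with semiaxes `r + a` in the direction `n` and `r` in the orthogonal directions. -/
def ellipsoid (n : Space d) (r a : ℝ) : Set (Space d) :=
  (fun x => r • x + (a * inner ℝ n x) • n) '' Metric.closedBall 0 1

/-- The ellipsoid is `r` times the image of the unit ball under a transvection with determinant `1 +
a / r`. -/
lemma volume_ellipsoid {n : Space d} (hn : ‖n‖ = 1) {r a : ℝ} (hr : 0 < r) (ha : 0 ≤ a)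
    (p : Space d) : volume ((fun q => p + q) '' ellipsoid n r a) =
      ENNReal.ofReal (r ^ d * (1 + a / r) * ballVol d 1) := by
  let B : Space d →L[ℝ] Space d := LinearMap.toContinuousLinearMap
    (LinearMap.transvection (innerSL ℝ n).toLinearMap ((a / r) • n))
  have hB : ∀ x, B x = x + (inner ℝ n x) • ((a / r) • n) := fun x => rfl
  have hdet : B.det = 1 + a / r := by
    have h1 : B.det = LinearMap.det
      (LinearMap.transvection (innerSL ℝ n).toLinearMap ((a / r) • n)) := rfl
    rw [h1, LinearMap.transvection.det]
    simp [hn]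
  have he : (fun q => p + q) '' ellipsoid n r a =
      (fun x => p + r • B x) '' Metric.closedBall 0 1 := by
    rw [ellipsoid, image_image]
    refine image_congr fun x _ => ?_
    rw [hB, smul_add, smul_smul, smul_smul]
    congr 3
    field_simp
  rw [he, volume_image_affine p hr B, hdet, abs_of_nonneg (by positivity), volume_closedBall_eq,
    ← ENNReal.ofReal_mul (by positivity)]

lemma inner_le_of_mem_ellipsoid {n q v : Space d} (hn : ‖n‖ = 1) {r a : ℝ} (hr : 0 ≤ r) (ha : 0 ≤ a)
    (hq : q ∈ ellipsoid n r a) : inner ℝ q v ≤ r * ‖v‖ + a * |inner ℝ n v| := by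
  obtain ⟨x, hx, rfl⟩ := hq
  rw [mem_closedBall_zero_iff] at hx
  rw [inner_add_left, real_inner_smul_left, real_inner_smul_left]
  have h1 : inner ℝ x v ≤ ‖v‖ := (real_inner_le_norm x v).trans
    (mul_le_of_le_one_left (norm_nonneg v) hx)
  have h2 : |inner ℝ n x| ≤ 1 := (abs_real_inner_le_norm n x).trans (by rw [hn, one_mul]; exact hx)
  have h3 : inner ℝ n x * inner ℝ n v ≤ |inner ℝ n v| := (le_abs_self _).trans (by
    rw [abs_mul]; exact mul_le_of_le_one_left (abs_nonneg _) h2)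
  have h4 := mul_le_mul_of_nonneg_left h1 hr
  have h5 := mul_le_mul_of_nonneg_left h3 ha
  linarith

/-! ### The lower barrier -/

lemma posPart_sq_sub (t t₀ a : ℝ) :
    2 * max (t₀ + a) 0 * (t - t₀) ≤ max (t + a) 0 ^ 2 - max (t₀ + a) 0 ^ 2 := by
  have h1 : 2 * max (t₀ + a) 0 * (t + a) ≤ 2 * max (t₀ + a) 0 * max (t + a) 0 :=
    mul_le_mul_of_nonneg_left (le_max_left _ _) (by positivity)
  have h2 : max (t₀ + a) 0 * (t₀ + a) = max (t₀ + a) 0 ^ 2 := by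
    rcases le_total 0 (t₀ + a) with h | h
    · rw [max_eq_left h]; ring
    · rw [max_eq_right h]; ring
  nlinarith [sq_nonneg (max (t + a) 0 - max (t₀ + a) 0)]

/-- Above the kink the remainder is the full square; beyond it the function is zero and the
remainder is still at least `b²`. -/
lemma posPart_sq_remainder {t t₀ a b : ℝ} (hb : 0 ≤ b) (h₀ : b ≤ t₀ + a) :
    min ((t - t₀) ^ 2) (b ^ 2) ≤
      max (t + a) 0 ^ 2 - max (t₀ + a) 0 ^ 2 - 2 * max (t₀ + a) 0 * (t - t₀) := by
  rw [max_eq_left (hb.trans h₀)]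
  rcases le_total 0 (t + a) with h | h
  · rw [max_eq_left h]
    refine (min_le_left _ _).trans (le_of_eq ?_)
    ring
  · rw [max_eq_right h]
    refine (min_le_right _ _).trans ?_
    have h1 : b ^ 2 ≤ (t₀ + a) ^ 2 := pow_le_pow_left₀ hb h₀ 2
    nlinarith [mul_nonneg (hb.trans h₀) (neg_nonneg.2 h)]

/-- The barrier, as a function of the value `t` of the exact solution. -/
def barrier (κ K T h μ t : ℝ) : ℝ :=
  (1 + κ * h ^ 2) * t + K / μ ^ 2 * max (t + T * h * μ) 0 ^ 2 - K * h ^ 2 * T ^ 2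

lemma barrier_zero {κ K T h μ : ℝ} (hT : 0 ≤ T) (hh : 0 ≤ h) (hμ : 0 < μ) :
    barrier κ K T h μ 0 = 0 := by
  rw [barrier, zero_add, max_eq_left (by positivity)]
  field_simp
  ring

lemma barrier_ge {κ K T h μ t B : ℝ} (hκ : 0 ≤ κ) (hK : 0 ≤ K) (ht : -B ≤ t) :
    t - (κ * B + K * T ^ 2) * h ^ 2 ≤ barrier κ K T h μ t := by
  rw [barrier]
  have h1 : 0 ≤ K / μ ^ 2 * max (t + T * h * μ) 0 ^ 2 := by positivity
  have h2 : κ * h ^ 2 * -B ≤ κ * h ^ 2 * t := mul_le_mul_of_nonneg_left ht (by positivity)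
  nlinarith

/-- The slope of the barrier. -/
def barrierSlope (κ K T h μ t : ℝ) : ℝ :=
  1 + κ * h ^ 2 + 2 * (K / μ ^ 2) * max (t + T * h * μ) 0

lemma one_add_le_barrierSlope {κ K T h μ t : ℝ} (hK : 0 ≤ K) :
    1 + κ * h ^ 2 ≤ barrierSlope κ K T h μ t := by
  rw [barrierSlope]
  have : 0 ≤ 2 * (K / μ ^ 2) * max (t + T * h * μ) 0 := by positivity
  linarith

lemma barrier_sub_ge {κ K T h μ t t₀ : ℝ} (hK : 0 ≤ K) :
    barrierSlope κ K T h μ t₀ * (t - t₀) ≤ barrier κ K T h μ t - barrier κ K T h μ t₀ := by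
  have h1 := mul_le_mul_of_nonneg_left (posPart_sq_sub t t₀ (T * h * μ))
    (show 0 ≤ K / μ ^ 2 by positivity)
  rw [barrier, barrier, barrierSlope]
  linarith

lemma barrier_remainder {κ K T h μ t t₀ b : ℝ} (hK : 0 ≤ K) (hb : 0 ≤ b)
    (h₀ : b ≤ t₀ + T * h * μ) :
    K / μ ^ 2 * min ((t - t₀) ^ 2) (b ^ 2) ≤ barrier κ K T h μ t - barrier κ K T h μ t₀ -
      barrierSlope κ K T h μ t₀ * (t - t₀) := by
  have h1 := mul_le_mul_of_nonneg_left (posPart_sq_remainder (t := t) hb h₀)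
    (show 0 ≤ K / μ ^ 2 by positivity)
  rw [barrier, barrier, barrierSlope]
  linarith

/-- All the data of the discrete problem. -/
structure Config (lam M c C σ R₀ : ℝ) (Ω : Set (Space d)) (f u : Space d → ℝ)
    (G : Space d → Space d) (H : Space d → Space d →L[ℝ] Space d) (x₀ : Space d) (μ h : ℝ)
    (N : NodalSet Ω h) (K : Geometry.SimplicialComplex ℝ (Space d)) (uh : Space d → ℝ) :
    Prop where
  regular : RegularSolution lam M Ω f u G H
  round : IsRound c C Ω u G x₀ μ
  admissible : IsAdmissible σ R₀ N K
  mem : x₀ ∈ Ω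
  op : IsOPSolution N K f uh

section

variable {lam M c C σ R₀ : ℝ} {Ω : Set (Space d)} {f u : Space d → ℝ} {G : Space d → Space d}
  {H : Space d → Space d →L[ℝ] Space d} {x₀ : Space d} {μ h : ℝ} {N : NodalSet Ω h}
  {K : Geometry.SimplicialComplex ℝ (Space d)} {uh : Space d → ℝ}

/-- Near the boundary `u` must drop by at least `μ² / 2` on the way to `x₀`, over a distance at most
`C μ`. -/
lemma Config.norm_grad_ge (F : Config lam M c C σ R₀ Ω f u G H x₀ μ h N K uh) (hlam : 0 < lam)
    (hC : 1 ≤ C) {t : ℝ} {z : Space d} (hz : z ∈ Ω) (hu : -(t * h * μ) < u z)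
    (ht : 2 * t * h ≤ μ) : μ / (2 * C) ≤ ‖G z‖ := by
  have hμ := F.round.pos
  have h1 := F.regular.lower z hz x₀ (subset_closure F.mem)
  rw [F.round.min] at h1
  have h2 : 0 ≤ lam / 2 * ‖x₀ - z‖ ^ 2 := by positivity
  have h3 : -inner ℝ (G z) (x₀ - z) ≤ ‖G z‖ * (C * μ) := by
    refine (neg_le_abs _).trans ((abs_real_inner_le_norm _ _).trans ?_)
    gcongr
    rw [norm_sub_rev]
    exact F.round.bounded z (subset_closure hz)
  have h4 : 2 * t * h * μ ≤ μ * μ := by gcongr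
  rw [div_le_iff₀ (by positivity)]
  have h5 : μ * μ ≤ μ * (‖G z‖ * (2 * C)) := by nlinarith
  exact le_of_mul_le_mul_left h5 hμ

lemma Config.ball_subset (F : Config lam M c C σ R₀ Ω f u G H x₀ μ h N K uh) (hC : 1 ≤ C) {D : ℝ}
    {z : Space d} (hz : z ∈ Ω) (hu : u z ≤ -(C * D * h * μ)) : Metric.ball z (D * h) ⊆ Ω := by
  have T := F.admissible
  have hμ := F.round.pos
  have hfr := frontier_nonempty T.dim T.domain.nonempty T.domain.isBounded
  rw [ball_subset_iff_le_infDist T.domain.isOpen hfr hz, Metric.le_infDist hfr]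
  intro y hy
  have h1 := F.round.lip z hz y (frontier_subset_closure hy)
  rw [F.regular.boundary y hy, zero_sub, abs_neg] at h1
  rw [dist_comm, dist_eq_norm]
  have h2 := neg_abs_le (u z)
  have h3 : C * μ * (D * h) ≤ C * μ * ‖y - z‖ := by nlinarith
  exact le_of_mul_le_mul_left h3 (by positivity)

lemma Config.ellipsoid_subset (F : Config lam M c C σ R₀ Ω f u G H x₀ μ h N K uh) (hlam : 0 < lam)
    (hM : 1 ≤ M) (hC : 1 ≤ C) {t α κ k : ℝ} (ht : 0 < t) (hα : 0 < α) (hκ : 0 ≤ κ) (hk : 0 ≤ k)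
    (hk' : α * (4 * α / lam) ≤ k * min ((lam / (16 * α) / (4 * C)) ^ 2) (t ^ 2))
    (hμ1 : 2 * t * h ≤ μ)
    (hμ2 : M / 2 * (4 * α / lam) ^ 2 * h ≤ μ / (4 * C) * (lam / (16 * α)))
    {z : Space d} (hz : z ∈ N.inner) (hu : -(t * h * μ) < u z) :
    (fun q => barrierSlope κ k (2 * t) h μ (u z) • G z + q) ''
        ellipsoid ((‖G z‖)⁻¹ • G z) (lam / 8 * h) (α * h) ⊆
      subdiff N (fun y => barrier κ k (2 * t) h μ (u y)) z := by
  have T := F.admissible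
  have hh := T.pos
  have hμ := F.round.pos
  have hzΩ := mem_of_mem_inner hz
  have hG := F.norm_grad_ge hlam hC hzΩ hu hμ1
  have hG0 : 0 < ‖G z‖ := lt_of_lt_of_le (by positivity) hG
  set n : Space d := (‖G z‖)⁻¹ • G z with hn
  have hn1 : ‖n‖ = 1 := by rw [hn, norm_smul, norm_inv, norm_norm, inv_mul_cancel₀ hG0.ne']
  refine image_subset_subdiff fun q hq y hy hyz => ?_
  refine (inner_le_of_mem_ellipsoid hn1 (by positivity) (by positivity) hq).trans ?_
  set e := ‖y - z‖ with he
  have he0 : h / 2 ≤ e := half_le_norm_sub T.domain T.dim hh hz hy hyz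
  have hycl := mem_closure_of_mem_nodes hy
  set r := |inner ℝ n (y - z)| with hr
  have hre : r ≤ e := (abs_real_inner_le_norm n _).trans (by rw [hn1, one_mul])
  have hr0 : 0 ≤ r := abs_nonneg _
  have hGr : |inner ℝ (G z) (y - z)| = ‖G z‖ * r := by
    have : G z = ‖G z‖ • n := by rw [hn, smul_smul, mul_inv_cancel₀ hG0.ne', one_smul]
    conv_lhs => rw [this]
    rw [real_inner_smul_left, abs_mul, abs_norm]
  have hl := F.regular.lower z hzΩ y hycl
  have hup := F.regular.upper z hzΩ y hycl
  have hrem := barrier_remainder (κ := κ) (T := 2 * t) (h := h) (μ := μ) (t := u y) (t₀ := u z)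
    (b := t * h * μ) hk (by positivity) (by linarith)
  have hsl : 1 ≤ barrierSlope κ k (2 * t) h μ (u z) :=
    le_trans (le_add_of_nonneg_right (by positivity)) (one_add_le_barrierSlope hk)
  set s := barrierSlope κ k (2 * t) h μ (u z) with hs
  rw [real_inner_smul_left]
  set I := inner ℝ (G z) (y - z) with hI
  clear_value s n
  have hq0 : 0 ≤ lam / 2 * e ^ 2 := by positivity
  have h1 : lam / 2 * e ^ 2 ≤ s * (u y - u z - I) := by nlinarith
  have hmain : lam / 8 * h * e + α * h * r ≤ lam / 2 * e ^ 2 +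
      k / μ ^ 2 * min ((u y - u z) ^ 2) ((t * h * μ) ^ 2) := by
    have h2 : lam / 8 * h * e ≤ lam / 4 * e ^ 2 := by
      have : lam / 8 * h * e ≤ lam / 8 * (2 * e) * e := by gcongr; linarith
      linarith
    have h3 : 0 ≤ k / μ ^ 2 * min ((u y - u z) ^ 2) ((t * h * μ) ^ 2) := by positivity
    by_cases c1 : 4 * α / lam * h ≤ e
    · have h4 : α * h * r ≤ lam / 4 * e ^ 2 := by
        have h5 : α * h ≤ lam / 4 * e := by
          have := mul_le_mul_of_nonneg_left c1 (show 0 ≤ lam / 4 by positivity)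
          calc α * h = lam / 4 * (4 * α / lam * h) := by field_simp
            _ ≤ _ := this
        calc α * h * r ≤ lam / 4 * e * e := by gcongr
          _ = _ := by ring
      linarith
    by_cases c2 : r ≤ lam / (16 * α) * h
    · have h4 : α * h * r ≤ lam / 4 * e ^ 2 := by
        calc α * h * r ≤ α * h * (lam / (16 * α) * h) := by gcongr
          _ = lam / 4 * (h / 2) ^ 2 := by field_simp; norm_num
          _ ≤ _ := by gcongr
      linarith
    push Not at c1 c2
    set r₀ := lam / (16 * α) with hr₀
    set Q := 4 * α / lam with hQ
    have hr₀0 : 0 < r₀ := by positivity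
    have hQ0 : 0 < Q := by positivity
    clear_value r₀ Q
    have h5 : μ / (4 * C) * r₀ * h ≤ |u y - u z| := by
      have h6 : |I| - M / 2 * e ^ 2 ≤ |u y - u z| := by
        have h7 : |I - (u y - u z)| ≤ M / 2 * e ^ 2 := by
          rw [abs_sub_comm, abs_le]; constructor <;> linarith
        have h8 := abs_sub_abs_le_abs_sub I (u y - u z)
        linarith
      rw [hGr] at h6
      have h7 : M / 2 * e ^ 2 ≤ μ / (4 * C) * r₀ * h := by
        calc M / 2 * e ^ 2 ≤ M / 2 * (Q * h) ^ 2 := by gcongr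
          _ = M / 2 * Q ^ 2 * h * h := by ring
          _ ≤ μ / (4 * C) * r₀ * h := by gcongr
      have h8 : μ / (2 * C) * (r₀ * h) ≤ ‖G z‖ * r := by gcongr
      have h9 : μ / (2 * C) * (r₀ * h) = 2 * (μ / (4 * C) * r₀ * h) := by field_simp; norm_num
      linarith
    have h6 : μ ^ 2 * h ^ 2 * min ((r₀ / (4 * C)) ^ 2) (t ^ 2) ≤
        min ((u y - u z) ^ 2) ((t * h * μ) ^ 2) := by
      refine le_min ?_ ?_
      · calc μ ^ 2 * h ^ 2 * min ((r₀ / (4 * C)) ^ 2) (t ^ 2)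
            ≤ μ ^ 2 * h ^ 2 * (r₀ / (4 * C)) ^ 2 := by gcongr; exact min_le_left _ _
          _ = (μ / (4 * C) * r₀ * h) ^ 2 := by ring
          _ ≤ |u y - u z| ^ 2 := by gcongr
          _ = _ := sq_abs _
      · calc μ ^ 2 * h ^ 2 * min ((r₀ / (4 * C)) ^ 2) (t ^ 2)
            ≤ μ ^ 2 * h ^ 2 * t ^ 2 := by gcongr; exact min_le_right _ _
          _ = _ := by ring
    have h7 : α * h * r ≤ k / μ ^ 2 * min ((u y - u z) ^ 2) ((t * h * μ) ^ 2) := by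
      calc α * h * r ≤ α * h * (Q * h) := by gcongr; linarith
        _ = (α * Q) * h ^ 2 := by ring
        _ ≤ (k * min ((r₀ / (4 * C)) ^ 2) (t ^ 2)) * h ^ 2 := by gcongr
        _ = k / μ ^ 2 * (μ ^ 2 * h ^ 2 * min ((r₀ / (4 * C)) ^ 2) (t ^ 2)) := by field_simp
        _ ≤ _ := by gcongr
    linarith
  have h10 : s * (u y - u z - I) = s * (u y - u z) - s * I := by ring
  linarith

/-- The barrier is a convex function of `u` with slope at least `1 + 2 A h²`, so `∂u`, enlarged by
this factor, lies in `∂u_h`. The gain `2 A h²` beats the consistency error `A h²`. -/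
lemma Config.deep_contradiction (F : Config lam M c C σ R₀ Ω f u G H x₀ μ h N K uh) {A k T : ℝ}
    (hA : 0 < A) (hk : 0 ≤ k) (hhA : A * h ^ 2 ≤ 1 / 4) {z : Space d} (hz : z ∈ N.inner)
    (hw0 : 0 < weight Ω f K z)
    (hlow : ENNReal.ofReal (weight Ω f K z * (1 - A * h ^ 2)) ≤ volume (subdiff N u z))
    (hsub : subdiff N (fun y => barrier (2 * A) k T h μ (u y)) z ⊆ subdiff N uh z) : False := by
  have hh := F.admissible.pos
  have hle := measure_mono (μ := volume) hsub
  rw [F.op.volume_eq z hz] at hle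
  set w := weight Ω f K z with hw
  set s := barrierSlope (2 * A) k T h μ (u z) with hs
  have hs1 : 1 + 2 * A * h ^ 2 ≤ s := one_add_le_barrierSlope hk
  have hs0 : 1 ≤ s := le_trans (le_add_of_nonneg_right (by positivity)) hs1
  have h1 : s • subdiff N u z ⊆ subdiff N (fun y => barrier (2 * A) k T h μ (u y)) z :=
    smul_subdiff_subset (by linarith) fun y _ => barrier_sub_ge hk
  clear_value s w
  have h2 := (measure_mono (μ := volume) h1).trans hle
  rw [volume_smul_set _ (by linarith)] at h2
  have h3 := (mul_le_mul_right hlow (ENNReal.ofReal (s ^ d))).trans h2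
  rw [← ENNReal.ofReal_mul (by positivity), ENNReal.ofReal_le_ofReal_iff hw0.le] at h3
  have h4 : 1 + 2 * A * h ^ 2 ≤ s ^ d :=
    hs1.trans (le_self_pow₀ hs0 (by have := F.admissible.dim; omega))
  have h8 : 0 < A * h ^ 2 := by positivity
  have h5 : (1 + 2 * A * h ^ 2) * (w * (1 - A * h ^ 2)) ≤ s ^ d * (w * (1 - A * h ^ 2)) := by
    gcongr
    exact mul_nonneg hw0.le (by linarith)
  have h6 : w * ((1 + 2 * A * h ^ 2) * (1 - A * h ^ 2)) ≤ w * 1 := by linarith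
  have h7 := le_of_mul_le_mul_left h6 hw0
  have h9 : A * h ^ 2 * (A * h ^ 2) ≤ 1 / 4 * (A * h ^ 2) := by gcongr
  linarith

/-- With this `α` the elongation of the ellipsoid alone contributes the upper bound of the weight,
so its volume exceeds the weight strictly. -/
lemma Config.layer_contradiction (F : Config lam M c C σ R₀ Ω f u G H x₀ μ h N K uh)
    (hlam : 0 < lam) (hM : 1 ≤ M) (hC : 1 ≤ C) {α t : ℝ} (ht : 2 * t * h ≤ μ) (hα : 0 < α)
    (hα' : (lam / 8) ^ d * (α / (lam / 8)) * ballVol d 1 = M * meshConst d σ ^ d * ballVol d 1)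
    {W : Space d → ℝ} {p z : Space d} (hz : z ∈ N.inner) (hu : -(t * h * μ) < u z)
    (hW : (fun q => p + q) '' ellipsoid ((‖G z‖)⁻¹ • G z) (lam / 8 * h) (α * h) ⊆ subdiff N W z)
    (hsub : subdiff N W z ⊆ subdiff N uh z) : False := by
  have T := F.admissible
  have hh := T.pos
  have hμ := F.round.pos
  have hle := measure_mono (μ := volume) hsub
  rw [F.op.volume_eq z hz] at hle
  have hG := F.norm_grad_ge hlam hC (mem_of_mem_inner hz) hu ht
  have hG0 : 0 < ‖G z‖ := lt_of_lt_of_le (by positivity) hG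
  have h2 := (measure_mono (μ := volume) hW).trans hle
  rw [volume_ellipsoid (by
    rw [norm_smul, norm_inv, norm_norm, inv_mul_cancel₀ hG0.ne']) (by positivity)
    (by positivity), ENNReal.ofReal_le_ofReal_iff
    (weight_nonneg F.regular hlam z)] at h2
  have h3 := h2.trans (T.weight_le F.regular hlam hM z)
  have hV : 0 < ballVol d 1 := ballVol_pos one_pos
  rw [← hα', mul_div_mul_right _ _ hh.ne', mul_pow] at h3
  have h6 : 0 < (lam / 8) ^ d * h ^ d * ballVol d 1 := by positivity
  linarith

end

/-- The barrier lies below `u` by at most `O(h²)` and vanishes on the boundary. Its difference with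
`uh` cannot be maximal at an interior node, by consistency if the node is deep and by the ellipsoid
if it is in the boundary layer. -/
theorem exists_lower_bound {lam M c C σ R₀ : ℝ} (hd : 1 ≤ d) (hlam : 0 < lam) (hM : 1 ≤ M)
    (hC : 1 ≤ C) : ∃ C₀ B : ℝ, 0 < C₀ ∧ 0 ≤ B ∧
    ∀ (Ω : Set (Space d)) (f u : Space d → ℝ) (G : Space d → Space d)
      (H : Space d → Space d →L[ℝ] Space d) (x₀ : Space d) (μ h : ℝ) (N : NodalSet Ω h)
      (K : Geometry.SimplicialComplex ℝ (Space d)) (uh : Space d → ℝ),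
      Config lam M c C σ R₀ Ω f u G H x₀ μ h N K uh → C₀ * h ≤ μ →
      ∀ z ∈ N.nodes, u z - uh z ≤ B * h ^ 2 := by
  obtain ⟨D, A, t₀, hD, hA, ht₀, ht₀1, hcons⟩ :=
    exists_consistency (d := d) (σ := σ) (R₀ := R₀) hlam hM
  set V := ballVol d 1 with hV
  have hV0 : 0 < V := ballVol_pos one_pos
  set t : ℝ := C * D with ht
  have ht0 : 0 < t := by positivity
  set W₀ : ℝ := M * meshConst d σ ^ d * V with hW₀
  have hm := meshConst_pos (d := d) σ
  have hW₀0 : 0 < W₀ := by positivity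
  set α : ℝ := lam / 8 * (W₀ / ((lam / 8) ^ d * V) ) with hα
  have hα0 : 0 < α := by positivity
  have hα' : (lam / 8) ^ d * (α / (lam / 8)) * V = W₀ := by rw [hα]; field_simp
  rw [hW₀, hV] at hα'
  set m₁ : ℝ := min ((lam / (16 * α) / (4 * C)) ^ 2) (t ^ 2) with hm₁
  have hm₁0 : 0 < m₁ := by positivity
  set k : ℝ := α * (4 * α / lam) / m₁ with hk
  have hk0 : 0 < k := by positivity
  set κ : ℝ := 2 * A with hκ
  have hκ0 : 0 < κ := by positivity
  clear_value α m₁ k κ t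
  -- The four terms serve the two smallness conditions on `h / μ` in the layer, then `h ≤ t₀` and `A
  -- h² ≤ 1/4`; the last two use `μ ≤ C`.
  refine ⟨2 * t + M / 2 * (4 * α / lam) ^ 2 * (4 * C) / (lam / (16 * α)) + C / t₀ + C * (4 * A + 1),
    κ * C ^ 2 + k * (2 * t) ^ 2, by positivity, by positivity, ?_⟩
  intro Ω f u G H x₀ μ h N K uh F hμh
  have T := F.admissible
  have hh := T.pos
  have hμ := F.round.pos
  have hμC := F.round.le
  have e1 : 0 ≤ M / 2 * (4 * α / lam) ^ 2 * (4 * C) / (lam / (16 * α)) * h := by positivity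
  have e2 : 0 ≤ C / t₀ * h := by positivity
  have e3 : 0 ≤ C * (4 * A + 1) * h := by positivity
  have e4 : 0 ≤ 2 * t * h := by positivity
  have hμ1 : 2 * t * h ≤ μ := by linarith
  have hμ2 : M / 2 * (4 * α / lam) ^ 2 * h ≤ μ / (4 * C) * (lam / (16 * α)) := by
    have h1 : M / 2 * (4 * α / lam) ^ 2 * (4 * C) / (lam / (16 * α)) * h ≤ μ := by linarith
    have h2 : M / 2 * (4 * α / lam) ^ 2 * (4 * C) / (lam / (16 * α)) * h =
        M / 2 * (4 * α / lam) ^ 2 * h * (4 * C) / (lam / (16 * α)) := by ring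
    rw [h2, div_le_iff₀ (by positivity)] at h1
    have h3 : μ / (4 * C) * (lam / (16 * α)) = μ * (lam / (16 * α)) / (4 * C) := by ring
    rwa [h3, le_div_iff₀ (by positivity)]
  have hht₀ : h ≤ t₀ := by
    have h1 : C / t₀ * h ≤ C := by linarith
    rw [div_mul_eq_mul_div, div_le_iff₀ ht₀] at h1
    exact le_of_mul_le_mul_left h1 (by positivity)
  have hh1 : h ≤ 1 := hht₀.trans ht₀1
  have hhA : A * h ^ 2 ≤ 1 / 4 := by
    have h1 : C * ((4 * A + 1) * h) ≤ C * 1 := by linarith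
    have h2 := le_of_mul_le_mul_left h1 (by positivity)
    have h3 : A * h * h ≤ A * h * 1 := by gcongr
    linarith
  set W : Space d → ℝ := fun y => barrier κ k (2 * t) h μ (u y) with hW
  have hWu : ∀ y ∈ closure Ω, u y - (κ * C ^ 2 + k * (2 * t) ^ 2) * h ^ 2 ≤ W y := fun y hy =>
    barrier_ge hκ0.le hk0.le (by
      have := F.round.min_le y hy
      nlinarith)
  obtain ⟨z, hz, hmax⟩ := exists_max_nodes hd T.domain N (fun y => W y - uh y)
  have hzb : W z - uh z ≤ 0 := by
    rcases hz with hz | hz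
    swap
    · rw [F.op.boundary z hz, hW]
      dsimp only
      rw [F.regular.boundary z (N.bdry_subset z hz), barrier_zero (by positivity) hh.le hμ, sub_zero]
    · exfalso
      have hzΩ := mem_of_mem_inner hz
      have hsub : subdiff N W z ⊆ subdiff N uh z := subdiff_subset_of_max hmax
      rcases le_or_gt (u z) (-(t * h * μ)) with hu | hu
      · rw [ht] at hu
        obtain ⟨hw0, -, hlow⟩ := hcons Ω f u G H h N K F.regular T hht₀ z hz
          (F.ball_subset hC hzΩ hu)
        rw [hW, hκ] at hsub
        exact F.deep_contradiction hA hk0.le hhA hz hw0 hlow hsub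
      · exact F.layer_contradiction hlam hM hC hμ1 hα0 hα' hz hu (F.ellipsoid_subset hlam hM hC ht0
          hα0 hκ0.le hk0.le (by rw [← hm₁, hk, div_mul_cancel₀ _ hm₁0.ne']) hμ1 hμ2 hz hu) hsub
  intro y hy
  have h1 := hmax y hy
  have h2 := hWu y (mem_closure_of_mem_nodes hy)
  linarith

/-! ### The upper bound for the discrete solution -/

lemma sum_mul_add_inner {s : Finset (Space d)} {w : Space d → ℝ} {x : Space d}
    (h1 : ∑ y ∈ s, w y = 1) (hx : ∑ y ∈ s, w y • y = x) (a : ℝ) (q z : Space d) :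
    ∑ y ∈ s, w y * (a + inner ℝ q (y - z)) = a + inner ℝ q (x - z) := by
  have h2 : ∑ y ∈ s, w y * inner ℝ q y = inner ℝ q x := by
    rw [← hx, inner_sum]
    exact Finset.sum_congr rfl fun y _ => (real_inner_smul_right _ _ _).symm
  have h3 : ∀ y ∈ s, w y * (a + inner ℝ q (y - z)) =
      w y * (a - inner ℝ q z) + w y * inner ℝ q y := fun y _ => by rw [inner_sub_right]; ring
  rw [Finset.sum_congr rfl h3, Finset.sum_add_distrib, ← Finset.sum_mul, h1, h2, inner_sub_right]
  ring

section

variable {lam M c C σ R₀ : ℝ} {Ω : Set (Space d)} {f u : Space d → ℝ} {G : Space d → Space d}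
  {H : Space d → Space d →L[ℝ] Space d} {x₀ : Space d} {μ h : ℝ} {N : NodalSet Ω h}
  {K : Geometry.SimplicialComplex ℝ (Space d)} {uh : Space d → ℝ}

lemma IsAdmissible.mem_nodes_of_mem_face (T : IsAdmissible σ R₀ N K) {s : Finset (Space d)}
    (hs : s ∈ K.faces) {y : Space d} (hy : y ∈ s) : y ∈ N.nodes :=
  T.triangulation.vertices_eq ▸ mem_vertices_of_mem hs hy

/-- Let `E` be the maximum of `uh - s u`, attained at `z`. A supporting plane of `uh` at `z` is at
most `s u + E` at nodes around the deep point `w`, and at most `0 = s u` at the boundary node `x'`.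
Replacing `u` by its tangent plane up to `O(h²)` and averaging with the weights of `z` gives `θ E =
O(h²)` with `θ ≥ 1/2`. -/
lemma Config.bound_of_extension (F : Config lam M c C σ R₀ Ω f u G H x₀ μ h N K uh) (hM : 1 ≤ M)
    {z x' w : Space d} {θ s Q r : ℝ} (hz : z ∈ N.inner) (hx' : x' ∈ N.bdry)
    (hzx' : ‖x' - z‖ ≤ Q * h) (hθ : 1 / 2 ≤ θ) (hθ1 : θ ≤ 1) (hzw : z = θ • x' + (1 - θ) • w)
    (hw : Metric.ball w r ⊆ Ω) (hr : (meshConst d σ + 2 * d + 1) * h ≤ r)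
    (hwz : meshConst d σ * h + ‖w - z‖ ≤ Q * h) (hs0 : 0 ≤ s) (hs1 : s ≤ 1)
    (hmax : ∀ y ∈ N.nodes, uh y - s * u y ≤ uh z - s * u z) :
    uh z - s * u z ≤ M * Q ^ 2 * h ^ 2 := by
  have T := F.admissible
  have hzΩ := mem_of_mem_inner hz
  obtain ⟨t, ht, b, hb0, hb1, hbw⟩ := exists_weights
    (mem_space_of_ball_subset T.domain T.dim T.pos T.triangulation T.shape hw hr)
  obtain ⟨q, hq⟩ := F.op.convex z hz
  have hx'n : x' ∈ N.nodes := Or.inr hx'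
  have hx'F := N.bdry_subset x' hx'
  have key : ∀ p : Space d, θ * inner ℝ p (x' - z) + (1 - θ) * inner ℝ p (w - z) = 0 := fun p => by
    rw [← real_inner_smul_right, ← real_inner_smul_right, ← inner_add_right]
    have : θ • (x' - z) + (1 - θ) • (w - z) = (θ • x' + (1 - θ) • w) - z := by module
    rw [this, ← hzw, sub_self, inner_zero_right]
  have hup : ∀ y ∈ N.nodes, ‖y - z‖ ≤ Q * h →
      u y ≤ u z + inner ℝ (G z) (y - z) + M / 2 * Q ^ 2 * h ^ 2 := fun y hy hyz => by
    have h1 := F.regular.upper z hzΩ y (mem_closure_of_mem_nodes hy)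
    have h2 : M / 2 * ‖y - z‖ ^ 2 ≤ M / 2 * (Q * h) ^ 2 := by gcongr
    linarith
  have hclose : ∀ y ∈ t, ‖y - z‖ ≤ Q * h := fun y hy => by
    have h1 := dist_le_of_mem_face T.domain T.dim T.pos T.triangulation T.shape ht
      (subset_convexHull ℝ _ hy) (Finset.mem_convexHull'.2 ⟨b, hb0, hb1, hbw⟩)
    have h2 := norm_add_le (y - w) (w - z)
    rw [sub_add_sub_cancel] at h2
    linarith
  set E := uh z - s * u z with hE
  set B := M / 2 * Q ^ 2 * h ^ 2 with hB
  have h1 : uh z + inner ℝ q (w - z) ≤ s * (u z + B + inner ℝ (G z) (w - z)) + E := by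
    rw [← sum_mul_add_inner hb1 hbw, ← sum_mul_add_inner hb1 hbw, Finset.mul_sum]
    have h2 : E = ∑ y ∈ t, b y * E := by rw [← Finset.sum_mul, hb1, one_mul]
    rw [h2, ← Finset.sum_add_distrib]
    refine Finset.sum_le_sum fun y hy => ?_
    have hyn := T.mem_nodes_of_mem_face ht hy
    have h3 := hmax y hyn
    have h4 := hq y hyn
    have h5 := mul_le_mul_of_nonneg_left (hup y hyn (hclose y hy)) hs0
    have h6 : uh z + inner ℝ q (y - z) ≤ s * (u z + B + inner ℝ (G z) (y - z)) + E := by linarith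
    have h7 := mul_le_mul_of_nonneg_left h6 (hb0 y hy)
    linarith
  have h2 : uh z + inner ℝ q (x' - z) ≤ s * (u z + B + inner ℝ (G z) (x' - z)) := by
    have h3 := hq x' hx'n
    rw [F.op.boundary x' hx'] at h3
    have h4 := hup x' hx'n hzx'
    rw [F.regular.boundary x' hx'F] at h4
    have h5 := mul_le_mul_of_nonneg_left h4 hs0
    linarith
  have h3 := mul_le_mul_of_nonneg_left h1 (sub_nonneg.2 hθ1)
  have h4 := mul_le_mul_of_nonneg_left h2 (show 0 ≤ θ by linarith)
  have h5 := key q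
  have h6 : s * (θ * inner ℝ (G z) (x' - z) + (1 - θ) * inner ℝ (G z) (w - z)) = 0 := by
    rw [key (G z), mul_zero]
  have hB0 : 0 ≤ B := by positivity
  have h7 : s * B ≤ B := mul_le_of_le_one_left hB0 hs1
  have h8 : θ * E ≤ B := by linarith
  have h9 : M * Q ^ 2 * h ^ 2 = 2 * B := by rw [hB]; ring
  rw [h9]
  rcases le_total E 0 with h10 | h10
  · linarith
  · have := mul_le_mul_of_nonneg_right hθ h10
    linarith

/-- Dividing by `1 - 2 A h²` enlarges `∂u_h` more than the consistency error `1 + A h²` of `∂u`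
allows. -/
lemma Config.deep_contradiction_upper (F : Config lam M c C σ R₀ Ω f u G H x₀ μ h N K uh) {A : ℝ}
    (hA : 0 < A) (hhA : A * h ^ 2 ≤ 1 / 4) {z : Space d} (hz : z ∈ N.inner)
    (hw0 : 0 < weight Ω f K z)
    (hup : volume (subdiff N u z) ≤ ENNReal.ofReal (weight Ω f K z * (1 + A * h ^ 2)))
    (hsub : subdiff N uh z ⊆ subdiff N (fun y => (1 - 2 * A * h ^ 2) * u y) z) : False := by
  have hh := F.admissible.pos
  set w := weight Ω f K z with hw
  set s := 1 - 2 * A * h ^ 2 with hs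
  have hs0 : 0 < s := by rw [hs]; linarith
  have h1 : s⁻¹ • subdiff N (fun y => s * u y) z ⊆ subdiff N u z :=
    smul_subdiff_subset (by positivity) fun y _ => by
      rw [← mul_sub, inv_mul_cancel_left₀ hs0.ne']
  have h2 := measure_mono (μ := volume) (smul_set_mono (a := s⁻¹) hsub)
  have h3 := h2.trans ((measure_mono h1).trans hup)
  rw [volume_smul_set _ (by positivity), F.op.volume_eq z hz,
    ← ENNReal.ofReal_mul (by positivity), ENNReal.ofReal_le_ofReal_iff (by positivity)] at h3
  have h4 : s⁻¹ * w ≤ (1 + A * h ^ 2) * w := by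
    refine le_trans ?_ (h3.trans (le_of_eq (mul_comm _ _)))
    gcongr
    exact le_self_pow₀ ((one_le_inv₀ hs0).2 (by rw [hs]; linarith [show 0 < A * h ^ 2 by positivity]))
      (by have := F.admissible.dim; omega)
  have h5 := le_of_mul_le_mul_right h4 hw0
  rw [inv_le_iff_one_le_mul₀ hs0, hs] at h5
  have h8 : 0 < A * h ^ 2 := by positivity
  have h9 : 0 < A * h ^ 2 * (A * h ^ 2) := by positivity
  linarith

/-- Linear growth of `-u` makes a point with small `|u|` close to the boundary, where boundary nodes
are `h`-dense. -/
lemma Config.exists_bdry_near (F : Config lam M c C σ R₀ Ω f u G H x₀ μ h N K uh) (hc : 0 < c)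
    {t : ℝ} {z : Space d} (hz : z ∈ Ω) (hu : -(t * h * μ) < u z) :
    ∃ x' ∈ N.bdry, ‖z - x'‖ ≤ (t / c + 1) * h := by
  have T := F.admissible
  have hμ := F.round.pos
  have hfr := frontier_nonempty T.dim T.domain.nonempty T.domain.isBounded
  obtain ⟨x, hx, hzx⟩ := isClosed_frontier.exists_infDist_eq_dist hfr z
  have hpos : 0 < Metric.infDist z (frontier Ω) := by
    refine (isClosed_frontier.notMem_iff_infDist_pos hfr).1 fun hzf => ?_
    exact notMem_of_mem_frontier T.domain.isOpen hzf hz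
  have h1 := F.round.growth z hz _ hpos
    ((ball_subset_iff_le_infDist T.domain.isOpen hfr hz).2 le_rfl)
  obtain ⟨x', hx', hxx'⟩ := N.bdry_dense x hx
  refine ⟨x', hx', ?_⟩
  rw [← dist_eq_norm]
  have h2 := dist_triangle z x x'
  rw [← hzx] at h2
  have h3 : Metric.infDist z (frontier Ω) ≤ t / c * h := by
    rw [div_mul_eq_mul_div, le_div_iff₀ hc]
    have : μ * (Metric.infDist z (frontier Ω) * c) ≤ μ * (t * h) := by linarith
    exact le_of_mul_le_mul_left this hμ
  linarith

end

theorem exists_upper_bound {lam M c C σ R₀ : ℝ} (hd : 1 ≤ d) (hlam : 0 < lam) (hM : 1 ≤ M)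
    (hc : 0 < c) (hC : 1 ≤ C) : ∃ C₀ B : ℝ, 0 < C₀ ∧ 0 ≤ B ∧
    ∀ (Ω : Set (Space d)) (f u : Space d → ℝ) (G : Space d → Space d)
      (H : Space d → Space d →L[ℝ] Space d) (x₀ : Space d) (μ h : ℝ) (N : NodalSet Ω h)
      (K : Geometry.SimplicialComplex ℝ (Space d)) (uh : Space d → ℝ),
      Config lam M c C σ R₀ Ω f u G H x₀ μ h N K uh → C₀ * h ≤ μ →
      ∀ z ∈ N.nodes, uh z - u z ≤ B * h ^ 2 := by
  obtain ⟨D, A, t₀, hD, hA, ht₀, ht₀1, hcons⟩ :=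
    exists_consistency (d := d) (σ := σ) (R₀ := R₀) hlam hM
  set t : ℝ := C * D with ht
  have ht0 : 0 < t := by positivity
  have hm := meshConst_pos (d := d) σ
  set r : ℝ := meshConst d σ + 2 * d + 1 with hr
  have hr0 : 0 < r := by positivity
  obtain ⟨L, C₁, hL, hC₁, hext⟩ := exists_deep_extension (d := d) (lam := lam) hM hc hC
    (show 0 < t / c + 1 by positivity) hr0 hd
  set Q : ℝ := meshConst d σ + L + (t / c + 1) with hQ
  have hQ0 : 0 < Q := by positivity
  refine ⟨C₁ + C / t₀ + C * (4 * A + 1), M * Q ^ 2 + 2 * A * C ^ 2, by positivity,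
    by positivity, ?_⟩
  intro Ω f u G H x₀ μ h N K uh F hμh
  have T := F.admissible
  have hh := T.pos
  have hμ := F.round.pos
  have hμC := F.round.le
  have e2 : 0 ≤ C / t₀ * h := by positivity
  have e3 : 0 ≤ C * (4 * A + 1) * h := by positivity
  have e4 : 0 ≤ C₁ * h := by positivity
  have hC₁μ : C₁ * h ≤ μ := by linarith
  have hht₀ : h ≤ t₀ := by
    have h1 : C / t₀ * h ≤ C := by linarith
    rw [div_mul_eq_mul_div, div_le_iff₀ ht₀] at h1
    exact le_of_mul_le_mul_left h1 (by positivity)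
  have hh1 : h ≤ 1 := hht₀.trans ht₀1
  have hhA : A * h ^ 2 ≤ 1 / 4 := by
    have h1 : C * ((4 * A + 1) * h) ≤ C * 1 := by linarith
    have h2 := le_of_mul_le_mul_left h1 (by positivity)
    have h3 : A * h * h ≤ A * h * 1 := by gcongr
    linarith
  obtain ⟨z, hz, hmax⟩ := exists_max_nodes hd T.domain N
    (fun y => uh y - (1 - 2 * A * h ^ 2) * u y)
  have hAh : 0 < A * h ^ 2 := by positivity
  have hzb : uh z - (1 - 2 * A * h ^ 2) * u z ≤ M * Q ^ 2 * h ^ 2 := by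
    rcases hz with hz | hz
    swap
    · rw [F.op.boundary z hz, F.regular.boundary z (N.bdry_subset z hz)]
      simp only [mul_zero, sub_zero]
      positivity
    · have hzΩ := mem_of_mem_inner hz
      rcases le_or_gt (u z) (-(t * h * μ)) with hu | hu
      · exfalso
        rw [ht] at hu
        obtain ⟨hw0, hup, -⟩ := hcons Ω f u G H h N K F.regular T hht₀ z hz
          (F.ball_subset hC hzΩ hu)
        exact F.deep_contradiction_upper hA hhA hz hw0 hup (subdiff_subset_of_max hmax)
      · obtain ⟨x', hx', hzx'⟩ := F.exists_bdry_near hc hzΩ hu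
        obtain ⟨w, θ, hθ, hθ1, hzw, hw, hwz⟩ := hext Ω f u G H F.regular x₀ μ F.round h hh hC₁μ z
          hzΩ ((mem_inner_iff T.domain hd).1 hz).2.2 x' (N.bdry_subset x' hx') hzx'
        refine F.bound_of_extension hM hz hx' ?_ hθ hθ1 hzw hw le_rfl ?_ (by linarith)
          (by linarith) hmax
        · rw [norm_sub_rev]
          refine hzx'.trans ?_
          gcongr
          linarith
        · have h1 : Q * h = meshConst d σ * h + L * h + (t / c + 1) * h := by rw [hQ]; ring
          have h2 : 0 ≤ (t / c + 1) * h := by positivity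
          linarith
  intro y hy
  have h1 := hmax y hy
  have h2 := F.round.min_le y (mem_closure_of_mem_nodes hy)
  have h3 : -(C ^ 2) ≤ u y := by
    have : μ ^ 2 ≤ C ^ 2 := by gcongr
    linarith
  have h4 := mul_le_mul_of_nonneg_left h3 (show 0 ≤ 2 * A * h ^ 2 by positivity)
  linarith

/-! ### Crude bounds for domains of size comparable to the mesh -/

section

variable {lam M c C σ R₀ : ℝ} {Ω : Set (Space d)} {f u : Space d → ℝ} {G : Space d → Space d}
  {H : Space d → Space d →L[ℝ] Space d} {x₀ : Space d} {μ h : ℝ} {N : NodalSet Ω h}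
  {K : Geometry.SimplicialComplex ℝ (Space d)} {uh : Space d → ℝ}

/-- At an interior maximum a subgradient `q` cannot point into the triangulated region, so it is
zero; then the maximal value is a minimum as well and is bounded by the boundary value. -/
lemma Config.nonpos (F : Config lam M c C σ R₀ Ω f u G H x₀ μ h N K uh) {y : Space d}
    (hy : y ∈ N.nodes) : uh y ≤ 0 := by
  have T := F.admissible
  obtain ⟨z, hz, hmax⟩ := exists_max_nodes T.dim T.domain N uh
  refine (hmax y hy).trans ?_
  rcases hz with hz | hz
  swap
  · exact (F.op.boundary z hz).le
  obtain ⟨q, hq⟩ := F.op.convex z hz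
  have hq' : ∀ y ∈ N.nodes, inner ℝ q (y - z) ≤ 0 := fun y hy => by
    have h1 := hq y hy
    have h2 := hmax y hy
    linarith
  have hint := T.triangulation.inner_interior z hz
  obtain ⟨ε, hε, hball⟩ := Metric.mem_nhds_iff.1 (mem_interior_iff_mem_nhds.1 hint)
  have hmem : z + (ε / (2 * (‖q‖ + 1))) • q ∈ Metric.ball z ε := by
    have hn := norm_nonneg q
    rw [Metric.mem_ball, dist_eq_norm, add_sub_cancel_left, norm_smul,
      Real.norm_of_nonneg (by positivity), div_mul_eq_mul_div, div_lt_iff₀ (by positivity)]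
    nlinarith
  obtain ⟨t, ht, b, hb0, hb1, hbw⟩ := exists_weights (hball hmem)
  have h1 := sum_mul_add_inner hb1 hbw 0 q z
  rw [add_sub_cancel_left, real_inner_smul_right, real_inner_self_eq_norm_sq, zero_add] at h1
  have h2 : ∑ y ∈ t, b y * (0 + inner ℝ q (y - z)) ≤ 0 := Finset.sum_nonpos fun y hy =>
    mul_nonpos_of_nonneg_of_nonpos (hb0 y hy)
      (by rw [zero_add]; exact hq' y (T.mem_nodes_of_mem_face ht hy))
  rw [h1] at h2
  have h3 : ‖q‖ ^ 2 ≤ 0 := by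
    by_contra! h4
    have := mul_pos (show 0 < ε / (2 * (‖q‖ + 1)) by positivity) h4
    linarith
  have h4 : q = 0 := by
    rw [← norm_eq_zero]
    exact pow_eq_zero_iff (two_ne_zero) |>.1 (le_antisymm h3 (by positivity))
  obtain ⟨x, hx⟩ := exists_bdry T.dim T.domain N
  have h5 := hq x (Or.inr hx)
  rw [h4, inner_zero_left, F.op.boundary x hx] at h5
  linarith

/-- A paraboloid with large opening `k` has at every interior node a subdifferential containing a
ball of radius `k h / 2`, too large for the weight. Hence its maximum over `uh` is attained on the
boundary. -/
lemma Config.ge_paraboloid (F : Config lam M c C σ R₀ Ω f u G H x₀ μ h N K uh) (hlam : 0 < lam)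
    (hM : 1 ≤ M) {y : Space d} (hy : y ∈ N.nodes) :
    -(2 * (M * meshConst d σ + 1) * (C * μ) ^ 2) ≤ uh y := by
  have T := F.admissible
  have hh := T.pos
  have hm := meshConst_pos (d := d) σ
  set k := 2 * (M * meshConst d σ + 1) with hk
  have hk0 : 0 < k := by positivity
  obtain ⟨z, hz, hmax⟩ := exists_max_nodes T.dim T.domain N
    (fun y => k * (‖y - x₀‖ ^ 2 - (C * μ) ^ 2) - uh y)
  have hzb : k * (‖z - x₀‖ ^ 2 - (C * μ) ^ 2) - uh z ≤ 0 := by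
    rcases hz with hz | hz
    swap
    · rw [F.op.boundary z hz, sub_zero]
      refine mul_nonpos_of_nonneg_of_nonpos hk0.le ?_
      have := pow_le_pow_left₀ (norm_nonneg _)
        (F.round.bounded z (frontier_subset_closure (N.bdry_subset z hz))) 2
      linarith
    · exfalso
      have hsub : Metric.closedBall ((2 * k) • (z - x₀)) (k / 2 * h) ⊆ subdiff N uh z := by
        refine Subset.trans ?_ (subdiff_subset_of_max hmax)
        intro q hq y hy
        by_cases hyz : y = z
        · simp [hyz]
        have h1 := half_le_norm_sub T.domain T.dim hh hz hy hyz
        rw [Metric.mem_closedBall, dist_eq_norm] at hq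
        have h2 : inner ℝ (q - (2 * k) • (z - x₀)) (y - z) ≤ k / 2 * h * ‖y - z‖ :=
          (real_inner_le_norm _ _).trans (by gcongr)
        rw [inner_sub_left, real_inner_smul_left] at h2
        have h3 : ‖y - x₀‖ ^ 2 = ‖z - x₀‖ ^ 2 + 2 * inner ℝ (z - x₀) (y - z) + ‖y - z‖ ^ 2 := by
          rw [← norm_add_sq_real, add_comm (z - x₀), sub_add_sub_cancel]
        have h4 : k / 2 * h * ‖y - z‖ ≤ k * ‖y - z‖ * ‖y - z‖ := by
          calc k / 2 * h * ‖y - z‖ = k * (h / 2) * ‖y - z‖ := by ring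
            _ ≤ _ := by gcongr
        dsimp only
        rw [h3]
        linarith
      have hle := measure_mono (μ := volume) hsub
      rw [F.op.volume_eq z hz, volume_closedBall_center_eq _ (by positivity),
        ENNReal.ofReal_le_ofReal_iff (weight_nonneg F.regular hlam z)] at hle
      have h1 := hle.trans (T.weight_le F.regular hlam hM z)
      have hV : 0 < ballVol d 1 := ballVol_pos one_pos
      rw [mul_pow, show (k / 2) ^ d * h ^ d * ballVol d 1 = (k / 2) ^ d * (ballVol d 1 * h ^ d) by
        ring, mul_assoc _ (ballVol d 1)] at h1
      have h2 := le_of_mul_le_mul_right h1 (by positivity)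
      have h3 : M * meshConst d σ ^ d ≤ (M * meshConst d σ) ^ d := by
        rw [mul_pow]
        gcongr
        exact le_self_pow₀ hM (by have := T.dim; omega)
      have h4 : (M * meshConst d σ) ^ d < (k / 2) ^ d :=
        pow_lt_pow_left₀ (by rw [hk]; linarith) (by positivity) (by have := T.dim; omega)
      linarith
  have h1 := hmax y hy
  have h2 : 0 ≤ k * ‖y - x₀‖ ^ 2 := by positivity
  linarith

end

/-- The quadratic rate in the maximum norm. -/
theorem exists_maxNorm_bound {lam M c C σ R₀ : ℝ} (hd : 1 ≤ d) (hlam : 0 < lam) (hM : 1 ≤ M)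
    (hc : 0 < c) (hC : 1 ≤ C) : ∃ B : ℝ, 0 < B ∧
    ∀ (Ω : Set (Space d)) (f u : Space d → ℝ) (G : Space d → Space d)
      (H : Space d → Space d →L[ℝ] Space d) (x₀ : Space d) (μ h : ℝ) (N : NodalSet Ω h)
      (K : Geometry.SimplicialComplex ℝ (Space d)) (uh : Space d → ℝ),
      Config lam M c C σ R₀ Ω f u G H x₀ μ h N K uh →
      ∀ z ∈ N.nodes, |u z - uh z| ≤ B * h ^ 2 := by
  obtain ⟨C₁, B₁, hC₁, hB₁, h₁⟩ := exists_lower_bound (d := d) (σ := σ) (R₀ := R₀) (c := c)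
    hd hlam hM hC
  obtain ⟨C₂, B₂, hC₂, hB₂, h₂⟩ := exists_upper_bound (d := d) (σ := σ) (R₀ := R₀) hd hlam hM hc hC
  have hm := meshConst_pos (d := d) σ
  set k := 2 * (M * meshConst d σ + 1) with hk
  have hk0 : 0 < k := by positivity
  refine ⟨B₁ + B₂ + ((C₁ + C₂) ^ 2 + k * (C * (C₁ + C₂)) ^ 2), by positivity, ?_⟩
  intro Ω f u G H x₀ μ h N K uh F z hz
  have hh := F.admissible.pos
  have e1 : 0 ≤ B₁ * h ^ 2 := by positivity
  have e2 : 0 ≤ B₂ * h ^ 2 := by positivity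
  have e3 : 0 ≤ ((C₁ + C₂) ^ 2 + k * (C * (C₁ + C₂)) ^ 2) * h ^ 2 := by positivity
  have hμ := F.round.pos
  -- For large `μ` the comparison results apply. Otherwise `u` and `uh` are both `O(μ²) = O(h²)`.
  rcases le_or_gt ((C₁ + C₂) * h) μ with hle | hlt
  · have p1 : 0 ≤ C₁ * h := by positivity
    have p2 : 0 ≤ C₂ * h := by positivity
    have g1 := h₁ Ω f u G H x₀ μ h N K uh F (by linarith) z hz
    have g2 := h₂ Ω f u G H x₀ μ h N K uh F (by linarith) z hz
    rw [abs_le]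
    constructor <;> linarith
  · have hcl := mem_closure_of_mem_nodes hz
    have g1 := F.round.min_le z hcl
    have g2 := F.round.nonpos z hcl
    have g3 := F.nonpos hz
    have g4 := F.ge_paraboloid hlam hM hz
    rw [← hk] at g4
    have g5 : μ ^ 2 ≤ ((C₁ + C₂) * h) ^ 2 := by gcongr
    have g6 : k * (C * μ) ^ 2 ≤ k * (C * ((C₁ + C₂) * h)) ^ 2 := by gcongr
    have g7 : k * (C * ((C₁ + C₂) * h)) ^ 2 = k * (C * (C₁ + C₂)) ^ 2 * h ^ 2 := by ring
    have g8 : 0 ≤ k * (C * μ) ^ 2 := by positivity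
    rw [abs_le]
    constructor <;> nlinarith

/-! ### The subdifferential of a perturbation -/

section

variable {Ω : Set (Space d)} {h : ℝ} {N : NodalSet Ω h}

lemma measurableSet_subdiff (v : Space d → ℝ) (z : Space d) : MeasurableSet (subdiff N v z) := by
  have : subdiff N v z = ⋂ y ∈ N.nodes, {q : Space d | v z + inner ℝ q (y - z) ≤ v y} := by
    ext q; simp [subdiff]
  rw [this]
  refine (isClosed_biInter fun y _ => ?_).measurableSet
  exact isClosed_le (by fun_prop) continuous_const

lemma volume_subdiff_mul (u : Space d → ℝ) (z : Space d) {s : ℝ} (hs : 0 < s) :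
    volume (subdiff N (fun y => s * u y) z) = ENNReal.ofReal (s ^ d) * volume (subdiff N u z) := by
  rw [← volume_smul_set s hs.le]
  congr 1
  refine Subset.antisymm ?_ (smul_subdiff_subset hs.le fun y _ => by rw [mul_sub])
  rw [subset_smul_set_iff₀ hs.ne']
  exact smul_subdiff_subset (inv_pos.2 hs).le fun y _ => by
    rw [← mul_sub, inv_mul_cancel_left₀ hs.ne']

/-- Since `∂v + ∂b ⊆ ∂a`, Brunn–Minkowski subtracts `d`-th roots of volumes: `γ` may be any number
above `α - β`, in units of `g`. -/
lemma volume_subdiff_le {a b v : Space d → ℝ} {z : Space d} {g α β γ : ℝ} (hd : 1 ≤ d)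
    (hz : z ∈ N.nodes) (hab : ∀ y ∈ N.nodes, v y + b y = a y) (hg : 0 < g) (hα : 0 ≤ α)
    (hβ : 0 ≤ β) (hγ : 0 ≤ γ) (hlt : α < γ + β)
    (ha : volume (subdiff N a z) ≤ ENNReal.ofReal ((g * α) ^ d))
    (hb : ENNReal.ofReal ((g * β) ^ d) ≤ volume (subdiff N b z)) (hbn : (subdiff N b z).Nonempty) :
    volume (subdiff N v z) ≤ ENNReal.ofReal ((g * γ) ^ d) := by
  by_contra! hcon
  have hvn : (subdiff N v z).Nonempty := by
    rw [nonempty_iff_ne_empty]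
    intro h0
    rw [h0, measure_empty] at hcon
    exact not_lt_bot hcon
  have h1 := brunn_minkowski (measurableSet_subdiff (N := N) v z) (measurableSet_subdiff b z)
    (measurableSet_subdiff a z) hvn hbn (fun q hq q' hq' y hy => by
      have h1 := hq y hy
      have h2 := hq' y hy
      rw [inner_add_left]
      linarith [hab y hy, hab z hz]) (by positivity) (by positivity) hcon.le hb
  have h2 := h1.trans ha
  rw [ENNReal.ofReal_le_ofReal_iff (by positivity), ← mul_add] at h2
  have h3 := lt_of_pow_lt_pow_left₀ d (by positivity)
    (lt_of_le_of_ne h2 fun h => ?_)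
  · exact absurd (lt_of_mul_lt_mul_left h3 hg.le) (by linarith)
  · have h4 : (g * α) ^ d < (g * (γ + β)) ^ d :=
      pow_lt_pow_left₀ (by gcongr) (by positivity) (by omega)
    linarith

end

/-- The two functions are `uh - (1 - ε) u` and `(1 + ε) u - uh`. In each, the `d`-th roots of the
volumes for `u` and `uh` agree up to the relative error `O(h²)`, so their difference is `ε + O(h²)`
times the root of the weight. -/
theorem exists_perturbation_volume {lam M σ R₀ : ℝ} (hlam : 0 < lam) (hM : 1 ≤ M) :
    ∃ D C t₁ : ℝ, 1 ≤ D ∧ 0 < C ∧ 0 < t₁ ∧ t₁ ≤ 1 ∧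
      ∀ (Ω : Set (Space d)) (f u : Space d → ℝ) (G : Space d → Space d)
      (H : Space d → Space d →L[ℝ] Space d) (h : ℝ) (N : NodalSet Ω h)
      (K : Geometry.SimplicialComplex ℝ (Space d)) (uh : Space d → ℝ),
      RegularSolution lam M Ω f u G H → IsAdmissible σ R₀ N K → IsOPSolution N K f uh →
      h ≤ t₁ → ∀ z ∈ N.inner, Metric.ball z (D * h) ⊆ Ω → ∀ ε : ℝ, 0 < ε → ε ≤ 1 / 2 →
      volume (subdiff N (fun y => (uh y - u y) + ε * u y) z) ≤
        ENNReal.ofReal (weight Ω f K z * (ε + C * h ^ 2) ^ d) ∧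
      volume (subdiff N (fun y => (u y - uh y) + ε * u y) z) ≤
        ENNReal.ofReal (weight Ω f K z * (ε + C * h ^ 2) ^ d) := by
  obtain ⟨D, A, t₀, hD, hA, ht₀, ht₀1, hcons⟩ :=
    exists_consistency (d := d) (σ := σ) (R₀ := R₀) hlam hM
  refine ⟨D, 2 * A, min t₀ (1 / (1 + A)), hD, by positivity, by positivity,
    (min_le_left _ _).trans ht₀1, ?_⟩
  intro Ω f u G H h N K uh S T O hh1 z hz hball ε hε hε2
  have hd := T.dim
  have hh := T.pos
  obtain ⟨hw0, hup, hlow⟩ := hcons Ω f u G H h N K S T (hh1.trans (min_le_left _ _)) z hz hball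
  have hhA : A * h ^ 2 < 1 := by
    have h1 : h ≤ 1 / (1 + A) := hh1.trans (min_le_right _ _)
    rw [le_div_iff₀ (by positivity)] at h1
    have h2 : h ≤ 1 := (hh1.trans (min_le_left _ _)).trans ht₀1
    have h3 : A * h * h ≤ A * h * 1 := by gcongr
    linarith
  have hAh : 0 < A * h ^ 2 := by positivity
  have hzn : z ∈ N.nodes := Or.inl hz
  set w := weight Ω f K z with hw
  -- The `d`-th root of the weight is the common unit for all three volumes.
  set g : ℝ := w ^ ((d : ℝ)⁻¹) with hgdef
  have hg0 : 0 < g := Real.rpow_pos_of_pos hw0 _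
  have hgd : g ^ d = w := Real.rpow_inv_natCast_pow hw0.le (by omega)
  clear_value g w
  have hww : w * (ε + 2 * A * h ^ 2) ^ d = (g * (ε + 2 * A * h ^ 2)) ^ d := by rw [mul_pow, hgd]
  have hvol : volume (subdiff N uh z) = ENNReal.ofReal ((g * 1) ^ d) := by
    rw [O.volume_eq z hz, mul_one, hgd, hw]
  rw [hww]
  constructor
  · have hb : ENNReal.ofReal ((g * ((1 - ε) * (1 - A * h ^ 2))) ^ d) ≤
        volume (subdiff N (fun y => (1 - ε) * u y) z) := by
      rw [volume_subdiff_mul _ _ (by linarith)]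
      refine le_trans ?_ (mul_le_mul_right hlow _)
      rw [← ENNReal.ofReal_mul (pow_nonneg (by linarith) _)]
      refine ENNReal.ofReal_le_ofReal ?_
      have h1 : (1 - A * h ^ 2) ^ d ≤ 1 - A * h ^ 2 :=
        pow_le_of_le_one (by linarith) (by linarith) (by omega)
      calc (g * ((1 - ε) * (1 - A * h ^ 2))) ^ d = (1 - ε) ^ d * (w * (1 - A * h ^ 2) ^ d) := by
            rw [mul_pow, mul_pow, hgd]; ring
        _ ≤ (1 - ε) ^ d * (w * (1 - A * h ^ 2)) := by
            gcongr
            exact pow_nonneg (by linarith) _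
    have h1 : 0 < (1 - ε) * (1 - A * h ^ 2) := mul_pos (by linarith) (by linarith)
    refine volume_subdiff_le hd hzn (a := uh) (b := fun y => (1 - ε) * u y) (fun y _ => by ring) hg0
      zero_le_one h1.le (by positivity) ?_ hvol.le hb ?_
    · have : 0 < ε * (A * h ^ 2) := by positivity
      linarith
    · refine nonempty_of_measure_ne_zero (μ := volume) (ne_of_gt (lt_of_lt_of_le ?_ hb))
      rw [ENNReal.ofReal_pos]
      positivity
  · have ha : volume (subdiff N (fun y => (1 + ε) * u y) z) ≤
        ENNReal.ofReal ((g * ((1 + ε) * (1 + A * h ^ 2))) ^ d) := by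
      rw [volume_subdiff_mul _ _ (by linarith)]
      refine (mul_le_mul_right hup _).trans ?_
      rw [← ENNReal.ofReal_mul (by positivity)]
      refine ENNReal.ofReal_le_ofReal ?_
      have h1 : 1 + A * h ^ 2 ≤ (1 + A * h ^ 2) ^ d := le_self_pow₀ (by linarith) (by omega)
      calc (1 + ε) ^ d * (w * (1 + A * h ^ 2)) ≤ (1 + ε) ^ d * (w * (1 + A * h ^ 2) ^ d) := by
            gcongr
        _ = _ := by rw [mul_pow, mul_pow, hgd]; ring
    refine volume_subdiff_le hd hzn (a := fun y => (1 + ε) * u y) (b := uh) (fun y _ => by ring) hg0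
      (by positivity) zero_le_one (by positivity) ?_ ha hvol.ge (O.convex z hz)
    have : ε * (A * h ^ 2) ≤ 1 / 2 * (A * h ^ 2) := by gcongr
    linarith

/-! ### Second differences -/

section

variable {Ω : Set (Space d)}

/-- The supremum is positive since `Ω` is open, and attained since its closure is closed. -/
lemma stepLength_spec (ho : IsOpen Ω) {x : Space d} (hx : x ∈ Ω) (a : Space d) :
    0 < stepLength Ω x a ∧ stepLength Ω x a ≤ 1 ∧ x + stepLength Ω x a • a ∈ closure Ω := by
  set A : Set ℝ := {ρ : ℝ | 0 < ρ ∧ ρ ≤ 1 ∧ x + ρ • a ∈ closure Ω} with hA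
  have hbdd : BddAbove A := ⟨1, fun ρ hρ => hρ.2.1⟩
  have hcont : Continuous fun ρ : ℝ => x + ρ • a := by fun_prop
  obtain ⟨ρ, hρ1, hρ2⟩ : ∃ ρ ∈ A, 0 < ρ := by
    have h0 : ∀ᶠ ρ in nhds (0 : ℝ), x + ρ • a ∈ Ω :=
      hcont.continuousAt.eventually (by simpa using ho.mem_nhds hx)
    have h1 : ∀ᶠ ρ in nhdsWithin (0 : ℝ) (Ioi 0), x + ρ • a ∈ Ω := h0.filter_mono nhdsWithin_le_nhds
    obtain ⟨ρ, h2, h3⟩ := (h1.and (Ioc_mem_nhdsGT zero_lt_one)).exists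
    exact ⟨ρ, ⟨h3.1, h3.2, subset_closure h2⟩, h3.1⟩
  refine ⟨hρ2.trans_le (le_csSup hbdd hρ1), csSup_le ⟨ρ, hρ1⟩ fun ρ hρ => hρ.2.1, ?_⟩
  have h1 : stepLength Ω x a ∈ closure A := csSup_mem_closure ⟨ρ, hρ1⟩ hbdd
  have h2 : closure A ⊆ {ρ | x + ρ • a ∈ closure Ω} :=
    closure_minimal (fun ρ hρ => hρ.2.2) (isClosed_closure.preimage hcont)
  exact h2 h1

lemma le_stepLength {x a : Space d} {ρ : ℝ} (h0 : 0 < ρ) (h1 : ρ ≤ 1)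
    (hmem : x + ρ • a ∈ closure Ω) : ρ ≤ stepLength Ω x a :=
  le_csSup ⟨1, fun _ hρ => hρ.2.1⟩ ⟨h0, h1, hmem⟩

lemma stepLength_eq_one_of_mem (ho : IsOpen Ω) {x : Space d} (hx : x ∈ Ω) {a : Space d}
    (hmem : x + stepLength Ω x a • a ∈ Ω) : stepLength Ω x a = 1 := by
  obtain ⟨h0, h1, -⟩ := stepLength_spec ho hx a
  by_contra hne
  have hlt := lt_of_le_of_ne h1 hne
  have hcont : Continuous fun ρ : ℝ => x + ρ • a := by fun_prop
  have h2 : ∀ᶠ ρ in nhdsWithin (stepLength Ω x a) (Ioi (stepLength Ω x a)), x + ρ • a ∈ Ω :=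
    (hcont.continuousAt.eventually (ho.mem_nhds hmem)).filter_mono nhdsWithin_le_nhds
  obtain ⟨ρ, h3, h4⟩ := (h2.and (Ioc_mem_nhdsGT hlt)).exists
  exact absurd (le_stepLength (h0.trans h4.1) h4.2 (subset_closure h3)) (not_le.2 h4.1)

lemma half_le_stepLength_mul_norm {x a : Space d} {h : ℝ} (hh : 0 < h) (ha : h ≤ ‖a‖)
    (hball : Metric.ball x (h / 2) ⊆ Ω) : h / 2 ≤ stepLength Ω x a * ‖a‖ := by
  have ha0 : 0 < ‖a‖ := hh.trans_le ha
  have h1 : h / 2 / ‖a‖ ≤ stepLength Ω x a := by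
    refine le_stepLength (by positivity) ?_ (closure_mono hball ?_)
    · rw [div_le_one ha0]; linarith
    · rw [closure_ball x (by positivity), Metric.mem_closedBall, dist_eq_norm, add_sub_cancel_left,
        norm_smul, Real.norm_of_nonneg (by positivity), div_mul_cancel₀ _ ha0.ne']
  rwa [div_le_iff₀ ha0] at h1

/-- The depth `h / 2` of the node keeps both arms of the difference at least `h / 2` long, so an
`O(h²)` function has bounded second differences even near the boundary. -/
lemma abs_secondDiff_le (ho : IsOpen Ω) {h : ℝ} (hh : 0 < h) {e : Fin d → ℤ} (he : e ≠ 0)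
    {z : Space d} (hball : Metric.ball z (h / 2) ⊆ Ω) {v : Space d → ℝ} {B : ℝ}
    (hv : ∀ x, |v x| ≤ B * h ^ 2) : |secondDiff Ω h e v z| ≤ 16 * B := by
  have hz : z ∈ Ω := hball (Metric.mem_ball_self (by positivity))
  have hB : 0 ≤ B := by
    have h1 := (abs_nonneg _).trans (hv z)
    exact nonneg_of_mul_nonneg_left h1 (by positivity)
  have he1 := one_le_norm_intVec he
  rw [secondDiff]
  set a : Space d := h • intVec e with ha
  have han : ‖a‖ = h * ‖intVec e‖ := by rw [ha, norm_smul, Real.norm_of_nonneg hh.le]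
  have hah : h ≤ ‖a‖ := by rw [han]; exact le_mul_of_one_le_right hh.le he1
  obtain ⟨p1, -, -⟩ := stepLength_spec ho hz a
  obtain ⟨p2, -, -⟩ := stepLength_spec ho hz (-a)
  have g1 := half_le_stepLength_mul_norm hh hah hball
  have g2 := half_le_stepLength_mul_norm (a := -a) hh (by rwa [norm_neg]) hball
  rw [norm_neg] at g2
  set ρ₁ := stepLength Ω z a
  set ρ₂ := stepLength Ω z (-a)
  clear_value ρ₁ ρ₂
  have g3 : h / 2 * (h / 2) ≤ ρ₁ * ‖a‖ * (ρ₂ * ‖a‖) := by gcongr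
  have hden : 0 < ρ₁ * ρ₂ * (ρ₁ + ρ₂) * ‖intVec e‖ ^ 2 * h ^ 2 / 2 := by
    have : 0 < ‖intVec e‖ := by linarith
    positivity
  rw [abs_div, abs_of_pos hden, div_le_iff₀ hden]
  have n1 : |ρ₂ * v (z + ρ₁ • a) - (ρ₁ + ρ₂) * v z + ρ₁ * v (z - ρ₂ • a)| ≤
      2 * (ρ₁ + ρ₂) * (B * h ^ 2) := by
    have k1 := mul_le_mul_of_nonneg_left (hv (z + ρ₁ • a)) p2.le
    have k2 := mul_le_mul_of_nonneg_left (hv z) (show 0 ≤ ρ₁ + ρ₂ by positivity)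
    have k3 := mul_le_mul_of_nonneg_left (hv (z - ρ₂ • a)) p1.le
    have t1 := abs_add_le (ρ₂ * v (z + ρ₁ • a) - (ρ₁ + ρ₂) * v z) (ρ₁ * v (z - ρ₂ • a))
    have t2 := abs_sub (ρ₂ * v (z + ρ₁ • a)) ((ρ₁ + ρ₂) * v z)
    rw [abs_mul, abs_of_pos p2, abs_mul, abs_of_pos (show 0 < ρ₁ + ρ₂ by positivity)] at t2
    rw [abs_mul ρ₁, abs_of_pos p1] at t1
    linarith
  refine n1.trans ?_
  have k : 2 * (ρ₁ + ρ₂) * B * (h ^ 2) ≤ 2 * (ρ₁ + ρ₂) * B * (4 * (ρ₁ * ‖a‖ * (ρ₂ * ‖a‖))) := by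
    gcongr
    linarith
  rw [han] at k
  linarith

lemma secondDiff_neg {h : ℝ} {e : Fin d → ℤ} {v v' : Space d → ℝ} (hv : ∀ x, v' x = -v x)
    (z : Space d) : secondDiff Ω h e v' z = -secondDiff Ω h e v z := by
  simp only [secondDiff, hv]
  rw [← neg_div]
  congr 1
  ring

lemma interp_neg {K : Geometry.SimplicialComplex ℝ (Space d)} {v v' : Space d → ℝ}
    (hv : ∀ x, v' x = -v x) (x : Space d) : interp K v' x = -interp K v x := by
  by_cases hx : x ∈ K.space
  · obtain ⟨s, hs, w, h0, h1, rfl⟩ := exists_weights hx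
    rw [interp_sum hs h0 h1, interp_sum hs h0 h1, ← Finset.sum_neg_distrib]
    exact Finset.sum_congr rfl fun y _ => by rw [hv, mul_neg]
  · rw [interp_of_notMem hx, interp_of_notMem hx, neg_zero]

end

section

variable {lam M σ R₀ : ℝ} {Ω : Set (Space d)} {f u : Space d → ℝ} {G : Space d → Space d}
  {H : Space d → Space d →L[ℝ] Space d} {h : ℝ} {N : NodalSet Ω h}
  {K : Geometry.SimplicialComplex ℝ (Space d)}

/-- A supporting plane of `W + ε u` at `z` bounds the second differences of `W` below. -/
lemma RegularSolution.neg_le_secondDiff (S : RegularSolution lam M Ω f u G H) (hh : 0 < h)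
    {e : Fin d → ℤ} (he : e ≠ 0) {z q : Space d} (hz : z ∈ Ω) {W : Space d → ℝ} {ε : ℝ}
    (hε : 0 ≤ ε)
    (h₁ : ∀ y, y = z + stepLength Ω z (h • intVec e) • (h • intVec e) ∨
      y = z + stepLength Ω z (-(h • intVec e)) • (-(h • intVec e)) →
      W z + ε * u z + inner ℝ q (y - z) ≤ W y + ε * u y) :
    -(M * ε) ≤ secondDiff Ω h e W z := by
  have he1 := one_le_norm_intVec he
  rw [secondDiff]
  set a : Space d := h • intVec e with ha
  have han : ‖a‖ = h * ‖intVec e‖ := by rw [ha, norm_smul, Real.norm_of_nonneg hh.le]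
  obtain ⟨p1, -, c1⟩ := stepLength_spec S.isOpen hz a
  obtain ⟨p2, -, c2⟩ := stepLength_spec S.isOpen hz (-a)
  have g1 := h₁ _ (Or.inl rfl)
  have g2 := h₁ _ (Or.inr rfl)
  have t1 := S.upper z hz _ c1
  have t2 := S.upper z hz _ c2
  set ρ₁ := stepLength Ω z a
  set ρ₂ := stepLength Ω z (-a)
  clear_value ρ₁ ρ₂ a
  rw [smul_neg, ← sub_eq_add_neg] at g2 t2
  rw [add_sub_cancel_left, real_inner_smul_right] at g1 t1
  rw [show z - ρ₂ • a - z = -(ρ₂ • a) by abel, inner_neg_right, real_inner_smul_right] at g2 t2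
  rw [norm_smul, Real.norm_of_nonneg p1.le, han] at t1
  rw [norm_neg, norm_smul, Real.norm_of_nonneg p2.le, han] at t2
  have hden : 0 < ρ₁ * ρ₂ * (ρ₁ + ρ₂) * ‖intVec e‖ ^ 2 * h ^ 2 / 2 := by
    have : 0 < ‖intVec e‖ := by linarith
    positivity
  rw [le_div_iff₀ hden]
  have k1 := mul_le_mul_of_nonneg_left g1 p2.le
  have k2 := mul_le_mul_of_nonneg_left g2 p1.le
  have k3 := mul_le_mul_of_nonneg_left t1 (show 0 ≤ ε * ρ₂ by positivity)
  have k4 := mul_le_mul_of_nonneg_left t2 (show 0 ≤ ε * ρ₁ by positivity)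
  linarith

end

/-! ### Contact points -/

/-- The graph of `w + η² u` touches at the node `z` a plane parallel to the tangent plane of `η² u`
at the point `x` of depth at least `s`, and this plane is not much above the tangent plane. -/
structure IsContact {Ω : Set (Space d)} {h : ℝ} (N : NodalSet Ω h) (u : Space d → ℝ)
    (G : Space d → Space d) (lam A η s : ℝ) (w : Space d → ℝ) (x z : Space d) : Prop where
  deep : Metric.ball x s ⊆ Ω
  mem_inner : z ∈ N.inner
  mem : η ^ 2 • G x ∈ subdiff N (fun y => w y + η ^ 2 * u y) z
  plane : ∀ y ∈ closure Ω, w z + η ^ 2 * u z + inner ℝ (η ^ 2 • G x) (y - z) ≤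
    η ^ 2 * (u y - lam / 2 * ‖y - x‖ ^ 2) + A * h ^ 2

section

variable {lam M c C σ R₀ : ℝ} {Ω : Set (Space d)} {f u : Space d → ℝ} {G : Space d → Space d}
  {H : Space d → Space d →L[ℝ] Space d} {x₀ : Space d} {μ h : ℝ} {N : NodalSet Ω h}
  {K : Geometry.SimplicialComplex ℝ (Space d)}

/-- A plane of slope `η² ∇u(x)` is raised until it touches `w + η² u` at a node `z`. Since `|w| ≤ B
h²` while `η² u` leaves its tangent plane at rate `η² lam / 2`, the contact is within `Q h / η` of
`x`. A node next to `x` bounds the height of the plane. -/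
lemma IsAdmissible.exists_contact (T : IsAdmissible σ R₀ N K)
    (S : RegularSolution lam M Ω f u G H) (hlam : 0 < lam) (hM : 1 ≤ M) {B η Q D s : ℝ}
    {w : Space d → ℝ} (hw : ∀ y ∈ N.nodes, |w y| ≤ B * h ^ 2) (hη : 0 < η) (hη1 : η ≤ 1)
    (hQ : 0 ≤ Q) (hQB : 4 * B + M * d ^ 2 ≤ lam * Q ^ 2) (hD : 1 ≤ D)
    (hs : (d + 1) * h + D * h + Q * h / η ≤ s) {x : Space d} (hx : Metric.ball x s ⊆ Ω) :
    ∃ z, IsContact N u G lam (B + M / 2 * d ^ 2) η s w x z ∧ Metric.ball z (D * h) ⊆ Ω := by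
  have hh := T.pos
  have hdh : (0 : ℝ) ≤ (d + 1) * h := by positivity
  have hDh : 0 < D * h := by positivity
  have hQh : 0 ≤ Q * h / η := by positivity
  have hxΩ : x ∈ Ω := hx (Metric.mem_ball_self (by linarith))
  obtain ⟨y₀, hy₀, hxy₀⟩ := exists_inner_near (N := N) T.domain T.dim hh hx (by linarith)
  obtain ⟨z, hz, hmin⟩ := exists_max_nodes T.dim T.domain N
    (fun y => inner ℝ (η ^ 2 • G x) y - (w y + η ^ 2 * u y))
  have hη2 : η ^ 2 ≤ 1 := pow_le_one₀ hη.le hη1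
  have hplane : ∀ y ∈ closure Ω, w z + η ^ 2 * u z + inner ℝ (η ^ 2 • G x) (y - z) ≤
      η ^ 2 * (u y - lam / 2 * ‖y - x‖ ^ 2) + (B + M / 2 * d ^ 2) * h ^ 2 := by
    intro y hy
    have h1 := hmin y₀ (Or.inl hy₀)
    have h2 := S.upper x hxΩ y₀ (subset_closure (mem_of_mem_inner hy₀))
    have h3 := S.lower x hxΩ y hy
    have h4 := (abs_le.1 (hw y₀ (Or.inl hy₀))).2
    have h5 : M / 2 * ‖y₀ - x‖ ^ 2 ≤ M / 2 * (d * h) ^ 2 := by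
      rw [norm_sub_rev]
      gcongr
    have h6 : η ^ 2 * (u y₀ - u x - inner ℝ (G x) (y₀ - x)) ≤ M / 2 * (d * h) ^ 2 :=
      (mul_le_mul_of_nonneg_left (h2.trans h5) (sq_nonneg η)).trans
        (mul_le_of_le_one_left (by positivity) hη2)
    have h7 := mul_le_mul_of_nonneg_left h3 (sq_nonneg η)
    rw [real_inner_smul_left, real_inner_smul_left] at h1
    rw [inner_sub_right] at h6 h7
    rw [real_inner_smul_left, inner_sub_right]
    linarith
  have hzcl := mem_closure_of_mem_nodes hz
  have hzx : ‖z - x‖ ≤ Q * h / η := by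
    have h1 := hplane z hzcl
    rw [sub_self, inner_zero_right] at h1
    have h2 := (abs_le.1 (hw z hz)).1
    have h3 : (η * ‖z - x‖) ^ 2 * lam ≤ (Q * h) ^ 2 * lam := by
      have := mul_le_mul_of_nonneg_right hQB (sq_nonneg h)
      linarith
    have h4 := le_of_mul_le_mul_right h3 hlam
    rw [le_div_iff₀ hη, mul_comm]
    exact le_of_sq_le_sq h4 (by positivity)
  have hball : Metric.ball z (D * h) ⊆ Ω := by
    refine (ball_subset_ball_of_le ?_).trans hx
    rw [dist_eq_norm]
    linarith
  have hzΩ : z ∈ Ω := hball (Metric.mem_ball_self hDh)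
  refine ⟨z, ⟨hx, mem_inner_of_mem_nodes T.domain.isOpen hz hzΩ, fun y hy => ?_, hplane⟩, hball⟩
  have h1 := hmin y hy
  dsimp only at h1 ⊢
  rw [inner_sub_right]
  linarith

/-- The supporting plane must also lie below the interpolant at the ends of the difference. An end
of depth `h / 2` is a node, where this is the contact property. Any other end is close to the
boundary and therefore at distance at least `s / 2` from the deep point `x`; there the plane is far
below the tangent bound, by at least `(B + A) h²`. -/
lemma IsContact.neg_le_secondDiff {A η s B t : ℝ} {w : Space d → ℝ} {x z : Space d}
    (P : IsContact N u G lam A η s w x z) (T : IsAdmissible σ R₀ N K)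
    (S : RegularSolution lam M Ω f u G H) (hlam : 0 < lam) (hB : 0 ≤ B)
    (hw : ∀ y ∈ N.nodes, |w y| ≤ B * h ^ 2) (hη : 0 < η) (hη1 : η ≤ 1) (ht : 1 ≤ t)
    (hs : t * h / η = s) (htB : B + A ≤ lam / 8 * t ^ 2) {e : Fin d → ℤ} (he : e ≠ 0) :
    -(M * η ^ 2) ≤ secondDiff Ω h e (interp K w) z := by
  have hh := T.pos
  have hz := mem_of_mem_inner P.mem_inner
  have hvert : ∀ y ∈ N.nodes, interp K w y = w y := fun y hy =>
    interp_vertex (T.triangulation.vertices_eq ▸ hy) w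
  have hsh : h ≤ s := by
    rw [← hs, le_div_iff₀ hη]
    nlinarith
  have key : ∀ e' : Fin d → ℤ, ∀ y,
      y = z + stepLength Ω z (h • intVec e') • (h • intVec e') →
      interp K w z + η ^ 2 * u z + inner ℝ (η ^ 2 • G x) (y - z) ≤
        interp K w y + η ^ 2 * u y := by
    intro e' y hy
    obtain ⟨-, -, hycl⟩ := stepLength_spec S.isOpen hz (h • intVec e')
    rw [← hy] at hycl
    rw [hvert z (Or.inl P.mem_inner)]
    by_cases hb : Metric.ball y (h / 2) ⊆ Ω
    · have hyΩ : y ∈ Ω := hb (Metric.mem_ball_self (by positivity))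
      have h1 := stepLength_eq_one_of_mem S.isOpen hz (hy ▸ hyΩ)
      rw [h1, one_smul] at hy
      obtain ⟨-, ⟨k, hk⟩, -⟩ := (mem_inner_iff T.domain T.dim).1 P.mem_inner
      have hyn : y ∈ N.inner := (mem_inner_iff T.domain T.dim).2
        ⟨hyΩ, ⟨k + e', by rw [hy, hk, intVec_add, smul_add, add_assoc]⟩, hb⟩
      rw [hvert y (Or.inl hyn)]
      exact P.mem y (Or.inl hyn)
    · have h1 : s / 2 ≤ ‖y - x‖ := by
        by_contra! hlt
        refine hb ((ball_subset_ball_of_le ?_).trans P.deep)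
        rw [dist_eq_norm]
        linarith
      have h2 := P.plane y hycl
      have h3 := (abs_le.1 (abs_interp_le (K := K) (by positivity)
        (fun y hy => hw y (T.triangulation.vertices_eq ▸ hy)) y)).1
      have h4 : (lam / 8 * t ^ 2) * h ^ 2 ≤ η ^ 2 * (lam / 2 * ‖y - x‖ ^ 2) := by
        calc (lam / 8 * t ^ 2) * h ^ 2 = η ^ 2 * (lam / 2 * (s / 2) ^ 2) := by
              rw [← hs]; field_simp; norm_num
          _ ≤ _ := by
              gcongr
              linarith
      have h5 := mul_le_mul_of_nonneg_right htB (sq_nonneg h)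
      linarith
  refine S.neg_le_secondDiff hh he hz (q := η ^ 2 • G x) (sq_nonneg η) fun y hy => ?_
  rcases hy with hy | hy
  · exact key e y hy
  · refine key (-e) y ?_
    have : h • intVec (-e) = -(h • intVec e) := by
      rw [← smul_neg]
      congr 1
      ext i
      simp [intVec]
    rwa [this]

end

/-! ### The measure of the contact set -/

lemma sub_le_of_pow_mul_le {ε δ i g : ℝ} (hε : 0 < ε) (hδ : 0 ≤ δ) (hi : 0 ≤ i)
    (hle : ε ^ d * i ≤ (ε + δ) ^ d * g) : i - g ≤ d * (δ / ε) * i := by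
  have h1 : 0 < ε + δ := by positivity
  have h2 : 1 + (d : ℝ) * (-(δ / (ε + δ))) ≤ (1 + -(δ / (ε + δ))) ^ d := by
    refine one_add_mul_le_pow ?_ d
    have : δ / (ε + δ) ≤ 1 := by rw [div_le_one h1]; linarith
    linarith
  have h3 : 1 + -(δ / (ε + δ)) = ε / (ε + δ) := by field_simp; ring
  rw [h3, div_pow] at h2
  have h4 : ε ^ d / (ε + δ) ^ d * i ≤ g := by
    rw [div_mul_eq_mul_div, div_le_iff₀ (by positivity), mul_comm g]
    exact hle
  have h5 : δ / (ε + δ) ≤ δ / ε := by gcongr; linarith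
  have h6 := mul_le_mul_of_nonneg_right h2 hi
  have h7 : (d : ℝ) * (δ / (ε + δ)) * i ≤ d * (δ / ε) * i := by gcongr
  linarith

section

variable {lam M c C σ R₀ : ℝ} {Ω : Set (Space d)} {f u : Space d → ℝ} {G : Space d → Space d}
  {H : Space d → Space d →L[ℝ] Space d} {x₀ : Space d} {μ h : ℝ} {N : NodalSet Ω h}
  {K : Geometry.SimplicialComplex ℝ (Space d)}

lemma RegularSolution.injOn (S : RegularSolution lam M Ω f u G H) (hlam : 0 < lam) :
    InjOn G Ω := by
  intro x hx y hy hxy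
  have h1 := S.lower x hx y (subset_closure hy)
  have h2 := S.lower y hy x (subset_closure hx)
  have h3 : inner ℝ (G y) (x - y) = -inner ℝ (G x) (y - x) := by
    rw [hxy, ← inner_neg_right, neg_sub]
  rw [h3, norm_sub_rev] at h2
  have h4 : ‖y - x‖ ^ 2 ≤ 0 := by
    have : lam * ‖y - x‖ ^ 2 ≤ lam * 0 := by linarith
    exact le_of_mul_le_mul_left this hlam
  have h5 : ‖y - x‖ = 0 := (pow_eq_zero_iff two_ne_zero).1 (le_antisymm h4 (by positivity))
  exact (sub_eq_zero.1 (norm_eq_zero.1 h5)).symm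

/-- Area formula: the gradient map is injective with Jacobian `det H = f`. -/
lemma RegularSolution.volume_image_grad (S : RegularSolution lam M Ω f u G H) (hlam : 0 < lam)
    {A : Set (Space d)} (hA : MeasurableSet A) (hAΩ : A ⊆ Ω) :
    volume (G '' A) = ∫⁻ x in A, ENNReal.ofReal (f x) := by
  rw [← lintegral_abs_det_fderiv_eq_addHaar_image volume hA
    (fun x hx => (S.grad x (hAΩ hx)).hasFDerivWithinAt) ((S.injOn hlam).mono hAΩ)]
  refine setLIntegral_congr_fun hA fun x hx => ?_
  rw [← S.det_eq x (hAΩ hx), abs_of_pos (S.f_pos hlam (hAΩ hx))]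

open Classical in
-- The slopes `η² G x` from the inset all lie in subdifferentials at deep contact nodes. Comparing
-- measures gives `η^(2d) ∫ f ≤ (η² + γ h²)^d ∑ f_z` over these nodes. The total mass of weights is
-- at most the integral of `f`, so the rest carries at most the boundary layer plus a relative loss
-- of order `h² / η²`.
lemma IsAdmissible.sum_noncontact_le (T : IsAdmissible σ R₀ N K)
    (S : RegularSolution lam M Ω f u G H) (R : IsRound c C Ω u G x₀ μ) (hlam : 0 < lam)
    (hM : 1 ≤ M) (hc : 0 < c) (hC : 1 ≤ C) {A D η s γ : ℝ} {w : Space d → ℝ} (hη : 0 < η)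
    (hs : 0 < s) (hγ : 0 ≤ γ)
    (hvol : ∀ z ∈ N.inner, Metric.ball z (D * h) ⊆ Ω →
      volume (subdiff N (fun y => w y + η ^ 2 * u y) z) ≤
        ENNReal.ofReal (weight Ω f K z * (η ^ 2 + γ * h ^ 2) ^ d))
    (hcontact : ∀ x, Metric.ball x s ⊆ Ω →
      ∃ z, IsContact N u G lam A η s w x z ∧ Metric.ball z (D * h) ⊆ Ω) :
    ∑ z ∈ N.inner with ¬∃ x, IsContact N u G lam A η s w x z, weight Ω f K z ≤
      M * (layerConst d c C * s) +
        d * (γ * h ^ 2 / η ^ 2) * (M * (layerConst d c C * μ)) := by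
  have hμ := R.pos
  have hvolΩ := R.volume_le T.dim hc hC
  have hins : inset Ω s ⊆ Ω := inset_subset hs
  have hmeas := measurableSet_inset Ω s
  set good : Finset (Space d) := N.inner.filter (fun z => (∃ x, IsContact N u G lam A η s w x z) ∧
    Metric.ball z (D * h) ⊆ Ω) with hgood
  have hw0 := fun z => weight_nonneg (K := K) S hlam z
  have hL0 : 0 ≤ layerConst d c C := by
    have := ballVol_nonneg (d := d) 1
    rw [layerConst]
    positivity
  have hIfin : ∫⁻ x in inset Ω s, ENNReal.ofReal (f x) ≤
      ENNReal.ofReal (M * (layerConst d c C * μ)) := by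
    refine (lintegral_f_le S hmeas hins).trans ?_
    rw [ENNReal.ofReal_mul (by positivity)]
    gcongr
    exact (measure_mono hins).trans hvolΩ
  obtain ⟨i, hi0, hi⟩ : ∃ i : ℝ, 0 ≤ i ∧
      ∫⁻ x in inset Ω s, ENNReal.ofReal (f x) = ENNReal.ofReal i :=
    ⟨_, ENNReal.toReal_nonneg, (ENNReal.ofReal_toReal (ne_top_of_le_ne_top ENNReal.ofReal_ne_top
      hIfin)).symm⟩
  rw [hi, ENNReal.ofReal_le_ofReal_iff (by positivity)] at hIfin
  have h1 : (η ^ 2) ^ d * i ≤ (η ^ 2 + γ * h ^ 2) ^ d * ∑ z ∈ good, weight Ω f K z := by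
    have hsub : η ^ 2 • (G '' inset Ω s) ⊆
        ⋃ z ∈ good, subdiff N (fun y => w y + η ^ 2 * u y) z := by
      rintro _ ⟨_, ⟨x, hx, rfl⟩, rfl⟩
      obtain ⟨z, hz, hzb⟩ := hcontact x hx
      exact mem_iUnion₂.2 ⟨z, Finset.mem_filter.2 ⟨hz.mem_inner, ⟨x, hz⟩, hzb⟩, hz.mem⟩
    have h2 := (measure_mono (μ := volume) hsub).trans (measure_biUnion_finset_le _ _)
    rw [volume_smul_set _ (sq_nonneg η), S.volume_image_grad hlam hmeas hins, hi,
      ← ENNReal.ofReal_mul (by positivity)] at h2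
    have h3 := h2.trans (Finset.sum_le_sum fun z hz =>
      hvol z (Finset.mem_filter.1 hz).1 (Finset.mem_filter.1 hz).2.2)
    rw [← ENNReal.ofReal_sum_of_nonneg fun z _ => mul_nonneg (hw0 z) (by positivity),
      ← Finset.sum_mul, ENNReal.ofReal_le_ofReal_iff (mul_nonneg (Finset.sum_nonneg fun z _ => hw0 z)
        (by positivity)), mul_comm (∑ z ∈ good, _)] at h3
    exact h3
  have h2 := sub_le_of_pow_mul_le (by positivity) (by positivity) hi0 h1
  have h3 : ∑ z ∈ N.inner, weight Ω f K z ≤ i + M * (layerConst d c C * s) := by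
    have h4 := T.sum_weight_le S hlam
    rw [← lintegral_inter_add_sdiff (fun x => ENNReal.ofReal (f x)) Ω hmeas,
      inter_eq_self_of_subset_right hins, hi] at h4
    have h5 := lintegral_f_le S (S.isOpen.measurableSet.diff hmeas) (sdiff_subset (t := inset Ω s))
    have h6 := R.volume_diff_inset_le S.convex T.dim hc hC hs
    have h7 := h4.trans (add_le_add le_rfl (h5.trans (mul_le_mul_right h6 _)))
    rw [← ENNReal.ofReal_mul (by positivity), ← ENNReal.ofReal_add hi0 (by positivity),
      ← ENNReal.ofReal_sum_of_nonneg fun z _ => hw0 z,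
      ENNReal.ofReal_le_ofReal_iff (by positivity)] at h7
    exact h7
  have h4 : ∑ z ∈ N.inner with ¬∃ x, IsContact N u G lam A η s w x z, weight Ω f K z +
      ∑ z ∈ good, weight Ω f K z ≤ ∑ z ∈ N.inner, weight Ω f K z := by
    rw [← Finset.sum_union]
    · exact Finset.sum_le_sum_of_subset_of_nonneg (Finset.union_subset (Finset.filter_subset _ _)
        (Finset.filter_subset _ _)) fun z _ _ => hw0 z
    · rw [Finset.disjoint_left]
      intro z hz hz'
      exact (Finset.mem_filter.1 hz).2 (Finset.mem_filter.1 hz').2.1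
  have h5 : d * (γ * h ^ 2 / η ^ 2) * i ≤
      d * (γ * h ^ 2 / η ^ 2) * (M * (layerConst d c C * μ)) := by gcongr
  linarith

end

/-! ### Summation over dyadic levels -/

open Classical in
-- Either the finest level is good, or its own term in the sum dominates: at the first level it pays
-- for the trivial bound `T`, and at later levels it absorbs the factor four between consecutive
-- squares.
lemma le_dyadic_sum {g m T : ℝ} (hm : 0 ≤ m) (hT : 0 ≤ T) (hgT : g ≤ T) (bad : ℕ → Prop) (n : ℕ)
    (hgood : ∀ j ≤ n, ¬bad j → g ≤ m * ((1 / 2 : ℝ) ^ (j + 1)) ^ 2) :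
    g ≤ m * ((1 / 2 : ℝ) ^ (n + 1)) ^ 2 + 4 * (T + m) *
      ∑ j ∈ Finset.range (n + 1), if bad j then ((1 / 2 : ℝ) ^ (j + 1)) ^ 2 else 0 := by
  induction n with
  | zero =>
    rw [zero_add, Finset.sum_range_one]
    split_ifs with hb
    · norm_num
      linarith
    · have := hgood 0 le_rfl hb
      rw [zero_add] at this
      linarith
  | succ n ih =>
    have h1 := ih fun j hj => hgood j (hj.trans n.le_succ)
    have h0 : 0 ≤ ∑ j ∈ Finset.range (n + 1), if bad j then ((1 / 2 : ℝ) ^ (j + 1)) ^ 2 else 0 :=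
      Finset.sum_nonneg fun j _ => by split_ifs <;> positivity
    rw [Finset.sum_range_succ]
    have h2 : (1 / 2 : ℝ) ^ (n + 1) = 2 * (1 / 2 : ℝ) ^ (n + 1 + 1) := by
      rw [pow_succ _ (n + 1)]; ring
    split_ifs with hb
    · rw [h2] at h1
      have h3 : 0 ≤ T * ((1 / 2 : ℝ) ^ (n + 1 + 1)) ^ 2 := by positivity
      have h4 : 0 ≤ m * ((1 / 2 : ℝ) ^ (n + 1 + 1)) ^ 2 := by positivity
      linarith
    · have h3 := hgood (n + 1) le_rfl hb
      have h4 : 0 ≤ 4 * (T + m) * ∑ j ∈ Finset.range (n + 1),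
        if bad j then ((1 / 2 : ℝ) ^ (j + 1)) ^ 2 else 0 := mul_nonneg (by positivity) h0
      linarith

open Classical in
-- A level `η` costs `η²` on a bad set of mass `O(h / η)`, hence `O(η h)`. The levels form a
-- geometric series, so no logarithm appears.
lemma sum_mul_le_of_dyadic {ι : Type*} (s : Finset ι) {f g : ι → ℝ} (hf : ∀ z, 0 ≤ f z)
    {m T F b h : ℝ} (hm : 0 ≤ m) (hT : 0 ≤ T) (hb : 0 ≤ b) (hgT : ∀ z ∈ s, g z ≤ T)
    (hF : ∑ z ∈ s, f z ≤ F) (hh : 0 < h) (hh2 : h ≤ 1 / 2) (bad : ℝ → ι → Prop)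
    (hgood : ∀ η, h ≤ η → η ≤ 1 / 2 → ∀ z ∈ s, ¬bad η z → g z ≤ m * η ^ 2)
    (hbad : ∀ η, h ≤ η → η ≤ 1 / 2 → ∑ z ∈ s with bad η z, f z ≤ b * (h / η)) :
    ∑ z ∈ s, f z * g z ≤ (2 * m * F + 4 * (T + m) * b) * h := by
  -- The finest level is the last power of `1/2` that is at least `h`; it is below `2 h`, so its
  -- square is `O(h)`.
  obtain ⟨n', hn1, hn2⟩ := exists_nat_pow_near_of_lt_one hh (by linarith)
    (show (0 : ℝ) < 1 / 2 by norm_num) (by norm_num)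
  obtain ⟨n, rfl⟩ : ∃ n, n' = n + 1 := by
    refine Nat.exists_eq_succ_of_ne_zero ?_
    rintro rfl
    norm_num at hn1
    linarith
  have hη : ∀ j ≤ n, h ≤ (1 / 2 : ℝ) ^ (j + 1) ∧ (1 / 2 : ℝ) ^ (j + 1) ≤ 1 / 2 := fun j hj =>
    ⟨hn2.trans (pow_le_pow_of_le_one (by norm_num) (by norm_num) (by omega)),
      pow_le_of_le_one (by norm_num) (by norm_num) (by omega)⟩
  have hF0 : 0 ≤ F := (Finset.sum_nonneg fun z _ => hf z).trans hF
  have h1 : ∀ z ∈ s, f z * g z ≤ m * ((1 / 2 : ℝ) ^ (n + 1)) ^ 2 * f z + 4 * (T + m) *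
      ∑ j ∈ Finset.range (n + 1),
        ((1 / 2 : ℝ) ^ (j + 1)) ^ 2 * (if bad ((1 / 2 : ℝ) ^ (j + 1)) z then f z else 0) := by
    intro z hz
    have h2 := le_dyadic_sum hm hT (hgT z hz) (fun j => bad ((1 / 2 : ℝ) ^ (j + 1)) z) n
      (fun j hj => hgood _ (hη j hj).1 (hη j hj).2 z hz)
    have h3 := mul_le_mul_of_nonneg_left h2 (hf z)
    refine h3.trans (le_of_eq ?_)
    rw [mul_add, mul_left_comm (f z) (4 * (T + m)), Finset.mul_sum]
    congr 1
    · ring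
    · congr 1
      refine Finset.sum_congr rfl fun j _ => ?_
      split_ifs <;> ring
  have h2 := Finset.sum_le_sum h1
  rw [Finset.sum_add_distrib, ← Finset.mul_sum, ← Finset.mul_sum, Finset.sum_comm] at h2
  refine h2.trans ?_
  have h3 : ∑ j ∈ Finset.range (n + 1), ∑ z ∈ s,
      ((1 / 2 : ℝ) ^ (j + 1)) ^ 2 * (if bad ((1 / 2 : ℝ) ^ (j + 1)) z then f z else 0) ≤ b * h := by
    have h4 : ∀ j ∈ Finset.range (n + 1), ∑ z ∈ s,
        ((1 / 2 : ℝ) ^ (j + 1)) ^ 2 * (if bad ((1 / 2 : ℝ) ^ (j + 1)) z then f z else 0) ≤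
        b * h * (1 / 2 : ℝ) ^ (j + 1) := by
      intro j hj
      have hj' := hη j (Nat.lt_succ_iff.1 (Finset.mem_range.1 hj))
      rw [← Finset.mul_sum, ← Finset.sum_filter]
      have h5 := hbad _ hj'.1 hj'.2
      have hpos : (0 : ℝ) < (1 / 2 : ℝ) ^ (j + 1) := by positivity
      generalize (1 / 2 : ℝ) ^ (j + 1) = η at h5 hpos ⊢
      calc η ^ 2 * ∑ z ∈ s with bad η z, f z ≤ η ^ 2 * (b * (h / η)) := by gcongr
        _ = _ := by field_simp
    refine (Finset.sum_le_sum h4).trans ?_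
    rw [← Finset.mul_sum]
    refine mul_le_of_le_one_right (by positivity) ?_
    have h5 : ∀ k : ℕ, ∑ j ∈ Finset.range k, (1 / 2 : ℝ) ^ (j + 1) = 1 - (1 / 2) ^ k := by
      intro k
      induction k with
      | zero => simp
      | succ k ih => rw [Finset.sum_range_succ, ih]; ring
    rw [h5]
    have : (0 : ℝ) ≤ (1 / 2) ^ (n + 1) := by positivity
    linarith
  have h4 : ((1 / 2 : ℝ) ^ (n + 1)) ^ 2 ≤ 2 * h := by
    rw [pow_succ (1 / 2 : ℝ) (n + 1)] at hn1
    have hp : (0 : ℝ) ≤ (1 / 2) ^ (n + 1) := by positivity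
    have hp1 : (1 / 2 : ℝ) ^ (n + 1) ≤ 1 := (hη n le_rfl).2.trans (by norm_num)
    nlinarith
  have h5 : m * ((1 / 2 : ℝ) ^ (n + 1)) ^ 2 * ∑ z ∈ s, f z ≤ m * (2 * h) * F := by
    gcongr
    exact Finset.sum_nonneg fun z _ => hf z
  have h6 := mul_le_mul_of_nonneg_left h3 (show 0 ≤ 4 * (T + m) by positivity)
  linarith

lemma sum_filter_le_add {ι : Type*} (s : Finset ι) {f : ι → ℝ} (hf : ∀ z, 0 ≤ f z)
    {p q r : ι → Prop} {_ : DecidablePred p} {_ : DecidablePred q} {_ : DecidablePred r}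
    (hr : ∀ z, r z → p z ∨ q z) :
    ∑ z ∈ s with r z, f z ≤ ∑ z ∈ s with p z, f z + ∑ z ∈ s with q z, f z := by
  simp only [Finset.sum_filter]
  rw [← Finset.sum_add_distrib]
  refine Finset.sum_le_sum fun z _ => ?_
  have h1 := hf z
  have h2 := hr z
  split_ifs <;> first | linarith | tauto

lemma layerConst_nonneg {c C : ℝ} (hc : 0 < c) (hC : 1 ≤ C) : 0 ≤ layerConst d c C := by
  have := ballVol_nonneg (d := d) 1
  rw [layerConst]
  positivity

lemma Config.sum_weight_le {lam M c C σ R₀ : ℝ} {Ω : Set (Space d)} {f u : Space d → ℝ}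
    {G : Space d → Space d} {H : Space d → Space d →L[ℝ] Space d} {x₀ : Space d} {μ h : ℝ}
    {N : NodalSet Ω h} {K : Geometry.SimplicialComplex ℝ (Space d)} {uh : Space d → ℝ}
    (F : Config lam M c C σ R₀ Ω f u G H x₀ μ h N K uh) (hlam : 0 < lam) (hM : 1 ≤ M) (hc : 0 < c)
    (hC : 1 ≤ C) : ∑ z ∈ N.inner, weight Ω f K z ≤ M * (layerConst d c C * C) := by
  have hL := layerConst_nonneg (d := d) hc hC
  have hμ := F.round.pos
  have h1 := (F.admissible.sum_weight_le F.regular hlam).trans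
    ((lintegral_f_le F.regular F.regular.isOpen.measurableSet subset_rfl).trans
      (mul_le_mul_right (F.round.volume_le F.admissible.dim hc hC) _))
  rw [← ENNReal.ofReal_mul (by positivity),
    ← ENNReal.ofReal_sum_of_nonneg fun z _ => weight_nonneg F.regular hlam z,
    ENNReal.ofReal_le_ofReal_iff (by positivity)] at h1
  refine h1.trans ?_
  gcongr
  exact F.round.le

/-- Contact sets of `u - uh` and `uh - u` at level `η` bound the second difference from both sides
by `M η²`, outside nodes of mass `O(h / η)`; the dyadic summation concludes. -/
theorem exists_sum_secondDiff_bound {lam M c C σ R₀ : ℝ} (hd : 1 ≤ d) (hlam : 0 < lam)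
    (hM : 1 ≤ M) (hc : 0 < c) (hC : 1 ≤ C) : ∃ T B : ℝ, 0 < T ∧ 0 ≤ B ∧
    ∀ (Ω : Set (Space d)) (f u : Space d → ℝ) (G : Space d → Space d)
      (H : Space d → Space d →L[ℝ] Space d) (x₀ : Space d) (μ h : ℝ) (N : NodalSet Ω h)
      (K : Geometry.SimplicialComplex ℝ (Space d)) (uh : Space d → ℝ),
      Config lam M c C σ R₀ Ω f u G H x₀ μ h N K uh → h ≤ 1 / 2 → ∀ e : Fin d → ℤ, e ≠ 0 →
      (∀ z ∈ N.inner, |secondDiff Ω h e (interp K fun x => u x - uh x) z| ≤ T) ∧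
      ∑ z ∈ N.inner, weight Ω f K z * |secondDiff Ω h e (interp K fun x => u x - uh x) z| ≤
        B * h := by
  classical
  obtain ⟨B, hB, hmax⟩ := exists_maxNorm_bound (d := d) (σ := σ) (R₀ := R₀) hd hlam hM hc hC
  obtain ⟨D, γ, t₁, hD, hγ, ht₁, ht₁1, hpert⟩ :=
    exists_perturbation_volume (d := d) (σ := σ) (R₀ := R₀) hlam hM
  have hL := layerConst_nonneg (d := d) hc hC
  set l := layerConst d c C with hl
  set A : ℝ := B + M / 2 * d ^ 2 with hA
  have hA0 : 0 < A := by positivity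
  set Q : ℝ := 1 + (4 * B + M * d ^ 2) / lam with hQ
  have hQ1 : 1 ≤ Q := le_add_of_nonneg_right (by positivity)
  have hQB : 4 * B + M * d ^ 2 ≤ lam * Q ^ 2 := by
    have h1 : lam * Q = lam + (4 * B + M * d ^ 2) := by rw [hQ]; field_simp
    have h2 : lam * Q ≤ lam * Q ^ 2 := by gcongr; exact le_self_pow₀ hQ1 two_ne_zero
    linarith
  -- The depth `t h / η` of the slopes leaves room for the displacement to the contact node and its
  -- required depth; the last term is for the boundary ends of the second difference.
  set t : ℝ := d + 1 + D + Q + 8 * (B + A) / lam with ht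
  have ht8 : 0 ≤ 8 * (B + A) / lam := by positivity
  have hd0 : (0 : ℝ) ≤ d := Nat.cast_nonneg d
  have ht1 : 1 ≤ t := by linarith
  have htB : B + A ≤ lam / 8 * t ^ 2 := by
    have h1 : lam / 8 * (8 * (B + A) / lam) = B + A := by field_simp
    have h2 : lam / 8 * (8 * (B + A) / lam) ≤ lam / 8 * t := by gcongr; linarith
    have h3 : lam / 8 * t ≤ lam / 8 * t ^ 2 := by gcongr; exact le_self_pow₀ ht1 two_ne_zero
    linarith
  have htQ : d + 1 + D + Q ≤ t := by linarith
  clear_value Q t l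
  set b : ℝ := M * (l * t) + d * γ * (M * (l * C)) with hb
  have hb0 : 0 ≤ b := by positivity
  set S : ℝ := M * (l * C) with hS
  refine ⟨16 * B, 2 * M * S + 4 * (16 * B + M) * (2 * b) + 16 * B * S / t₁, by positivity,
    by positivity, ?_⟩
  intro Ω f u G H x₀ μ h N K uh F hh2 e he
  have T := F.admissible
  have hh := T.pos
  have hw0 := fun z => weight_nonneg (K := K) F.regular hlam z
  have hw₁ : ∀ y ∈ N.nodes, |u y - uh y| ≤ B * h ^ 2 := hmax Ω f u G H x₀ μ h N K uh F
  have hw₂ : ∀ y ∈ N.nodes, |uh y - u y| ≤ B * h ^ 2 := fun y hy => by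
    rw [abs_sub_comm]; exact hw₁ y hy
  have hsum : ∑ z ∈ N.inner, weight Ω f K z ≤ S := by
    rw [hS, hl]; exact F.sum_weight_le hlam hM hc hC
  have hT : ∀ z ∈ N.inner, |secondDiff Ω h e (interp K fun x => u x - uh x) z| ≤ 16 * B :=
    fun z hz => abs_secondDiff_le T.domain.isOpen hh he ((mem_inner_iff T.domain hd).1 hz).2.2
      fun x => abs_interp_le (by positivity) (fun y hy => hw₁ y (T.triangulation.vertices_eq ▸ hy)) x
  refine ⟨hT, ?_⟩
  have e1 : 0 ≤ (2 * M * S + 4 * (16 * B + M) * (2 * b)) * h := by positivity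
  rcases le_or_gt h t₁ with hht | hht
  swap
  -- For `h > t₁` the uniform bound already gives `O(1) = O(h)`.
  · have h1 : ∑ z ∈ N.inner, weight Ω f K z *
        |secondDiff Ω h e (interp K fun x => u x - uh x) z| ≤ S * (16 * B) := by
      refine (Finset.sum_le_sum fun z hz => mul_le_mul_of_nonneg_left (hT z hz) (hw0 z)).trans ?_
      rw [← Finset.sum_mul]
      gcongr
    have h2 : 16 * B * S ≤ 16 * B * S / t₁ * h := by
      rw [div_mul_eq_mul_div, le_div_iff₀ ht₁]
      gcongr
    linarith
  have hpert' := hpert Ω f u G H h N K uh F.regular T F.op hht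
  have hcon : ∀ w : Space d → ℝ, (∀ y ∈ N.nodes, |w y| ≤ B * h ^ 2) → (∀ z ∈ N.inner,
      Metric.ball z (D * h) ⊆ Ω → ∀ ε : ℝ, 0 < ε → ε ≤ 1 / 2 →
      volume (subdiff N (fun y => w y + ε * u y) z) ≤
        ENNReal.ofReal (weight Ω f K z * (ε + γ * h ^ 2) ^ d)) →
      ∀ η, h ≤ η → η ≤ 1 / 2 →
      ∑ z ∈ N.inner with ¬∃ x, IsContact N u G lam A η (t * h / η) w x z, weight Ω f K z ≤
        b * (h / η) := by
    intro w hw hvol η hη hη2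
    have hη0 : 0 < η := hh.trans_le hη
    have hη2' : η ^ 2 ≤ 1 / 2 := by nlinarith
    have h1 := T.sum_noncontact_le F.regular F.round hlam hM hc hC (A := A) (D := D) (η := η)
      (s := t * h / η) (γ := γ) (w := w) hη0 (by positivity) hγ.le
      (fun z hz hzb => hvol z hz hzb (η ^ 2) (by positivity) hη2')
      (fun x hx => T.exists_contact F.regular hlam hM hw hη0 (by linarith) (by linarith) hQB hD
        (by
          rw [le_div_iff₀ hη0, add_mul, div_mul_cancel₀ _ hη0.ne']
          have k1 : ((d + 1) * h + D * h) * η ≤ ((d + 1) * h + D * h) * 1 := by gcongr; linarith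
          have k2 : (d + 1 + D + Q) * h ≤ t * h := by gcongr
          linarith) hx)
    refine h1.trans ?_
    rw [← hl]
    have hr : h / η ≤ 1 := by rw [div_le_one hη0]; exact hη
    have hμC := F.round.le
    have hμ := F.round.pos
    have h2 : d * (γ * h ^ 2 / η ^ 2) * (M * (l * μ)) ≤ d * γ * (M * (l * C)) * (h / η) := by
      calc d * (γ * h ^ 2 / η ^ 2) * (M * (l * μ)) =
            d * γ * (M * (l * μ)) * ((h / η) * (h / η)) := by field_simp
        _ ≤ d * γ * (M * (l * C)) * ((h / η) * 1) := by gcongr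
        _ = _ := by ring
    have h3 : M * (l * (t * h / η)) = M * (l * t) * (h / η) := by ring
    rw [h3, hb]
    linarith
  have hc₁ := hcon _ hw₁ fun z hz hzb ε hε hε2 => (hpert' z hz hzb ε hε hε2).2
  have hc₂ := hcon _ hw₂ fun z hz hzb ε hε hε2 => (hpert' z hz hzb ε hε hε2).1
  have key := sum_mul_le_of_dyadic N.inner (f := weight Ω f K)
    (g := fun z => |secondDiff Ω h e (interp K fun x => u x - uh x) z|) hw0 (m := M)
    (T := 16 * B) (b := 2 * b) (by linarith) (by positivity) (by positivity) hT hsum hh hh2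
    (fun η z => (¬∃ x, IsContact N u G lam A η (t * h / η) (fun y => u y - uh y) x z) ∨
      ¬∃ x, IsContact N u G lam A η (t * h / η) (fun y => uh y - u y) x z)
    (fun η hη hη2 z hz hgood => by
      rw [not_or, not_not, not_not] at hgood
      obtain ⟨⟨x, hx⟩, ⟨x', hx'⟩⟩ := hgood
      have hη0 : 0 < η := hh.trans_le hη
      have h1 := hx.neg_le_secondDiff T F.regular hlam hB.le hw₁ hη0 (by linarith) ht1 rfl htB he
      have h2 := hx'.neg_le_secondDiff T F.regular hlam hB.le hw₂ hη0 (by linarith) ht1 rfl htB he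
      rw [secondDiff_neg (interp_neg (K := K) (v := fun x => u x - uh x)
        fun x => (neg_sub _ _).symm)] at h2
      rw [abs_le]
      constructor <;> linarith)
    (fun η hη hη2 => by
      refine (sum_filter_le_add N.inner hw0 fun z hz => hz).trans
        ((add_le_add (hc₁ η hη hη2) (hc₂ η hη hη2)).trans (le_of_eq ?_))
      ring)
  have e2 : 0 ≤ 16 * B * S / t₁ * h := by positivity
  linarith

/-! ### The rate in the discrete Sobolev norm -/

/-- Interpolation between the weighted sum and the uniform bound: `(g / T) ^ p ≤ g / T`. -/
lemma rpow_sum_le {ι : Type*} (s : Finset ι) {f g : ι → ℝ} (hf : ∀ z, 0 ≤ f z) (hg : ∀ z, 0 ≤ g z)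
    {p T b h : ℝ} (hp : 1 ≤ p) (hT : 0 < T) (hb : 0 ≤ b) (hh : 0 ≤ h) (hgT : ∀ z ∈ s, g z ≤ T)
    (hsum : ∑ z ∈ s, f z * g z ≤ b * h) :
    (∑ z ∈ s, f z * g z ^ p) ^ (1 / p) ≤ (T ^ p * (b / T)) ^ (1 / p) * h ^ (1 / p) := by
  rw [← Real.mul_rpow (by positivity) hh]
  refine Real.rpow_le_rpow (Finset.sum_nonneg fun z _ =>
    mul_nonneg (hf z) (Real.rpow_nonneg (hg z) p)) ?_ (by positivity)
  have h1 : ∀ z ∈ s, f z * g z ^ p ≤ T ^ p / T * (f z * g z) := fun z hz => by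
    have h2 : (g z / T) ^ p ≤ g z / T := Real.rpow_le_self_of_le_one (div_nonneg (hg z) hT.le)
      ((div_le_one hT).2 (hgT z hz)) hp
    rw [Real.div_rpow (hg z) hT.le, div_le_iff₀ (by positivity)] at h2
    have h3 := mul_le_mul_of_nonneg_left h2 (hf z)
    calc f z * g z ^ p ≤ f z * (g z / T * T ^ p) := h3
      _ = _ := by ring
  refine (Finset.sum_le_sum h1).trans ?_
  rw [← Finset.mul_sum]
  calc T ^ p / T * ∑ z ∈ s, f z * g z ≤ T ^ p / T * (b * h) := by gcongr
    _ = _ := by ring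

/-- For `p ≤ d` the exponent `1 / p` is at least `1 / d`, and `log (1 / h) ≥ log 2` lets the
logarithm be inserted at the price of a constant. -/
lemma rpow_le_rate (hd : 1 ≤ d) {p h : ℝ} (hp : 1 ≤ p) (hh : 0 < h) (hh2 : h ≤ 1 / 2) :
    h ^ (1 / p) ≤ (1 + (Real.log 2 ^ (1 / (d : ℝ)))⁻¹) * (if (d : ℝ) < p then h ^ (1 / p)
      else h ^ (1 / (d : ℝ)) * Real.log (1 / h) ^ (1 / (d : ℝ))) := by
  have hlog : 0 < Real.log 2 := Real.log_pos one_lt_two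
  have hL : 0 < Real.log 2 ^ (1 / (d : ℝ)) := Real.rpow_pos_of_pos hlog _
  split_ifs with hdp
  · exact le_mul_of_one_le_left (by positivity) (le_add_of_nonneg_right (by positivity))
  · have h1 : h ^ (1 / p) ≤ h ^ (1 / (d : ℝ)) :=
      Real.rpow_le_rpow_of_exponent_ge hh (by linarith)
        (one_div_le_one_div_of_le (by linarith) (not_lt.1 hdp))
    have h2 : Real.log 2 ^ (1 / (d : ℝ)) ≤ Real.log (1 / h) ^ (1 / (d : ℝ)) := by
      refine Real.rpow_le_rpow hlog.le (Real.log_le_log two_pos ?_) (by positivity)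
      rw [le_div_iff₀ hh]
      linarith
    have h3 : 0 ≤ h ^ (1 / (d : ℝ)) := by positivity
    generalize Real.log 2 ^ (1 / (d : ℝ)) = l at *
    generalize Real.log (1 / h) ^ (1 / (d : ℝ)) = l' at *
    generalize h ^ (1 / (d : ℝ)) = a at *
    have h4 : 1 ≤ l⁻¹ * l' := by rw [inv_mul_eq_div, one_le_div hL]; exact h2
    have h5 : 0 ≤ a * l' := mul_nonneg h3 (hL.le.trans h2)
    have h6 := mul_le_mul_of_nonneg_left h4 h3
    linarith

end OlikerPrussner
end

theorem mainTheorem1 (d : ℕ) (hd : 1 ≤ d) (p : ℝ) (hp : 1 ≤ p) (lam Lam M σ R₀ : ℝ)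
    (hlam : 0 < lam) :
    ∃ C : ℝ, ∀ (Ω : Set (OlikerPrussner.Space d)) (f u : OlikerPrussner.Space d → ℝ),
      OlikerPrussner.IsUniformlyConvexDomain Ω →
      ContinuousOn f (closure Ω) →
      (∃ c : ℝ, 0 < c ∧ ∀ x ∈ closure Ω, c ≤ f x) →
      OlikerPrussner.IsConvexSolution Ω f u →
      OlikerPrussner.IsC31 Ω u →
      OlikerPrussner.c31Norm Ω u ≤ ENNReal.ofReal M →
      (∀ x ∈ Ω, (OlikerPrussner.hessian u x - lam • (1 : Matrix (Fin d) (Fin d) ℝ)).PosSemidef ∧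
        (Lam • (1 : Matrix (Fin d) (Fin d) ℝ) - OlikerPrussner.hessian u x).PosSemidef) →
      ∀ (h : ℝ), 0 < h → h ≤ 1 / 2 →
      ∀ (N : OlikerPrussner.NodalSet Ω h)
        (K : Geometry.SimplicialComplex ℝ (OlikerPrussner.Space d)),
        OlikerPrussner.IsTriangulation N K →
        OlikerPrussner.IsShapeRegular σ K →
        OlikerPrussner.IsTranslationInvariant N R₀ K →
      ∀ uh : OlikerPrussner.Space d → ℝ, OlikerPrussner.IsOPSolution N K f uh →
      ∀ e : Fin d → ℤ, e ≠ 0 →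
        OlikerPrussner.w2pNorm N K f p e (fun x => u x - uh x) ≤
          C * (if (d : ℝ) < p then h ^ (1 / p)
            else h ^ (1 / (d : ℝ)) * Real.log (1 / h) ^ (1 / (d : ℝ))) := by
  obtain ⟨M', hM', hreg⟩ := OlikerPrussner.exists_regularSolution d (M₀ := M) hlam
  obtain ⟨c, C, hc, hC, hround⟩ := OlikerPrussner.exists_isRound hd hlam hM'
  obtain ⟨T, B, hT, hB, hmain⟩ := OlikerPrussner.exists_sum_secondDiff_bound (σ := σ) (R₀ := R₀)
    hd hlam hM' hc hC
  refine ⟨(T ^ p * (B / T)) ^ (1 / p) * (1 + (Real.log 2 ^ (1 / (d : ℝ)))⁻¹), ?_⟩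
  intro Ω f u hΩ hf _ hsol hC31 hnorm hhess h hh hh2 N K hK hσ hinv uh hop e he
  obtain ⟨G, H, S⟩ := hreg Ω f u hΩ hf hsol hC31 hnorm fun x hx => (hhess x hx).1
  obtain ⟨x₀, hx₀, μ, R⟩ := hround Ω f u G H S
  obtain ⟨h1, h2⟩ := hmain Ω f u G H x₀ μ h N K uh
    ⟨S, R, ⟨hd, S.isConvexDomain, hh, hK, hσ, hinv⟩, hx₀, hop⟩ hh2 e he
  rw [mul_assoc]
  refine le_trans (OlikerPrussner.rpow_sum_le N.inner
    (fun z => OlikerPrussner.weight_nonneg S hlam z) (fun z => abs_nonneg _) hp hT hB hh.le h1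
    h2) ?_
  gcongr
  exact OlikerPrussner.rpow_le_rate hd hp hh hh2
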